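/- **Setting.** Let $p_{i,j}\ge 0$, $(i,j)\in\{-1,0,1\}^2$, be real weights with $\sum p_{i,j}=1$ and zero drift, $\sum i\,p_{i,j}=\sum j\,p_{i,j}=0$, such that the cyclic list $p_{1,1},p_{1,0},p_{1,-1},p_{0,-1},p_{-1,-1},p_{-1,0},p_{-1,1},p_{0,1}$ does not contain three consecutive zeros. Let $$K(x,y)=xy\Big(\sum p_{i,j}x^{-i}y^{-j}-1\Big)=a(x)y^2+b(x)y+c(x)=\tilde a(y)x^2+\tilde b(y)x+\tilde c(y),$$ let $X_\pm(y)$ be the roots of $K(\cdot,y)=0$ and $Y_\pm(x)$ the roots of $K(x,\cdot)=0$ (as algebraic functions). Let $\Phi:(x,y)\mapsto\big(x^{-1}\tilde c(y)/\tilde a(y),\,y\big)$ and $\Psi:(x,y)\mapsto\big(x,\,y^{-1}c(x)/a(x)\big)$, regarded as substitution automorphisms of $\mathbb R(x,y)$; the group $\mathcal G$ of the model is generated by $\Phi,\Psi$. Put $\Theta=\Phi\circ\Psi$ (a product of automorphisms), and let $\operatorname{sgn}(\gamma)=\pm1$ according to whether $\gamma\in\mathcal G$ is a product of an even or an odd number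 of the generators. Let $$\theta=\arccos\Big(-\frac{\sum ij\,p_{i,j}}{\sqrt{\sum i^2p_{i,j}}\sqrt{\sum j^2p_{i,j}}}\Big).$$ For a function $h$ on $\{0,1,2,\dots\}^2$, extended by $0$ to $\mathbb Z^2$, let $\triangle h(i,j)=\sum_{u,v} p_{u,v}h(i+u,j+v)-h(i,j)$ for $i,j\geq 0$; $h$ is $n$-polyharmonic if $\triangle^n h=0$. We identify $h$ with its generating function $H(x,y)=\sum_{i,j\ge0}h(i,j)x^iy^j$, and denote by $\mathcal H_n$ the space of real-valued $n$-polyharmonic functions. $F(x)$ is a decoupling function of $M(x,y)$ if $F(x)+G(y)\equiv M(x,y)\bmod K(x,y)$ for some $G(y)$. **Assumptions.** The group $\mathcal G$ is finite, of order $2N$, and $m:=\pi/\theta\in\mathbb Z$. **The gluing function.** Let $\omega$ be the conformal gluing function of the model, normalised by $\omega(0)=0$; it is determined up to a nonzero factor, which is fixed arbitrarily. Explicitly, with $q(x)=\frac{b(x)^2-4a(x)c(x)}{(x-1)^2}$ (a polynomial $q_2x^2+q_1x+q_0$), $v(x)=\frac{2q(1)}{x-1}+q'(1)$, $A=\frac{q_1^2-4q_0q_2}{4}$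 and the Dickson polynomials $D_0=2$, $D_1(v)=v$, $D_{r+2}(v)=vD_{r+1}(v)-A\,D_{r}(v)$, $$\omega(x)=C\,\big(D_m(v(x))-D_m(v(0))\big),\qquad C\in\mathbb R\setminus\{0\}.$$ It is a rational function with $\omega(0)=0$ and $\omega(X_+)=\omega(X_-)$, and of the form $g(x)/(1-x)^m$ with $g$ a polynomial, $g(1)\neq0$. **Construction.** Let $d_0=\omega(X_+(0))$, i.e. the value at $y=0$ of the rational function $\omega(X_+(y))$ of $y$, and $P_{2k}(z)=z^k(z-d_0)^k$, $P_{2k+1}(z)=z^{k+1}(z-d_0)^k$. For $k\ge0$ put $$H_1^k(x,y)=\frac{P_k(\omega(x))-P_k(\omega(X_+(y)))}{K(x,y)},$$ and for $n\ge1$ $$F_n^k(x)=-\frac1N\sum_{i=1}^{N-1}i\,\Big[\big(\Theta^iM\big)(x,Y_+(x))+\big(\Theta^iM\big)(x,Y_-(x))\Big],\qquad M=xyH_n^k(x,y),$$ $$H_{n+1}^k(x,y)=\frac{xyH_n^k(x,y)-F_n^k(x)-\big[X_+yH_n^k(X_+,y)-F_n^k(X_+)\big]}{K(x,y)} .$$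 **Theorem.** This inductive construction is possible: at every step all the substitutions are defined, $\omega(X_+(y))$ and the bracket $X_+yH_n^k(X_+,y)-F_n^k(X_+)$ are rational functions of $y$, and $F_n^k$ is a rational function of $x$, so that $H_n^k\in\mathbb R(x,y)$. Moreover, for all $n\ge1$ and $k\ge0$: 1. $F_n^k$ is a decoupling function of $xyH_n^k$; 2. $H_n^k$ is the generating function of an element of $\mathcal H_n$, and $\triangle H_{n+1}^k=H_n^k$; 3. the signed orbit sum of $xyH_n^k$ vanishes: $\sum_{\gamma\in\mathcal G}\operatorname{sgn}(\gamma)\,\gamma\big(xyH_n^k(x,y)\big)=0$; 4. there is a polynomial $p_{n,k}\in\mathbb R[x,y]$ such that $$H_n^k(x,y)=\frac{p_{n,k}(x,y)}{(1-x)^{\alpha}(1-y)^{\alpha}},\qquad \alpha=k\cdot\frac{\pi}{\theta}+2(n-1).$$ -/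

import Mathlib

namespace QuadrantWalk

open Polynomial

noncomputable section

/-! ### Step sets -/

/-- A weighted small-step set in the plane: transition probabilities `p i j` of a homogeneous random
walk on `ℤ × ℤ` with steps in `{-1,0,1}²`, non-degenerate and with zero drift. -/
structure StepModel where
  p : ℤ → ℤ → ℝ
  nonneg : ∀ i j, 0 ≤ p i j
  small : ∀ i j, p i j ≠ 0 → i ∈ Finset.Icc (-1 : ℤ) 1 ∧ j ∈ Finset.Icc (-1 : ℤ) 1
  sum_eq_one : ∑ i ∈ Finset.Icc (-1 : ℤ) 1, ∑ j ∈ Finset.Icc (-1 : ℤ) 1, p i j = 1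
  /-- The cyclic list of the eight weights around the origin has no three consecutive zeros. -/
  nondegenerate : ∀ t : Fin 8,
    let l : Fin 8 → ℝ :=
      ![p 1 1, p 1 0, p 1 (-1), p 0 (-1), p (-1) (-1), p (-1) 0, p (-1) 1, p 0 1]
    ¬ (l t = 0 ∧ l (t + 1) = 0 ∧ l (t + 2) = 0)
  drift_x : ∑ i ∈ Finset.Icc (-1 : ℤ) 1, ∑ j ∈ Finset.Icc (-1 : ℤ) 1, (i : ℝ) * p i j = 0
  drift_y : ∑ i ∈ Finset.Icc (-1 : ℤ) 1, ∑ j ∈ Finset.Icc (-1 : ℤ) 1, (j : ℝ) * p i j = 0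

/-! ### Rational functions -/

/-- The field `ℝ(x, y)`. -/
abbrev RatXY : Type := FractionRing (MvPolynomial (Fin 2) ℝ)

/-- The variable `x` of `ℝ(x, y)`. -/
def xx : RatXY := algebraMap (MvPolynomial (Fin 2) ℝ) RatXY (MvPolynomial.X 0)

/-- The variable `y` of `ℝ(x, y)`. -/
def yy : RatXY := algebraMap (MvPolynomial (Fin 2) ℝ) RatXY (MvPolynomial.X 1)

/-- Substitution of an element `z` of a field for the variable of a univariate rational function. -/
def subst {E : Type} [Field E] [Algebra ℝ E] (f : RatFunc ℝ) (z : E) : E :=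
  RatFunc.eval (algebraMap ℝ E) z f

/-- `M(u, v)` is defined and equal to `w`, for a rational function `M(x, y)` and `u`, `v`, `w` in a
field: `M` is a quotient of polynomials whose denominator does not vanish at `(u, v)`. -/
def HasValueAt {E : Type} [Field E] [Algebra ℝ E] (M : RatXY) (u v w : E) : Prop :=
  ∃ P Q : MvPolynomial (Fin 2) ℝ,
    MvPolynomial.aeval ![u, v] Q ≠ 0 ∧
    M = algebraMap _ RatXY P / algebraMap _ RatXY Q ∧
    w = MvPolynomial.aeval ![u, v] P / MvPolynomial.aeval ![u, v] Q

/-- An algebraically closed field containing the rational functions `ℝ(t)` in one variable. -/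
abbrev AlgFun : Type := AlgebraicClosure (RatFunc ℝ)

/-- The variable `t` of `ℝ(t)`, as an algebraic function. -/
def tt : AlgFun := algebraMap (RatFunc ℝ) AlgFun RatFunc.X

/-- A fixed choice of a square root of an algebraic function. -/
def sqrtAlg (d : AlgFun) : AlgFun :=
  Classical.choose (IsAlgClosed.exists_pow_nat_eq d two_pos)

namespace StepModel

variable (S : StepModel)

/-! ### The kernel -/

/-- The kernel `K(x,y) = x y (∑ p_{i,j} x^{-i} y^{-j} - 1)`, a polynomial. -/
def kernel : MvPolynomial (Fin 2) ℝ :=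
  (∑ i ∈ Finset.Icc (-1 : ℤ) 1, ∑ j ∈ Finset.Icc (-1 : ℤ) 1,
      MvPolynomial.C (S.p i j) * MvPolynomial.X 0 ^ (1 - i).toNat *
        MvPolynomial.X 1 ^ (1 - j).toNat)
    - MvPolynomial.X 0 * MvPolynomial.X 1

/-- The kernel as an element of `ℝ(x, y)`. -/
def K : RatXY := algebraMap _ RatXY S.kernel

/-- `∑_i p_{i,j} x^{1-i}`. -/
def row (j : ℤ) : ℝ[X] := ∑ i ∈ Finset.Icc (-1 : ℤ) 1, C (S.p i j) * X ^ (1 - i).toNat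

/-- `∑_j p_{i,j} y^{1-j}`. -/
def col (i : ℤ) : ℝ[X] := ∑ j ∈ Finset.Icc (-1 : ℤ) 1, C (S.p i j) * X ^ (1 - j).toNat

/-- The coefficient `a` in `K(x,y) = a(x) y² + b(x) y + c(x)`. -/
def a : ℝ[X] := S.row (-1)

/-- The coefficient `b` in `K(x,y) = a(x) y² + b(x) y + c(x)`. -/
def b : ℝ[X] := S.row 0 - X

/-- The coefficient `c` in `K(x,y) = a(x) y² + b(x) y + c(x)`. -/
def c : ℝ[X] := S.row 1

/-- The coefficient `ã` in `K(x,y) = ã(y) x² + b̃(y) x + c̃(y)`. -/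
def aT : ℝ[X] := S.col (-1)

/-- The coefficient `b̃` in `K(x,y) = ã(y) x² + b̃(y) x + c̃(y)`. -/
def bT : ℝ[X] := S.col 0 - X

/-- The coefficient `c̃` in `K(x,y) = ã(y) x² + b̃(y) x + c̃(y)`. -/
def cT : ℝ[X] := S.col 1

/-- The square root of the discriminant `b̃(y)² - 4 ã(y) c̃(y)`, where `y` is the variable `tt`. -/
def sqrtDiscX : AlgFun := sqrtAlg (aeval tt S.bT ^ 2 - 4 * aeval tt S.aT * aeval tt S.cT)

/-- The branch `X_+(y)` of `K(X, y) = 0`, where `y` is the variable `tt`. -/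
def Xplus : AlgFun := (-aeval tt S.bT + S.sqrtDiscX) / (2 * aeval tt S.aT)

/-- The branch `X_-(y)` of `K(X, y) = 0`, where `y` is the variable `tt`. -/
def Xminus : AlgFun := (-aeval tt S.bT - S.sqrtDiscX) / (2 * aeval tt S.aT)

/-- The square root of the discriminant `b(x)² - 4 a(x) c(x)`, where `x` is the variable `tt`. -/
def sqrtDiscY : AlgFun := sqrtAlg (aeval tt S.b ^ 2 - 4 * aeval tt S.a * aeval tt S.c)

/-- The branch `Y_+(x)` of `K(x, Y) = 0`, where `x` is the variable `tt`. -/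
def Yplus : AlgFun := (-aeval tt S.b + S.sqrtDiscY) / (2 * aeval tt S.a)

/-- The branch `Y_-(x)` of `K(x, Y) = 0`, where `x` is the variable `tt`. -/
def Yminus : AlgFun := (-aeval tt S.b - S.sqrtDiscY) / (2 * aeval tt S.a)

/-! ### The angle and the conformal gluing function -/

/-- The angle `θ = arccos (- ∑ i j p_{i,j} / (√(∑ i² p_{i,j}) √(∑ j² p_{i,j})))`. -/
def theta : ℝ :=
  Real.arccos (-(∑ i ∈ Finset.Icc (-1 : ℤ) 1, ∑ j ∈ Finset.Icc (-1 : ℤ) 1,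
      (i : ℝ) * (j : ℝ) * S.p i j) /
    (√(∑ i ∈ Finset.Icc (-1 : ℤ) 1, ∑ j ∈ Finset.Icc (-1 : ℤ) 1, (i : ℝ) ^ 2 * S.p i j) *
     √(∑ i ∈ Finset.Icc (-1 : ℤ) 1, ∑ j ∈ Finset.Icc (-1 : ℤ) 1, (j : ℝ) ^ 2 * S.p i j)))

/-- The quadratic polynomial `q(x) = (b(x)² - 4 a(x) c(x)) / (x - 1)²`, whose roots are the branch
points `x₁ ∈ [-1, 1)` and `x₄` of `Y_±` (one root only if `x₄ = ∞`); by zero drift the division is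
exact. -/
def branchQuad : ℝ[X] := (S.b ^ 2 - 4 * S.a * S.c) /ₘ (X - C 1) ^ 2

/-- The Möbius function `v(x) = 2 q(1) / (x - 1) + q'(1)`. It maps `1` to `∞` and the branch points
`x₁`, `x₄` to `± √disc(q)`. -/
def moebius : RatFunc ℝ :=
  RatFunc.C (2 * S.branchQuad.eval 1) / (RatFunc.X - 1) +
    RatFunc.C ((derivative S.branchQuad).eval 1)

/-- A quarter of the discriminant of `q`. -/
def quarterDisc : ℝ :=
  (S.branchQuad.coeff 1 ^ 2 - 4 * S.branchQuad.coeff 2 * S.branchQuad.coeff 0) / 4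

/-- The conformal gluing function `ω` of the model in the case `π/θ = m ∈ ℤ`, normalised by
`ω(0) = 0`, up to a multiplicative constant. In general `ω(x) = C (w(x) - w(0))` with
`w(x) = sin² ((π/θ) (arcsin T(x) - π/2))`, where `2 T² - 1` is the Möbius function mapping the
points `1`, `x₁`, `x₄` to `∞`, `1`, `-1`. For `π/θ = m`, `w` is an affine function of the value at
`2 T² - 1` of the `m`-th Chebyshev polynomial. The Dickson polynomial
`D_m(v, A) = 2 A^{m/2} T_m(v / (2 √A))` is the homogenised Chebyshev polynomial, so that no case
distinction is needed when `x₁ = x₄`. -/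
def omega (m : ℕ) : RatFunc ℝ :=
  aeval S.moebius (dickson 1 S.quarterDisc m) -
    RatFunc.C ((dickson 1 S.quarterDisc m).eval (subst S.moebius (0 : ℝ)))

end StepModel

/-! ### The group of the walk -/

section Aux

lemma algebraMap_ne_zero {P : MvPolynomial (Fin 2) ℝ} (h : P ≠ 0) :
    algebraMap (MvPolynomial (Fin 2) ℝ) RatXY P ≠ 0 := by
  simpa using h

lemma xx_ne_zero : xx ≠ 0 := algebraMap_ne_zero (MvPolynomial.X_ne_zero 0)

lemma yy_ne_zero : yy ≠ 0 := algebraMap_ne_zero (MvPolynomial.X_ne_zero 1)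

lemma algebraMap_eq_aeval (P : MvPolynomial (Fin 2) ℝ) :
    algebraMap (MvPolynomial (Fin 2) ℝ) RatXY P = MvPolynomial.aeval ![xx, yy] P := by
  have : (IsScalarTower.toAlgHom ℝ (MvPolynomial (Fin 2) ℝ) RatXY) =
      MvPolynomial.aeval ![xx, yy] := by
    ext i
    fin_cases i <;> simp [xx, yy]
  exact DFunLike.congr_fun this P

lemma aeval_injective (u v : RatXY)
    (hx : IsAlgebraic (Algebra.adjoin ℝ (Set.range ![u, v])) xx)
    (hy : IsAlgebraic (Algebra.adjoin ℝ (Set.range ![u, v])) yy) :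
    Function.Injective (MvPolynomial.aeval ![u, v] : MvPolynomial (Fin 2) ℝ →ₐ[ℝ] RatXY) := by
  have key : ∀ P : MvPolynomial (Fin 2) ℝ, IsAlgebraic (Algebra.adjoin ℝ (Set.range ![u, v]))
      (algebraMap (MvPolynomial (Fin 2) ℝ) RatXY P) := by
    intro P
    induction P using MvPolynomial.induction_on with
    | C r =>
      have := isAlgebraic_algebraMap (A := RatXY)
        (algebraMap ℝ (Algebra.adjoin ℝ (Set.range ![u, v])) r)
      rw [← IsScalarTower.algebraMap_apply ℝ _ RatXY] at this
      rwa [← MvPolynomial.algebraMap_eq, ← IsScalarTower.algebraMap_apply ℝ _ RatXY]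
    | add P Q hP hQ => rw [map_add]; exact hP.add hQ
    | mul_X P i hP =>
      rw [map_mul]
      refine hP.mul ?_
      fin_cases i
      · exact hx
      · exact hy
  have : Algebra.IsAlgebraic (Algebra.adjoin ℝ (Set.range ![u, v])) RatXY := by
    refine ⟨fun z => ?_⟩
    obtain ⟨P, Q, -, rfl⟩ := IsFractionRing.div_surjective (A := MvPolynomial (Fin 2) ℝ) (K := RatXY) z
    rw [div_eq_mul_inv]
    exact (key P).mul (key Q).inv
  have hb : IsTranscendenceBasis ℝ ![u, v] := by
    apply Algebra.IsAlgebraic.isTranscendenceBasis_of_le_trdeg_of_finite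
    have h1 : Algebra.trdeg ℝ (MvPolynomial (Fin 2) ℝ) ≤ Algebra.trdeg ℝ RatXY :=
      trdeg_le_of_injective
        (IsScalarTower.toAlgHom ℝ (MvPolynomial (Fin 2) ℝ) RatXY)
        (IsFractionRing.injective (MvPolynomial (Fin 2) ℝ) RatXY)
    simpa using h1
  exact hb.1

/-- The endomorphism `M(x, y) ↦ M(u, v)` of `ℝ(x, y)`. -/
def substHom (u v : RatXY)
    (h : Function.Injective (MvPolynomial.aeval ![u, v] : MvPolynomial (Fin 2) ℝ →ₐ[ℝ] RatXY)) :
    RatXY →ₐ[ℝ] RatXY :=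
  IsFractionRing.liftAlgHom (g := MvPolynomial.aeval ![u, v]) h

lemma substHom_xx (u v : RatXY) (h) : substHom u v h xx = u := by
  simp [substHom, xx, IsFractionRing.liftAlgHom_apply]

lemma substHom_yy (u v : RatXY) (h) : substHom u v h yy = v := by
  simp [substHom, yy, IsFractionRing.liftAlgHom_apply]

lemma algHom_ext' {f g : RatXY →ₐ[ℝ] RatXY} (hx : f xx = g xx) (hy : f yy = g yy) : f = g := by
  refine AlgHom.ext fun z => ?_
  obtain ⟨P, Q, -, rfl⟩ := IsFractionRing.div_surjective (A := MvPolynomial (Fin 2) ℝ) (K := RatXY) z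
  have key : ∀ P : MvPolynomial (Fin 2) ℝ, f (algebraMap _ RatXY P) = g (algebraMap _ RatXY P) := by
    intro P
    have e : ∀ k : RatXY →ₐ[ℝ] RatXY, k (algebraMap _ RatXY P) =
        MvPolynomial.aeval ![k xx, k yy] P := by
      intro k
      rw [algebraMap_eq_aeval, MvPolynomial.comp_aeval_apply]
      congr 2
      funext i
      fin_cases i <;> rfl
    rw [e f, e g, hx, hy]
  rw [map_div₀, map_div₀, key, key]

lemma isAlgebraic_of_mem {R : Subalgebra ℝ RatXY} {z : RatXY} (h : z ∈ R) : IsAlgebraic R z :=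
  isAlgebraic_algebraMap (A := RatXY) (⟨z, h⟩ : R)

lemma aeval_mem_adjoin {s : Set RatXY} {z : RatXY} (h : z ∈ s) (f : ℝ[X]) :
    aeval z f ∈ Algebra.adjoin ℝ s :=
  Algebra.adjoin_mono (Set.singleton_subset_iff.mpr h) (aeval_mem_adjoin_singleton ℝ z)

lemma aeval_xx_ne_zero {f : ℝ[X]} (h : f ≠ 0) : aeval xx f ≠ 0 := by
  intro h0
  have ht : AlgebraicIndependent ℝ ![xx, yy] := by
    refine aeval_injective xx yy ?_ ?_ <;>
    exact isAlgebraic_of_mem (Algebra.subset_adjoin (by simp))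
  exact h (transcendental_iff.mp (ht.transcendental 0) f (by simpa using h0))

lemma aeval_yy_ne_zero {f : ℝ[X]} (h : f ≠ 0) : aeval yy f ≠ 0 := by
  intro h0
  have ht : AlgebraicIndependent ℝ ![xx, yy] := by
    refine aeval_injective xx yy ?_ ?_ <;>
    exact isAlgebraic_of_mem (Algebra.subset_adjoin (by simp))
  exact h (transcendental_iff.mp (ht.transcendental 1) f (by simpa using h0))

end Aux

namespace StepModel

variable (S : StepModel)

lemma row_ne_zero (j : ℤ) (h : S.p (-1) j ≠ 0 ∨ S.p 0 j ≠ 0 ∨ S.p 1 j ≠ 0) : S.row j ≠ 0 := by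
  intro h0
  have e : Finset.Icc (-1 : ℤ) 1 = {-1, 0, 1} := rfl
  have c0 := congrArg (fun f => coeff f 0) h0
  have c1 := congrArg (fun f => coeff f 1) h0
  have c2 := congrArg (fun f => coeff f 2) h0
  simp [row, e, coeff_X, coeff_C, coeff_X_pow] at c0 c1 c2
  tauto

lemma col_ne_zero (i : ℤ) (h : S.p i (-1) ≠ 0 ∨ S.p i 0 ≠ 0 ∨ S.p i 1 ≠ 0) : S.col i ≠ 0 := by
  intro h0
  have e : Finset.Icc (-1 : ℤ) 1 = {-1, 0, 1} := rfl
  have c0 := congrArg (fun f => coeff f 0) h0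
  have c1 := congrArg (fun f => coeff f 1) h0
  have c2 := congrArg (fun f => coeff f 2) h0
  simp [col, e, coeff_X, coeff_C, coeff_X_pow] at c0 c1 c2
  tauto

lemma a_ne_zero : S.a ≠ 0 := S.row_ne_zero (-1) (by
  have h := S.nondegenerate 2
  by_contra! h'
  exact h ⟨h'.2.2, h'.2.1, h'.1⟩)

lemma c_ne_zero : S.c ≠ 0 := S.row_ne_zero 1 (by
  have h := S.nondegenerate 6
  by_contra! h'
  exact h ⟨h'.1, h'.2.1, h'.2.2⟩)

lemma aT_ne_zero : S.aT ≠ 0 := S.col_ne_zero (-1) (by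
  have h := S.nondegenerate 4
  by_contra! h'
  exact h ⟨h'.1, h'.2.1, h'.2.2⟩)

lemma cT_ne_zero : S.cT ≠ 0 := S.col_ne_zero 1 (by
  have h := S.nondegenerate 0
  by_contra! h'
  exact h ⟨h'.2.2, h'.2.1, h'.1⟩)

/-- The image `x⁻¹ c̃(y) / ã(y)` of `x` under `Φ`. -/
def phiX : RatXY := xx⁻¹ * (aeval yy S.cT / aeval yy S.aT)

/-- The image `y⁻¹ c(x) / a(x)` of `y` under `Ψ`. -/
def psiY : RatXY := yy⁻¹ * (aeval xx S.c / aeval xx S.a)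

lemma phi_injective : Function.Injective
    (MvPolynomial.aeval ![S.phiX, yy] : MvPolynomial (Fin 2) ℝ →ₐ[ℝ] RatXY) := by
  have hu : S.phiX ∈ Algebra.adjoin ℝ (Set.range ![S.phiX, yy]) :=
    Algebra.subset_adjoin (by simp)
  have hv : yy ∈ Set.range ![S.phiX, yy] := by simp
  refine aeval_injective _ _ ?_ (isAlgebraic_of_mem (Algebra.subset_adjoin hv))
  have hx : xx = S.phiX⁻¹ * (aeval yy S.cT * (aeval yy S.aT)⁻¹) := by
    have h1 := aeval_yy_ne_zero S.aT_ne_zero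
    have h2 := aeval_yy_ne_zero S.cT_ne_zero
    have h3 := xx_ne_zero
    rw [phiX]
    field_simp
  rw [hx]
  exact (isAlgebraic_of_mem hu).inv.mul ((isAlgebraic_of_mem (aeval_mem_adjoin hv _)).mul
    (isAlgebraic_of_mem (aeval_mem_adjoin hv _)).inv)

lemma psi_injective : Function.Injective
    (MvPolynomial.aeval ![xx, S.psiY] : MvPolynomial (Fin 2) ℝ →ₐ[ℝ] RatXY) := by
  have hu : S.psiY ∈ Algebra.adjoin ℝ (Set.range ![xx, S.psiY]) :=
    Algebra.subset_adjoin (by simp)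
  have hv : xx ∈ Set.range ![xx, S.psiY] := by simp
  refine aeval_injective _ _ (isAlgebraic_of_mem (Algebra.subset_adjoin hv)) ?_
  have hy : yy = S.psiY⁻¹ * (aeval xx S.c * (aeval xx S.a)⁻¹) := by
    have h1 := aeval_xx_ne_zero S.a_ne_zero
    have h2 := aeval_xx_ne_zero S.c_ne_zero
    have h3 := yy_ne_zero
    rw [psiY]
    field_simp
  rw [hy]
  exact (isAlgebraic_of_mem hu).inv.mul ((isAlgebraic_of_mem (aeval_mem_adjoin hv _)).mul
    (isAlgebraic_of_mem (aeval_mem_adjoin hv _)).inv)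

/-- The substitution `Φ : x ↦ x⁻¹ c̃(y) / ã(y), y ↦ y` as an endomorphism of `ℝ(x, y)`. -/
def phiHom : RatXY →ₐ[ℝ] RatXY := substHom S.phiX yy S.phi_injective

/-- The substitution `Ψ : x ↦ x, y ↦ y⁻¹ c(x) / a(x)` as an endomorphism of `ℝ(x, y)`. -/
def psiHom : RatXY →ₐ[ℝ] RatXY := substHom xx S.psiY S.psi_injective

lemma phiHom_comp : S.phiHom.comp S.phiHom = AlgHom.id ℝ RatXY := by
  have hx : S.phiHom xx = S.phiX := substHom_xx _ _ _
  have hy : S.phiHom yy = yy := substHom_yy _ _ _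
  have h1 := aeval_yy_ne_zero S.aT_ne_zero
  have h2 := aeval_yy_ne_zero S.cT_ne_zero
  have h3 := xx_ne_zero
  apply algHom_ext'
  · simp only [AlgHom.comp_apply, hx, AlgHom.id_apply]
    rw [phiX, map_mul, map_div₀, map_inv₀, hx, ← aeval_algHom_apply, ← aeval_algHom_apply, hy,
      phiX]
    field_simp
  · simp [hy]

lemma psiHom_comp : S.psiHom.comp S.psiHom = AlgHom.id ℝ RatXY := by
  have hx : S.psiHom xx = xx := substHom_xx _ _ _
  have hy : S.psiHom yy = S.psiY := substHom_yy _ _ _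
  have h1 := aeval_xx_ne_zero S.a_ne_zero
  have h2 := aeval_xx_ne_zero S.c_ne_zero
  have h3 := yy_ne_zero
  apply algHom_ext'
  · simp [hx]
  · simp only [AlgHom.comp_apply, hy, AlgHom.id_apply]
    rw [psiY, map_mul, map_div₀, map_inv₀, hy, ← aeval_algHom_apply, ← aeval_algHom_apply, hx,
      psiY]
    field_simp

/-- The involution `Φ` of `ℝ(x, y)`. -/
def Phi : RatXY ≃ₐ[ℝ] RatXY := AlgEquiv.ofAlgHom S.phiHom S.phiHom S.phiHom_comp S.phiHom_comp

/-- The involution `Ψ` of `ℝ(x, y)`. -/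
def Psi : RatXY ≃ₐ[ℝ] RatXY := AlgEquiv.ofAlgHom S.psiHom S.psiHom S.psiHom_comp S.psiHom_comp

/-- `Θ = Φ ∘ Ψ`. -/
def Theta : RatXY ≃ₐ[ℝ] RatXY := S.Phi * S.Psi

/-- The group of the model, generated by `Φ` and `Ψ`. -/
def group : Subgroup (RatXY ≃ₐ[ℝ] RatXY) := Subgroup.closure {S.Phi, S.Psi}

open scoped Classical in
/-- The sign of an element of the group: `1` for products of an even number of the involutions `Φ`
and `Ψ`, that is, for powers of `Θ = Φ Ψ`, and `-1` for products of an odd number of them. -/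
def sgn (γ : RatXY ≃ₐ[ℝ] RatXY) : ℝ := if γ ∈ Subgroup.zpowers S.Theta then 1 else -1

/-- The signed orbit sum `∑_γ sgn(γ) γ(M)` over the (finite) group. -/
def orbitSum (M : RatXY) : RatXY :=
  ∑ᶠ γ : S.group, S.sgn γ.1 • γ.1 M

/-! ### Decoupling functions -/

/-- Congruence of rational functions modulo `K(x, y)`: the difference is a multiple of `K` by a
rational function whose denominator is not divisible by `K`. -/
def CongrModK (M N : RatXY) : Prop :=
  ∃ P Q : MvPolynomial (Fin 2) ℝ, ¬ S.kernel ∣ Q ∧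
    M - N = S.K * (algebraMap _ RatXY P / algebraMap _ RatXY Q)

/-- `F(x)` is a decoupling function of `M(x, y)`: `F(x) + G(y) ≡ M(x, y) mod K(x, y)` for some
`G(y)`. -/
def IsDecoupling (M : RatXY) (F : RatFunc ℝ) : Prop :=
  ∃ G : RatFunc ℝ, S.CongrModK (subst F xx + subst G yy) M

/-- `F` is given by the orbit sum formula
`F(x) = -(1/n) ∑_{i=1}^{n-1} i ((Θ^i M)(x, Y_+(x)) + (Θ^i M)(x, Y_-(x)))`, where `2 n` is the order
of the group; in particular, all the values on the right-hand side are defined. -/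
def IsDecouplingFormula (M : RatXY) (F : RatFunc ℝ) : Prop :=
  ∃ vp vm : ℕ → AlgFun,
    (∀ i ∈ Finset.Ico 1 (Nat.card S.group / 2),
      HasValueAt ((S.Theta ^ i) M) tt S.Yplus (vp i) ∧
      HasValueAt ((S.Theta ^ i) M) tt S.Yminus (vm i)) ∧
    algebraMap (RatFunc ℝ) AlgFun F = -(1 / ((Nat.card S.group / 2 : ℕ) : AlgFun)) *
      ∑ i ∈ Finset.Ico 1 (Nat.card S.group / 2), (i : AlgFun) * (vp i + vm i)

/-! ### Discrete polyharmonic functions -/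

/-- The discrete Laplacian `Δf(i,j) = ∑ p_{u,v} f(i+u, j+v) - f(i,j)` on functions on the quarter
plane `i, j ≥ 0`, which are extended by `0` (Dirichlet boundary conditions). -/
def laplacian (f : ℕ → ℕ → ℝ) : ℕ → ℕ → ℝ := fun i j =>
  (∑ u ∈ Finset.Icc (-1 : ℤ) 1, ∑ v ∈ Finset.Icc (-1 : ℤ) 1,
    S.p u v * (if 0 ≤ (i : ℤ) + u ∧ 0 ≤ (j : ℤ) + v then
      f ((i : ℤ) + u).toNat ((j : ℤ) + v).toNat else 0)) - f i j

/-- `f` is discrete `n`-polyharmonic: `Δ^n f = 0`. -/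
def IsPolyharmonic (n : ℕ) (f : ℕ → ℕ → ℝ) : Prop := S.laplacian^[n] f = 0

end StepModel

/-- The rational function `H(x, y)` is regular at `(0, 0)` and its power series there is
`∑_{i,j ≥ 0} h(i,j) x^i y^j`. -/
def IsGeneratingFunction (H : RatXY) (h : ℕ → ℕ → ℝ) : Prop :=
  ∃ P Q : MvPolynomial (Fin 2) ℝ, MvPolynomial.constantCoeff Q ≠ 0 ∧
    H = algebraMap _ RatXY P / algebraMap _ RatXY Q ∧
    (Q : MvPowerSeries (Fin 2) ℝ) * (show MvPowerSeries (Fin 2) ℝ from fun d => h (d 0) (d 1)) =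
      (P : MvPowerSeries (Fin 2) ℝ)

/-- `P_{2k} = z^k (z - d)^k` and `P_{2k+1} = z^{k+1} (z - d)^k`. -/
def basisPoly (d : ℝ) (k : ℕ) : ℝ[X] := X ^ ((k + 1) / 2) * (X - C d) ^ (k / 2)

/-- `H n k`, for `n ≥ 1` and `k ≥ 0`, is the family of functions `H_n^k(x, y)` that is built
inductively from `ω`. Here `ωX` is `ω(X_+(y))` as a rational function of `y`, `F n k` is the
decoupling function of `x y H_n^k(x, y)`, and `G n k` is the bracket
`X_+ y H_n^k(X_+, y) - F_n^k(X_+)` as a rational function of `y`. All these objects are determined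
by `S` and `ω`. -/
structure IsPolyharmonicFamily (S : StepModel) (ω ωX : RatFunc ℝ) (H : ℕ → ℕ → RatXY)
    (F G : ℕ → ℕ → RatFunc ℝ) : Prop where
  omegaX : algebraMap (RatFunc ℝ) AlgFun ωX = subst ω S.Xplus
  harmonic : ∀ k, H 1 k =
    (aeval (subst ω xx) (basisPoly (subst ωX (0 : ℝ)) k) -
      aeval (subst ωX yy) (basisPoly (subst ωX (0 : ℝ)) k)) / S.K
  decoupling : ∀ n k, 1 ≤ n → S.IsDecouplingFormula (xx * yy * H n k) (F n k)
  bracket : ∀ n k, 1 ≤ n → ∃ w : AlgFun, HasValueAt (H n k) S.Xplus tt w ∧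
    algebraMap (RatFunc ℝ) AlgFun (G n k) = S.Xplus * tt * w - subst (F n k) S.Xplus
  step : ∀ n k, 1 ≤ n →
    H (n + 1) k = (xx * yy * H n k - subst (F n k) xx - subst (G n k) yy) / S.K

end

end QuadrantWalk

/-!
The kernel curve becomes an ellipse. The drift being zero, `K(x, y)` has a double point at
`(1, 1)`, and in the coordinates `u = 1/(x-1)`, `w = 1/(y-1)` one has `K u² w² = E(u, w)`, where
`E` is quadratic with positive definite leading part (`StepModel.ellipse`, `StepModel.aeval_kernel_mul`).
On the curve `E = 0`, the involutions `Φ` and `Ψ` restrict to the affine reflections that exchange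
the two points with the same `w`, respectively with the same `u` (`StepModel.Restricts.phi`,
`StepModel.Restricts.psi`). In particular they preserve the polynomials in `u`, `w` and do not
raise their degree. All the rational functions of the construction are such polynomials: it turns
out that `H_n = u² w² R_n(u, w)`.

*Gluing.* The ellipse is parametrised by `s` in such a way that `v(x) = s + A/s` is affine in `u`
and that the corresponding affine function of `w` is proportional to `e^{iθ} s + A/(e^{iθ} s)`.
The Dickson polynomial `D_m` maps them to `s^m + (A/s)^m` and to its multiple by `e^{imθ} = -1`,
so that `ω`, a polynomial in `u`, is on the curve also a polynomial in `w`, and `ω(X_+) = ω(X_-)`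
is a rational function of `y` (`Ellipse.dickson_centred`, `StepModel.exists_gluing`).

*Harmonic functions.* The difference of `P_k(ω)` as a polynomial in `u` and as a polynomial in `w`
has degree at most `k m` and vanishes on the ellipse. Hence it is `E` times a polynomial of degree
at most `k m - 2` (`Ellipse.exists_eq_poly_mul`), and dividing by `K` gives `H_1 = u² w² R_1`.

*The inductive step.* If the signed orbit sum of `M = x y H_n` vanishes, then on the curve `M` is
the sum of a polynomial `F(u)`, the average over the orbit in the definition of `F_n`, and of a
polynomial `G(w)`: summation by parts shows that `M - F` is invariant under the reflection that
fixes `w`, and functions invariant under a reflection are polynomials in the fixed coordinate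
(`Ellipse.exists_decoupling`, `Ellipse.exists_trace`). Since `M - F - G` vanishes on the ellipse,
it is `E R_{n+1}`, and the degree of `R_{n+1}` exceeds that of `R_n` by at most `2`
(`StepModel.exists_step`). The orbit sum of `x y H_{n+1} = (x y / K) (M - F - G)` vanishes again,
because `x y / K` is invariant under the group and the orbit sums of functions of one variable
vanish (`StepModel.orbitSum_form`).

*Polyharmonicity.* The coefficient of `x^{i+1} y^{j+1}` in `K H` is `△h(i, j)`, and adding a
function of `x` or of `y` does not change these coefficients. So
`K H_{n+1} = x y H_n - F_n(x) - G_n(y)` says that `△H_{n+1} = H_n` (`StepModel.laplacian_of_step`).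
The poles at `x = 1` and `y = 1` have order at most `deg R_n + 2`.
-/

namespace QuadrantWalk

open Polynomial

noncomputable section

/-! ### Values of rational functions -/

section Values

variable {E : Type} [Field E] [Algebra ℝ E] {M M' : RatXY} {u v w w' : E}

lemma aeval_ne_zero_imp {Q : MvPolynomial (Fin 2) ℝ} (h : MvPolynomial.aeval ![u, v] Q ≠ 0) :
    algebraMap (MvPolynomial (Fin 2) ℝ) RatXY Q ≠ 0 := by
  refine algebraMap_ne_zero ?_
  rintro rfl
  simp at h

lemma HasValueAt.unique (h : HasValueAt M u v w) (h' : HasValueAt M u v w') : w = w' := by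
  obtain ⟨P, Q, hQ, rfl, rfl⟩ := h
  obtain ⟨P', Q', hQ', e, rfl⟩ := h'
  rw [div_eq_div_iff (aeval_ne_zero_imp hQ) (aeval_ne_zero_imp hQ'), ← map_mul, ← map_mul] at e
  have e' := congrArg (MvPolynomial.aeval ![u, v])
    (IsFractionRing.injective (MvPolynomial (Fin 2) ℝ) RatXY e)
  rw [map_mul, map_mul] at e'
  rw [div_eq_div_iff hQ hQ', e']

lemma HasValueAt.add (h : HasValueAt M u v w) (h' : HasValueAt M' u v w') :
    HasValueAt (M + M') u v (w + w') := by
  obtain ⟨P, Q, hQ, rfl, rfl⟩ := h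
  obtain ⟨P', Q', hQ', rfl, rfl⟩ := h'
  refine ⟨P * Q' + Q * P', Q * Q', by simp [hQ, hQ'], ?_, ?_⟩
  · rw [div_add_div _ _ (aeval_ne_zero_imp hQ) (aeval_ne_zero_imp hQ')]
    simp only [map_add, map_mul]
  · rw [div_add_div _ _ hQ hQ']
    simp only [map_add, map_mul]

lemma HasValueAt.mul (h : HasValueAt M u v w) (h' : HasValueAt M' u v w') :
    HasValueAt (M * M') u v (w * w') := by
  obtain ⟨P, Q, hQ, rfl, rfl⟩ := h
  obtain ⟨P', Q', hQ', rfl, rfl⟩ := h'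
  refine ⟨P * P', Q * Q', by simp [hQ, hQ'], ?_, ?_⟩
  · simp only [map_mul, div_mul_div_comm]
  · simp only [map_mul, div_mul_div_comm]

lemma HasValueAt.inv (h : HasValueAt M u v w) (hw : w ≠ 0) : HasValueAt M⁻¹ u v w⁻¹ := by
  obtain ⟨P, Q, hQ, rfl, rfl⟩ := h
  refine ⟨Q, P, fun h0 => hw (by simp [h0]), ?_, ?_⟩ <;> simp only [inv_div]

lemma HasValueAt.div (h : HasValueAt M u v w) (h' : HasValueAt M' u v w') (hw : w' ≠ 0) :
    HasValueAt (M / M') u v (w / w') := by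
  rw [div_eq_mul_inv, div_eq_mul_inv]
  exact h.mul (h'.inv hw)

lemma hasValueAt_algebraMap (P : MvPolynomial (Fin 2) ℝ) :
    HasValueAt (algebraMap _ RatXY P) u v (MvPolynomial.aeval ![u, v] P) :=
  ⟨P, 1, by simp, by simp, by simp⟩

lemma hasValueAt_real (r : ℝ) : HasValueAt (algebraMap ℝ RatXY r) u v (algebraMap ℝ E r) := by
  have h := hasValueAt_algebraMap (u := u) (v := v) (MvPolynomial.C r)
  rwa [algebraMap_eq_aeval, MvPolynomial.aeval_C, MvPolynomial.aeval_C] at h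

lemma hasValueAt_one : HasValueAt (1 : RatXY) u v (1 : E) := by
  simpa using hasValueAt_real (u := u) (v := v) 1

lemma hasValueAt_zero : HasValueAt (0 : RatXY) u v (0 : E) := by
  simpa using hasValueAt_real (u := u) (v := v) 0

lemma hasValueAt_xx : HasValueAt xx u v u := by
  simpa [xx] using hasValueAt_algebraMap (u := u) (v := v) (MvPolynomial.X 0)

lemma hasValueAt_yy : HasValueAt yy u v v := by
  simpa [yy] using hasValueAt_algebraMap (u := u) (v := v) (MvPolynomial.X 1)

lemma HasValueAt.neg (h : HasValueAt M u v w) : HasValueAt (-M) u v (-w) := by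
  simpa using (hasValueAt_real (-1)).mul h

lemma HasValueAt.sub (h : HasValueAt M u v w) (h' : HasValueAt M' u v w') :
    HasValueAt (M - M') u v (w - w') := by
  rw [sub_eq_add_neg, sub_eq_add_neg]
  exact h.add h'.neg

lemma HasValueAt.sum {ι : Type*} (s : Finset ι) {M : ι → RatXY} {w : ι → E}
    (h : ∀ i ∈ s, HasValueAt (M i) u v (w i)) :
    HasValueAt (∑ i ∈ s, M i) u v (∑ i ∈ s, w i) := by
  classical
  induction s using Finset.induction_on with
  | empty => simpa using hasValueAt_zero
  | insert a s ha ih =>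
    rw [Finset.sum_insert ha, Finset.sum_insert ha]
    exact (h a (by simp)).add (ih fun i hi => h i (by simp [hi]))

lemma HasValueAt.aeval (h : HasValueAt M u v w) (f : ℝ[X]) :
    HasValueAt (aeval M f) u v (aeval w f) := by
  induction f using Polynomial.induction_on' with
  | add f g hf hg => simpa using hf.add hg
  | monomial n r =>
    induction n with
    | zero => simpa using hasValueAt_real r
    | succ n ih =>
      rw [← monomial_mul_X, map_mul, map_mul, aeval_X, aeval_X]
      exact ih.mul h

lemma HasValueAt.mvAeval (h : HasValueAt M u v w) (h' : HasValueAt M' u v w')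
    (f : MvPolynomial (Fin 2) ℝ) :
    HasValueAt (MvPolynomial.aeval ![M, M'] f) u v (MvPolynomial.aeval ![w, w'] f) := by
  induction f using MvPolynomial.induction_on with
  | C r => simpa using hasValueAt_real r
  | add f g hf hg => simpa using hf.add hg
  | mul_X f i hf =>
    rw [map_mul, map_mul, MvPolynomial.aeval_X, MvPolynomial.aeval_X]
    refine hf.mul ?_
    fin_cases i
    · exact h
    · exact h'

lemma algHom_algebraMap (σ : RatXY →ₐ[ℝ] RatXY) (P : MvPolynomial (Fin 2) ℝ) :
    σ (algebraMap _ RatXY P) = MvPolynomial.aeval ![σ xx, σ yy] P := by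
  rw [algebraMap_eq_aeval, MvPolynomial.comp_aeval_apply]
  congr 2
  funext i
  fin_cases i <;> rfl

/-- Evaluating `σ(M)`, for a substitution `σ`, is evaluating `M` at the values of `σ(x)`, `σ(y)`. -/
lemma HasValueAt.map (σ : RatXY →ₐ[ℝ] RatXY) {u' v' : E} (hx : HasValueAt (σ xx) u v u')
    (hy : HasValueAt (σ yy) u v v') (h : HasValueAt M u' v' w) : HasValueAt (σ M) u v w := by
  obtain ⟨P, Q, hQ, rfl, rfl⟩ := h
  rw [map_div₀, algHom_algebraMap, algHom_algebraMap]
  exact (hx.mvAeval hy P).div (hx.mvAeval hy Q) hQ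

lemma subst_div {f : ℝ[X]} {g : ℝ[X]} {z : E} (hg : aeval z g ≠ 0) :
    subst (algebraMap ℝ[X] (RatFunc ℝ) f / algebraMap ℝ[X] (RatFunc ℝ) g) z =
      aeval z f / aeval z g := by
  have hg0 : g ≠ 0 := by rintro rfl; simp at hg
  set r := algebraMap ℝ[X] (RatFunc ℝ) f / algebraMap ℝ[X] (RatFunc ℝ) g with hr
  have h1 : aeval z r.denom ≠ 0 := by
    obtain ⟨k, hk⟩ := RatFunc.denom_div_dvd f g
    intro h0
    rw [hk, map_mul, h0, zero_mul] at hg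
    exact hg rfl
  have h2 : r.num * g = f * r.denom := (RatFunc.num_mul_eq_mul_denom_iff hg0).mpr hr
  have h3 := congrArg (aeval z) h2
  rw [map_mul, map_mul] at h3
  rw [subst, RatFunc.eval, ← aeval_def, ← aeval_def, div_eq_div_iff h1 hg, h3]

/-- A polynomial in `1/(z-1)` as a quotient of polynomials in `z`. -/
lemma aeval_inv_sub_one {z : E} (hz : z ≠ 1) (f : ℝ[X]) :
    aeval ((z - 1)⁻¹) f =
      aeval z (f.reverse.comp (X - 1)) / aeval z ((X - 1) ^ f.natDegree : ℝ[X]) := by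
  have hz' : z - 1 ≠ 0 := sub_ne_zero.mpr hz
  let _ : Invertible ((z - 1)⁻¹) := invertibleOfNonzero (inv_ne_zero hz')
  have h := eval₂_reverse_mul_pow (algebraMap ℝ E) ((z - 1)⁻¹) f
  rw [invOf_eq_inv, inv_inv] at h
  rw [aeval_def, ← h, aeval_comp]
  simp [aeval_def, div_eq_mul_inv]

/-- The rational function `f(1/(X-1))`, that is, the polynomial `f` in the coordinate
`u = 1/(x-1)`. -/
def inU (f : ℝ[X]) : RatFunc ℝ := aeval ((RatFunc.X - 1)⁻¹ : RatFunc ℝ) f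

lemma ratFuncX_ne_one : (RatFunc.X : RatFunc ℝ) ≠ 1 := by
  rw [← RatFunc.algebraMap_X, ← map_one (algebraMap ℝ[X] (RatFunc ℝ))]
  intro h
  simpa using congrArg natDegree (RatFunc.algebraMap_injective ℝ h)

lemma aeval_ratFuncX (f : ℝ[X]) :
    aeval (RatFunc.X : RatFunc ℝ) f = algebraMap ℝ[X] (RatFunc ℝ) f := by
  rw [← RatFunc.algebraMap_X, aeval_algebraMap_apply]
  simp

lemma inU_eq (f : ℝ[X]) : inU f = algebraMap ℝ[X] (RatFunc ℝ) (f.reverse.comp (X - 1)) /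
    algebraMap ℝ[X] (RatFunc ℝ) ((X - 1) ^ f.natDegree) := by
  rw [inU, aeval_inv_sub_one ratFuncX_ne_one, aeval_ratFuncX, aeval_ratFuncX]

lemma subst_inU {z : E} (hz : z ≠ 1) (f : ℝ[X]) : subst (inU f) z = aeval ((z - 1)⁻¹) f := by
  rw [inU_eq, aeval_inv_sub_one hz, subst_div]
  simp [sub_ne_zero.mpr hz]

lemma tt_eq : tt = algebraMap (RatFunc ℝ) AlgFun RatFunc.X := rfl

lemma tt_transcendental : Transcendental ℝ tt := by
  have : Transcendental ℝ (RatFunc.X : RatFunc ℝ) := by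
    rw [transcendental_iff]
    intro p hp
    rw [aeval_ratFuncX] at hp
    exact (map_eq_zero_iff _ (RatFunc.algebraMap_injective ℝ)).mp hp
  rw [tt_eq, transcendental_algebraMap_iff (algebraMap (RatFunc ℝ) AlgFun).injective]
  exact this

lemma algebraMap_inU (f : ℝ[X]) : algebraMap (RatFunc ℝ) AlgFun (inU f) = aeval ((tt - 1)⁻¹) f := by
  rw [inU, ← aeval_algebraMap_apply, tt_eq]
  simp

end Values

/-! ### Ellipses and their reflections -/

/-- The ellipse `γ U² + β U W + α W² + ε U + δ W + ζ = 0` with positive definite quadratic part. -/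
@[ext]
structure Ellipse where
  (α β γ δ ε ζ : ℝ)
  α_pos : 0 < α
  γ_pos : 0 < γ
  disc_pos : β ^ 2 < 4 * α * γ

namespace Ellipse

variable (C : Ellipse)

/-- The polynomial `γ U² + β U W + α W² + ε U + δ W + ζ`, with `U = X 0` and `W = X 1`. -/
def poly : MvPolynomial (Fin 2) ℝ :=
  MvPolynomial.C C.γ * MvPolynomial.X 0 ^ 2 +
    MvPolynomial.C C.β * (MvPolynomial.X 0 * MvPolynomial.X 1) +
    MvPolynomial.C C.α * MvPolynomial.X 1 ^ 2 + MvPolynomial.C C.ε * MvPolynomial.X 0 +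
    MvPolynomial.C C.δ * MvPolynomial.X 1 + MvPolynomial.C C.ζ

/-- The ellipse with the coordinates exchanged. -/
def swap : Ellipse where
  α := C.γ
  β := C.β
  γ := C.α
  δ := C.ε
  ε := C.δ
  ζ := C.ζ
  α_pos := C.γ_pos
  γ_pos := C.α_pos
  disc_pos := by have := C.disc_pos; linarith

/-- A point of the ellipse with transcendental coordinates. These are the generic points of the
curve; the branches of the kernel curve provide one. -/
structure GenericPt (U W : AlgFun) : Prop where
  left : Transcendental ℝ U
  right : Transcendental ℝ W
  zero : MvPolynomial.aeval ![U, W] C.poly = 0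

/-- Reflection along the second coordinate: the other point of the ellipse with the same `U`. -/
def reflW {R : Type} [CommRing R] [Algebra ℝ R] (U W : R) : R :=
  -(algebraMap ℝ R (C.β / C.α) * U + algebraMap ℝ R (C.δ / C.α)) - W

/-- The reflection `U ↦ U`, `W ↦ -(β U + δ) / α - W` of the coordinate ring of the plane. -/
def psi : MvPolynomial (Fin 2) ℝ →ₐ[ℝ] MvPolynomial (Fin 2) ℝ :=
  MvPolynomial.aeval ![MvPolynomial.X 0, C.reflW (MvPolynomial.X 0) (MvPolynomial.X 1)]

/-- The reflection `W ↦ W`, `U ↦ -(β W + ε) / γ - U` of the coordinate ring of the plane. -/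
def phi : MvPolynomial (Fin 2) ℝ →ₐ[ℝ] MvPolynomial (Fin 2) ℝ :=
  MvPolynomial.aeval ![C.swap.reflW (MvPolynomial.X 1) (MvPolynomial.X 0), MvPolynomial.X 1]

variable {C}

lemma aeval_poly {R : Type} [CommRing R] [Algebra ℝ R] (U W : R) :
    MvPolynomial.aeval ![U, W] C.poly = algebraMap ℝ R C.γ * U ^ 2 + algebraMap ℝ R C.β * (U * W) +
      algebraMap ℝ R C.α * W ^ 2 + algebraMap ℝ R C.ε * U + algebraMap ℝ R C.δ * W +
      algebraMap ℝ R C.ζ := by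
  simp [poly]

lemma swap_swap : C.swap.swap = C := rfl

lemma aeval_swap_poly {R : Type} [CommRing R] [Algebra ℝ R] (U W : R) :
    MvPolynomial.aeval ![W, U] C.swap.poly = MvPolynomial.aeval ![U, W] C.poly := by
  simp only [aeval_poly, swap]
  ring

lemma GenericPt.swap {U W : AlgFun} (h : C.GenericPt U W) : C.swap.GenericPt W U :=
  ⟨h.right, h.left, by rw [aeval_swap_poly]; exact h.zero⟩

lemma aeval_psi {R : Type} [CommRing R] [Algebra ℝ R] (U W : R) (f : MvPolynomial (Fin 2) ℝ) :
    MvPolynomial.aeval ![U, W] (C.psi f) = MvPolynomial.aeval ![U, C.reflW U W] f := by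
  rw [psi, MvPolynomial.comp_aeval_apply]
  congr 2
  funext i
  fin_cases i <;> simp [reflW]

lemma aeval_phi {R : Type} [CommRing R] [Algebra ℝ R] (U W : R) (f : MvPolynomial (Fin 2) ℝ) :
    MvPolynomial.aeval ![U, W] (C.phi f) = MvPolynomial.aeval ![C.swap.reflW W U, W] f := by
  rw [phi, MvPolynomial.comp_aeval_apply]
  congr 2
  funext i
  fin_cases i <;> simp [reflW]

lemma aeval_rename_swap {R : Type} [CommRing R] [Algebra ℝ R] (U W : R)
    (f : MvPolynomial (Fin 2) ℝ) :
    MvPolynomial.aeval ![U, W] (MvPolynomial.rename (Equiv.swap (0 : Fin 2) 1) f) =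
      MvPolynomial.aeval ![W, U] f := by
  rw [MvPolynomial.aeval_rename]
  congr 2
  funext i
  fin_cases i <;> simp

lemma reflW_reflW {R : Type} [CommRing R] [Algebra ℝ R] (U W : R) :
    C.reflW U (C.reflW U W) = W := by
  simp only [reflW]; ring

/-- The reflection preserves the equation of the ellipse. -/
lemma aeval_poly_reflW {R : Type} [CommRing R] [Algebra ℝ R] (U W : R) :
    MvPolynomial.aeval ![U, C.reflW U W] C.poly = MvPolynomial.aeval ![U, W] C.poly := by
  have hα := C.α_pos.ne'
  have h1 : algebraMap ℝ R C.α * algebraMap ℝ R (C.β / C.α) = algebraMap ℝ R C.β := by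
    rw [← map_mul]; congr 1; field_simp
  have h2 : algebraMap ℝ R C.α * algebraMap ℝ R (C.δ / C.α) = algebraMap ℝ R C.δ := by
    rw [← map_mul]; congr 1; field_simp
  rw [aeval_poly, aeval_poly, reflW]
  linear_combination
    (algebraMap ℝ R (C.β / C.α) * U ^ 2 + algebraMap ℝ R (C.δ / C.α) * U + 2 * U * W) * h1 +
      (algebraMap ℝ R (C.β / C.α) * U + algebraMap ℝ R (C.δ / C.α) + 2 * W) * h2

/-- On the ellipse, the second coordinate is algebraic over the first. -/
lemma isAlgebraic_of_zero {U W : AlgFun} (h : MvPolynomial.aeval ![U, W] C.poly = 0)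
    (hU : IsAlgebraic ℝ U) : IsAlgebraic ℝ W := by
  set r : ℝ →+* AlgFun := algebraMap ℝ AlgFun with hr
  have hr' : ∀ s, IsAlgebraic ℝ (r s) := fun s => isAlgebraic_algebraMap s
  rw [aeval_poly] at h
  have hα : r C.α ≠ 0 := by simpa [hr] using C.α_pos.ne'
  have hB : IsAlgebraic ℝ ((r C.β * U + r C.δ) ^ 2 -
      4 * r C.α * (r C.γ * U ^ 2 + r C.ε * U + r C.ζ)) := by
    have h4 : (4 : AlgFun) = r 4 := (map_ofNat r 4).symm
    rw [h4]
    exact ((((hr' _).mul hU).add (hr' _)).pow 2).sub (((hr' _).mul (hr' _)).mul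
      ((((hr' _).mul (hU.pow 2)).add ((hr' _).mul hU)).add (hr' _)))
  -- completing the square
  have hsq : ((2 * r C.α) * W + (r C.β * U + r C.δ)) ^ 2 = (r C.β * U + r C.δ) ^ 2 -
      4 * r C.α * (r C.γ * U ^ 2 + r C.ε * U + r C.ζ) := by
    linear_combination (4 * r C.α) * h
  rw [← hsq] at hB
  have hz := IsAlgebraic.of_pow two_pos hB
  have hW : W = (r (2 * C.α))⁻¹ *
      (((2 * r C.α) * W + (r C.β * U + r C.δ)) - (r C.β * U + r C.δ)) := by
    have h2 : r (2 * C.α) = 2 * r C.α := by rw [map_mul, map_ofNat]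
    rw [h2]
    field_simp
    ring
  rw [hW]
  exact (hr' _).inv.mul (hz.sub (((hr' _).mul hU).add (hr' _)))

lemma genericPt_of_left {U W : AlgFun} (hU : Transcendental ℝ U)
    (h : MvPolynomial.aeval ![U, W] C.poly = 0) : C.GenericPt U W :=
  ⟨hU, fun hW => hU (isAlgebraic_of_zero (C := C.swap) (by rwa [aeval_swap_poly]) hW), h⟩

lemma GenericPt.reflW {U W : AlgFun} (h : C.GenericPt U W) : C.GenericPt U (C.reflW U W) :=
  genericPt_of_left h.left (by rw [aeval_poly_reflW]; exact h.zero)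

lemma GenericPt.reflU {U W : AlgFun} (h : C.GenericPt U W) : C.GenericPt (C.swap.reflW W U) W :=
  h.swap.reflW.swap

end Ellipse

/-! ### Functions on an ellipse -/

lemma mul_mem_degreeLT {p g : ℝ[X]} {k n : ℕ} (hp : p.natDegree ≤ k) (hg : g ∈ degreeLT ℝ n) :
    p * g ∈ degreeLT ℝ (n + k) := by
  by_cases h : p * g = 0
  · rw [h]; exact Submodule.zero_mem _
  rw [mem_degreeLT] at hg ⊢
  have hg0 : g ≠ 0 := right_ne_zero_of_mul h
  rw [degree_eq_natDegree h]
  rw [degree_eq_natDegree hg0] at hg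
  have h1 := natDegree_mul_le (p := p) (q := g)
  have h2 : g.natDegree < n := by exact_mod_cast hg
  have : (p * g).natDegree < n + k := by omega
  exact_mod_cast this

lemma degreeLT_le_succ {g : ℝ[X]} {n : ℕ} (hg : g ∈ degreeLT ℝ n) : g ∈ degreeLT ℝ (n + 1) :=
  degreeLT_mono (Nat.le_succ n) hg

namespace Ellipse

variable (C : Ellipse)

/-- The polynomials that are congruent, modulo the equation of the ellipse, to `g₀(U) + W g₁(U)`
with `deg g₀ ≤ d` and `deg g₁ ≤ d - 1`. -/
def reducible (d : ℕ) : Submodule ℝ (MvPolynomial (Fin 2) ℝ) where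
  carrier := {f | ∃ g₀ ∈ degreeLT ℝ (d + 1), ∃ g₁ ∈ degreeLT ℝ d, C.poly ∣
    f - (aeval (MvPolynomial.X 0) g₀ + MvPolynomial.X 1 * aeval (MvPolynomial.X 0) g₁)}
  add_mem' := by
    rintro f f' ⟨g₀, h₀, g₁, h₁, h⟩ ⟨g₀', h₀', g₁', h₁', h'⟩
    refine ⟨g₀ + g₀', add_mem h₀ h₀', g₁ + g₁', add_mem h₁ h₁', ?_⟩
    convert dvd_add h h' using 1
    simp only [map_add]
    ring
  zero_mem' := ⟨0, zero_mem _, 0, zero_mem _, by simp⟩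
  smul_mem' := by
    rintro c f ⟨g₀, h₀, g₁, h₁, h⟩
    refine ⟨c • g₀, Submodule.smul_mem _ _ h₀, c • g₁, Submodule.smul_mem _ _ h₁, ?_⟩
    convert dvd_mul_of_dvd_right h (MvPolynomial.C c) using 1
    simp only [map_smul, MvPolynomial.smul_eq_C_mul]
    ring

variable {C}

lemma reducible_succ {d : ℕ} {f : MvPolynomial (Fin 2) ℝ} (hf : f ∈ C.reducible d) :
    f ∈ C.reducible (d + 1) := by
  obtain ⟨g₀, h₀, g₁, h₁, h⟩ := hf
  exact ⟨g₀, degreeLT_le_succ h₀, g₁, degreeLT_le_succ h₁, h⟩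

lemma X_zero_mul_mem {d : ℕ} {f : MvPolynomial (Fin 2) ℝ} (hf : f ∈ C.reducible d) :
    f * MvPolynomial.X 0 ∈ C.reducible (d + 1) := by
  obtain ⟨g₀, h₀, g₁, h₁, h⟩ := hf
  refine ⟨X * g₀, mul_mem_degreeLT natDegree_X_le h₀, X * g₁, mul_mem_degreeLT natDegree_X_le h₁,
    ?_⟩
  convert dvd_mul_of_dvd_left h (MvPolynomial.X 0) using 1
  simp only [map_mul, aeval_X]
  ring

/-- The equation of the ellipse expresses `W²` through `W` and `1`. -/
lemma X_one_mul_mem {d : ℕ} {f : MvPolynomial (Fin 2) ℝ} (hf : f ∈ C.reducible d) :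
    f * MvPolynomial.X 1 ∈ C.reducible (d + 1) := by
  obtain ⟨g₀, h₀, g₁, h₁, h⟩ := hf
  have hq : (Polynomial.C (C.γ / C.α) * X ^ 2 + Polynomial.C (C.ε / C.α) * X +
      Polynomial.C (C.ζ / C.α)).natDegree ≤ 2 := natDegree_quadratic_le
  have hl : (Polynomial.C (C.β / C.α) * X + Polynomial.C (C.δ / C.α)).natDegree ≤ 1 :=
    natDegree_linear_le
  refine ⟨-((Polynomial.C (C.γ / C.α) * X ^ 2 + Polynomial.C (C.ε / C.α) * X +
      Polynomial.C (C.ζ / C.α)) * g₁), neg_mem (by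
      simpa only [add_assoc] using mul_mem_degreeLT hq h₁),
    g₀ - (Polynomial.C (C.β / C.α) * X + Polynomial.C (C.δ / C.α)) * g₁,
    sub_mem h₀ (mul_mem_degreeLT hl h₁), ?_⟩
  have hα := C.α_pos.ne'
  have hp : C.poly = MvPolynomial.C C.α * (MvPolynomial.C (C.γ / C.α) * MvPolynomial.X 0 ^ 2 +
      MvPolynomial.C (C.β / C.α) * (MvPolynomial.X 0 * MvPolynomial.X 1) +
      MvPolynomial.X 1 ^ 2 + MvPolynomial.C (C.ε / C.α) * MvPolynomial.X 0 +
      MvPolynomial.C (C.δ / C.α) * MvPolynomial.X 1 + MvPolynomial.C (C.ζ / C.α)) := by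
    have e : ∀ s : ℝ, MvPolynomial.C (σ := Fin 2) s =
        MvPolynomial.C C.α * MvPolynomial.C (s / C.α) := by
      intro s
      rw [← map_mul]
      congr 1
      field_simp
    rw [poly, e C.γ, e C.β, e C.ε, e C.δ, e C.ζ]
    ring
  have hd : C.poly ∣ (MvPolynomial.C (C.γ / C.α) * MvPolynomial.X 0 ^ 2 +
      MvPolynomial.C (C.β / C.α) * (MvPolynomial.X 0 * MvPolynomial.X 1) +
      MvPolynomial.X 1 ^ 2 + MvPolynomial.C (C.ε / C.α) * MvPolynomial.X 0 +
      MvPolynomial.C (C.δ / C.α) * MvPolynomial.X 1 + MvPolynomial.C (C.ζ / C.α)) := by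
    refine ⟨MvPolynomial.C (1 / C.α), ?_⟩
    rw [hp, mul_right_comm, ← map_mul, mul_one_div_cancel hα, map_one, one_mul]
  convert dvd_add (dvd_mul_of_dvd_left h (MvPolynomial.X 1))
    (dvd_mul_of_dvd_left hd (aeval (MvPolynomial.X 0) g₁)) using 1
  simp only [map_mul, map_add, map_neg, map_sub, map_pow, aeval_X, aeval_C,
    MvPolynomial.algebraMap_eq]
  ring

lemma monomial_mem_reducible (d : Fin 2 →₀ ℕ) (r : ℝ) :
    MvPolynomial.monomial d r ∈ C.reducible (d 0 + d 1) := by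
  have h : MvPolynomial.monomial d r =
      r • (MvPolynomial.X 0 ^ d 0 * MvPolynomial.X 1 ^ d 1 : MvPolynomial (Fin 2) ℝ) := by
    rw [MvPolynomial.monomial_eq, Finsupp.prod_fintype _ _ (by simp), Fin.prod_univ_two,
      MvPolynomial.smul_eq_C_mul]
  rw [h]
  refine Submodule.smul_mem _ _ ?_
  have h0 : ∀ n : ℕ, (MvPolynomial.X 0 ^ n : MvPolynomial (Fin 2) ℝ) ∈ C.reducible n := by
    intro n
    induction n with
    | zero => exact ⟨1, by simp [mem_degreeLT], 0, zero_mem _, by simp⟩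
    | succ n ih => rw [pow_succ]; exact X_zero_mul_mem ih
  induction d 1 with
  | zero => simpa using h0 _
  | succ n ih => rw [pow_succ, ← mul_assoc]; exact X_one_mul_mem ih

lemma mem_reducible {f : MvPolynomial (Fin 2) ℝ} {d : ℕ} (hf : f.totalDegree ≤ d) :
    f ∈ C.reducible d := by
  rw [f.as_sum]
  refine Submodule.sum_mem _ fun e he => ?_
  have h1 : e 0 + e 1 ≤ d := by
    refine le_trans ?_ ((MvPolynomial.le_totalDegree he).trans hf)
    rw [Finsupp.sum_fintype _ _ (by simp), Fin.sum_univ_two]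
  have h2 := monomial_mem_reducible (C := C) e (MvPolynomial.coeff e f)
  clear he
  revert h2
  generalize MvPolynomial.monomial e (MvPolynomial.coeff e f) = g
  intro h2
  obtain ⟨k, rfl⟩ := Nat.exists_eq_add_of_le h1
  clear h1 hf
  induction k with
  | zero => exact h2
  | succ k ih => exact reducible_succ ih

/-- A function on the ellipse, symmetrised by the reflection along `W`, is a polynomial in `U`. -/
lemma exists_trace (C : Ellipse) {f : MvPolynomial (Fin 2) ℝ} {d : ℕ} (hf : f.totalDegree ≤ d) :
    ∃ g : ℝ[X], g.natDegree ≤ d ∧ ∀ U W : AlgFun, C.GenericPt U W →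
      MvPolynomial.aeval ![U, W] f + MvPolynomial.aeval ![U, C.reflW U W] f = aeval U g := by
  obtain ⟨g₀, h₀, g₁, h₁, r, hr⟩ := mem_reducible (C := C) hf
  have hl : (Polynomial.C (C.β / C.α) * X + Polynomial.C (C.δ / C.α)).natDegree ≤ 1 :=
    natDegree_linear_le
  refine ⟨g₀ + g₀ - (Polynomial.C (C.β / C.α) * X + Polynomial.C (C.δ / C.α)) * g₁, ?_, ?_⟩
  · have h := sub_mem (add_mem h₀ h₀) (mul_mem_degreeLT hl h₁)
    rw [mem_degreeLT] at h
    refine natDegree_le_of_degree_le (Order.le_of_lt_succ ?_)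
    exact_mod_cast h
  · intro U W h
    have e : ∀ W', C.GenericPt U W' →
        MvPolynomial.aeval ![U, W'] f = aeval U g₀ + W' * aeval U g₁ := by
      intro W' h'
      have := congrArg (MvPolynomial.aeval ![U, W']) hr
      rw [map_mul, h'.zero, zero_mul, map_sub, sub_eq_zero] at this
      rw [this]
      simp only [map_add, map_mul, ← aeval_algHom_apply]
      simp
    rw [e W h, e _ h.reflW]
    simp only [map_add, map_sub, map_mul, aeval_X, aeval_C, Ellipse.reflW]
    ring

/-- A polynomial that vanishes at two conjugate generic points of the ellipse is a multiple of its
equation: modulo the equation it is linear in `W`, and it has two zeros. -/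
lemma poly_dvd {f : MvPolynomial (Fin 2) ℝ} {U W : AlgFun} (h : C.GenericPt U W)
    (hne : C.reflW U W ≠ W) (h1 : MvPolynomial.aeval ![U, W] f = 0)
    (h2 : MvPolynomial.aeval ![U, C.reflW U W] f = 0) : C.poly ∣ f := by
  obtain ⟨g₀, -, g₁, -, r, hr⟩ := mem_reducible (C := C) (le_refl f.totalDegree)
  have e : ∀ W', C.GenericPt U W' → MvPolynomial.aeval ![U, W'] f = 0 →
      aeval U g₀ + W' * aeval U g₁ = 0 := by
    intro W' h' hf
    have := congrArg (MvPolynomial.aeval ![U, W']) hr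
    rw [map_mul, h'.zero, zero_mul, map_sub, sub_eq_zero, hf] at this
    rw [this]
    simp only [map_add, map_mul, ← aeval_algHom_apply]
    simp
  have e1 := e W h h1
  have e2 := e _ h.reflW h2
  have e3 : (C.reflW U W - W) * aeval U g₁ = 0 := by linear_combination e2 - e1
  have e4 := (mul_eq_zero.mp e3).resolve_left (sub_ne_zero.mpr hne)
  rw [e4, mul_zero, add_zero] at e1
  have z0 := transcendental_iff.mp h.left _ e1
  have z1 := transcendental_iff.mp h.left _ e4
  rw [z0, z1] at hr
  exact ⟨r, by simpa using hr⟩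

/-- The ellipse is not ramified over a transcendental point of the `U`-axis, as the discriminant
has leading coefficient `β² - 4 α γ ≠ 0`. -/
lemma GenericPt.reflW_ne {U W : AlgFun} (h : C.GenericPt U W) : C.reflW U W ≠ W := by
  intro h0
  have hα := C.α_pos.ne'
  have hα' : algebraMap ℝ AlgFun C.α ≠ 0 := by simpa using hα
  rw [Ellipse.reflW, map_div₀, map_div₀] at h0
  have h1 : 2 * algebraMap ℝ AlgFun C.α * W + algebraMap ℝ AlgFun C.β * U +
      algebraMap ℝ AlgFun C.δ = 0 := by
    field_simp at h0
    linear_combination -h0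
  have h2 := h.zero
  rw [aeval_poly] at h2
  set p : ℝ[X] := Polynomial.C (C.β ^ 2 - 4 * C.α * C.γ) * X ^ 2 +
    Polynomial.C (2 * C.β * C.δ - 4 * C.α * C.ε) * X +
    Polynomial.C (C.δ ^ 2 - 4 * C.α * C.ζ) with hp
  have h3 : aeval U p = 0 := by
    simp only [hp, map_add, map_sub, map_mul, map_pow, aeval_X, aeval_C, map_ofNat]
    linear_combination (2 * algebraMap ℝ AlgFun C.α * W + algebraMap ℝ AlgFun C.β * U +
      algebraMap ℝ AlgFun C.δ) * h1 - 4 * algebraMap ℝ AlgFun C.α * h2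
  have h4 := congrArg (fun q => coeff q 2) (transcendental_iff.mp h.left p h3)
  rw [hp, coeff_add, coeff_add, coeff_C_mul, coeff_C_mul, coeff_X_pow, coeff_X, coeff_C] at h4
  norm_num at h4
  have := C.disc_pos
  linarith

/-- The restriction of the equation to the axis `U = 0` has degree `2`. -/
lemma two_le_totalDegree_poly (C : Ellipse) : 2 ≤ C.poly.totalDegree := by
  have h := MvPolynomial.aeval_natDegree_le (m := C.poly.totalDegree) C.poly le_rfl
    (![0, X] : Fin 2 → ℝ[X]) (n := 1) (by intro i; fin_cases i <;> simp)
  have e : MvPolynomial.aeval ![(0 : ℝ[X]), X] C.poly =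
      Polynomial.C C.α * X ^ 2 + Polynomial.C C.δ * X + Polynomial.C C.ζ := by
    rw [aeval_poly]
    simp
  rwa [e, natDegree_quadratic C.α_pos.ne', mul_one] at h

/-- A polynomial of degree at most `d` that vanishes on the ellipse is its equation times a
polynomial of degree at most `d - 2`. -/
lemma exists_eq_poly_mul {f : MvPolynomial (Fin 2) ℝ} {d : ℕ} (hf : f.totalDegree ≤ d)
    (hgen : ∃ U W, C.GenericPt U W)
    (h : ∀ U W : AlgFun, C.GenericPt U W → MvPolynomial.aeval ![U, W] f = 0) :
    ∃ r, f = C.poly * r ∧ (r = 0 ∨ r.totalDegree + 2 ≤ d) := by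
  obtain ⟨U, W, hUW⟩ := hgen
  obtain ⟨r, rfl⟩ := poly_dvd hUW hUW.reflW_ne (h U W hUW) (h _ _ hUW.reflW)
  refine ⟨r, rfl, ?_⟩
  by_cases hr : r = 0
  · exact Or.inl hr
  right
  have h2 := two_le_totalDegree_poly C
  have h0 : C.poly ≠ 0 := by
    intro h0
    rw [h0] at h2
    simp at h2
  rw [MvPolynomial.totalDegree_mul_of_isDomain h0 hr] at hf
  omega

end Ellipse

/-! ### Decoupling on an ellipse -/

lemma totalDegree_mvAeval_le {g : Fin 2 → MvPolynomial (Fin 2) ℝ} (hg : ∀ i, (g i).totalDegree ≤ 1)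
    (f : MvPolynomial (Fin 2) ℝ) : (MvPolynomial.aeval g f).totalDegree ≤ f.totalDegree := by
  conv_lhs => rw [f.as_sum, map_sum]
  refine MvPolynomial.totalDegree_finsetSum_le fun e he => ?_
  refine le_trans ?_ (MvPolynomial.le_totalDegree he)
  rw [MvPolynomial.aeval_monomial, MvPolynomial.algebraMap_eq, Finsupp.prod_fintype _ _ (by simp),
    Fin.prod_univ_two, Finsupp.sum_fintype _ _ (by simp), Fin.sum_univ_two]
  have h : ∀ i, (g i ^ e i).totalDegree ≤ e i := fun i =>
    (MvPolynomial.totalDegree_pow _ _).trans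
      ((Nat.mul_le_mul_left _ (hg i)).trans (mul_one _).le)
  refine (MvPolynomial.totalDegree_mul _ _).trans ?_
  rw [MvPolynomial.totalDegree_C, zero_add]
  exact (MvPolynomial.totalDegree_mul _ _).trans (add_le_add (h 0) (h 1))

lemma totalDegree_aeval_X_le (i : Fin 2) (g : ℝ[X]) :
    (aeval (MvPolynomial.X i : MvPolynomial (Fin 2) ℝ) g).totalDegree ≤ g.natDegree := by
  rw [aeval_eq_sum_range]
  refine MvPolynomial.totalDegree_finsetSum_le fun n hn => ?_
  refine (MvPolynomial.totalDegree_smul_le _ _).trans ?_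
  rw [MvPolynomial.totalDegree_X_pow]
  simpa [Nat.lt_succ_iff] using hn

lemma mvAeval_aeval_X_zero {R : Type} [CommRing R] [Algebra ℝ R] (u v : R) (g : ℝ[X]) :
    MvPolynomial.aeval ![u, v] (aeval (MvPolynomial.X 0 : MvPolynomial (Fin 2) ℝ) g) =
      aeval u g := by
  rw [← aeval_algHom_apply]
  simp

lemma mvAeval_aeval_X_one {R : Type} [CommRing R] [Algebra ℝ R] (u v : R) (g : ℝ[X]) :
    MvPolynomial.aeval ![u, v] (aeval (MvPolynomial.X 1 : MvPolynomial (Fin 2) ℝ) g) =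
      aeval v g := by
  rw [← aeval_algHom_apply]
  simp

/-- Summation by parts. -/
lemma sum_mul_succ_sub {R : Type} [CommRing R] (s : ℕ → R) (N : ℕ) :
    ∑ i ∈ Finset.range N, (i : R) * (s (i + 1) - s i) =
      N * s N + s 0 - s N - ∑ i ∈ Finset.range N, s i := by
  induction N with
  | zero => simp
  | succ N ih => rw [Finset.sum_range_succ, ih, Finset.sum_range_succ]; push_cast; ring

/-- Summation by parts, where the truncated subtraction `0 - 1` only occurs in a vanishing term. -/
lemma sum_mul_pred_sub {R : Type} [CommRing R] (s : ℕ → R) (N : ℕ) :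
    ∑ i ∈ Finset.range N, (i : R) * (s (i - 1) - s i) =
      -(N * s (N - 1)) + ∑ i ∈ Finset.range N, s i := by
  induction N with
  | zero => simp
  | succ N ih =>
    rw [Finset.sum_range_succ, ih, Finset.sum_range_succ]
    simp only [Nat.add_sub_cancel]
    push_cast
    ring

namespace Ellipse

variable {C : Ellipse}

lemma totalDegree_reflW_le (i j : Fin 2) :
    (C.reflW (MvPolynomial.X i) (MvPolynomial.X j) : MvPolynomial (Fin 2) ℝ).totalDegree ≤ 1 := by
  rw [reflW, MvPolynomial.algebraMap_eq]
  refine (MvPolynomial.totalDegree_sub _ _).trans (max_le ?_ (MvPolynomial.totalDegree_X _).le)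
  rw [MvPolynomial.totalDegree_neg]
  refine (MvPolynomial.totalDegree_add _ _).trans (max_le ?_ ?_)
  · refine (MvPolynomial.totalDegree_mul _ _).trans ?_
    rw [MvPolynomial.totalDegree_C, MvPolynomial.totalDegree_X]
  · rw [MvPolynomial.totalDegree_C]
    exact zero_le_one

/-- The composite of the two reflections. -/
def theta (C : Ellipse) : MvPolynomial (Fin 2) ℝ →ₐ[ℝ] MvPolynomial (Fin 2) ℝ := C.phi.comp C.psi

lemma totalDegree_theta_iterate_le (i : ℕ) (f : MvPolynomial (Fin 2) ℝ) :
    (C.theta^[i] f).totalDegree ≤ f.totalDegree := by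
  induction i with
  | zero => exact le_rfl
  | succ i ih =>
    rw [Function.iterate_succ_apply']
    refine le_trans ?_ ih
    refine (totalDegree_mvAeval_le ?_ _).trans (totalDegree_mvAeval_le ?_ _)
    · intro j
      fin_cases j
      · exact totalDegree_reflW_le _ _
      · exact (MvPolynomial.totalDegree_X _).le
    · intro j
      fin_cases j
      · exact (MvPolynomial.totalDegree_X _).le
      · exact totalDegree_reflW_le _ _

lemma aeval_phi_phi {U W : AlgFun} (f : MvPolynomial (Fin 2) ℝ) :
    MvPolynomial.aeval ![U, W] (C.phi (C.phi f)) = MvPolynomial.aeval ![U, W] f := by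
  rw [aeval_phi, aeval_phi, reflW_reflW]

/-- A function `f` on the ellipse whose signed orbit sum under the dihedral group generated by the
two reflections vanishes is the sum of a function of `U`, given by an explicit average over the
orbit, and of a function of `W`. -/
lemma exists_decoupling (C : Ellipse) {f : MvPolynomial (Fin 2) ℝ} {d N : ℕ}
    (hf : f.totalDegree ≤ d) (hN : 0 < N)
    (hper : ∀ U W : AlgFun, C.GenericPt U W →
      MvPolynomial.aeval ![U, W] (C.theta^[N] f) = MvPolynomial.aeval ![U, W] f)
    (horb : ∀ U W : AlgFun, C.GenericPt U W →
      ∑ i ∈ Finset.range N, MvPolynomial.aeval ![U, W] (C.theta^[i] f) =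
        ∑ i ∈ Finset.range N, MvPolynomial.aeval ![U, W] (C.psi (C.theta^[i] f))) :
    ∃ F G : ℝ[X], F.natDegree ≤ d ∧ G.natDegree ≤ d ∧
      (∀ U W : AlgFun, C.GenericPt U W → aeval U F = -(1 / (N : AlgFun)) *
        ∑ i ∈ Finset.Ico 1 N, (i : AlgFun) * (MvPolynomial.aeval ![U, W] (C.theta^[i] f) +
          MvPolynomial.aeval ![U, C.reflW U W] (C.theta^[i] f))) ∧
      ∀ U W : AlgFun, C.GenericPt U W →
        MvPolynomial.aeval ![U, W] f = aeval U F + aeval W G := by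
  have hN0 : (N : AlgFun) ≠ 0 := Nat.cast_ne_zero.mpr hN.ne'
  choose t ht1 ht2 using fun i => exists_trace C ((totalDegree_theta_iterate_le i f).trans hf)
  set F : ℝ[X] := Polynomial.C (-(1 / (N : ℝ))) * ∑ i ∈ Finset.Ico 1 N, Polynomial.C (i : ℝ) * t i
    with hF
  have hFdeg : F.natDegree ≤ d := by
    refine (natDegree_C_mul_le _ _).trans (natDegree_sum_le_of_forall_le _ _ fun i _ => ?_)
    exact (natDegree_C_mul_le _ _).trans (ht1 i)
  have hFval : ∀ U W : AlgFun, C.GenericPt U W → aeval U F = -(1 / (N : AlgFun)) *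
        ∑ i ∈ Finset.Ico 1 N, (i : AlgFun) * (MvPolynomial.aeval ![U, W] (C.theta^[i] f) +
          MvPolynomial.aeval ![U, C.reflW U W] (C.theta^[i] f)) := by
    intro U W h
    rw [hF, map_mul, map_sum, aeval_C]
    congr 1
    · simp
    · refine Finset.sum_congr rfl fun i _ => ?_
      rw [map_mul, aeval_C, ht2 i U W h]
      simp
  have hFval' : ∀ U W : AlgFun, C.GenericPt U W → N * aeval U F =
      -∑ i ∈ Finset.range N, (i : AlgFun) * (MvPolynomial.aeval ![U, W] (C.theta^[i] f) +
        MvPolynomial.aeval ![U, W] (C.psi (C.theta^[i] f))) := by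
    intro U W h
    rw [hFval U W h, Finset.range_eq_Ico, Finset.sum_eq_sum_Ico_succ_bot hN]
    simp only [aeval_psi]
    field_simp
    simp
  -- By summation by parts, `f - F` is invariant under the reflection along `U`, so that its
  -- symmetrisation is twice itself.
  have hinv : ∀ U W : AlgFun, C.GenericPt U W →
      MvPolynomial.aeval ![C.swap.reflW W U, W] f - aeval (C.swap.reflW W U) F =
        MvPolynomial.aeval ![U, W] f - aeval U F := by
    intro U W h
    have e1 := hFval' U W h
    have e2 := hFval' _ W h.reflU
    set s : ℕ → AlgFun := fun i => MvPolynomial.aeval ![U, W] (C.theta^[i] f) with hs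
    set p : ℕ → AlgFun := fun i => MvPolynomial.aeval ![U, W] (C.psi (C.theta^[i] f)) with hp
    have e3 : ∀ i, MvPolynomial.aeval ![C.swap.reflW W U, W] (C.psi (C.theta^[i] f)) =
        s (i + 1) := by
      intro i
      simp only [hs]
      rw [Function.iterate_succ_apply', theta, AlgHom.comp_apply, aeval_phi]
    have e4 : ∀ i, MvPolynomial.aeval ![C.swap.reflW W U, W] (C.theta^[i + 1] f) = p i := by
      intro i
      rw [← aeval_phi, Function.iterate_succ_apply']
      exact aeval_phi_phi _
    have e5 : MvPolynomial.aeval ![C.swap.reflW W U, W] f = p (N - 1) := by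
      rw [← hper _ W h.reflU, ← e4, Nat.sub_add_cancel hN]
    have e6 : N * aeval (C.swap.reflW W U) F =
        -∑ i ∈ Finset.range N, (i : AlgFun) * (p (i - 1) + s (i + 1)) := by
      rw [e2]
      congr 1
      refine Finset.sum_congr rfl fun i _ => ?_
      rw [e3]
      rcases i with _ | i
      · simp
      · rw [e4, Nat.add_sub_cancel]
    have e7 := sum_mul_succ_sub s N
    have e8 := sum_mul_pred_sub p N
    have e9 : s N = s 0 := hper U W h
    have e10 : ∑ i ∈ Finset.range N, s i = ∑ i ∈ Finset.range N, p i := horb U W h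
    have e11 : N * (aeval (C.swap.reflW W U) F - aeval U F) = N * (p (N - 1) - s 0) := by
      rw [mul_sub, e6, e1]
      simp only [mul_sub, mul_add, Finset.sum_add_distrib, Finset.sum_sub_distrib] at e7 e8 ⊢
      linear_combination -e7 - e8 + (1 - N) * e9 + e10
    have e12 := mul_left_cancel₀ hN0 e11
    have e13 : MvPolynomial.aeval ![U, W] f = s 0 := rfl
    rw [e5, e13]
    linear_combination -e12
  obtain ⟨G, hG1, hG2⟩ := exists_trace C.swap (d := d)
    (f := MvPolynomial.rename (Equiv.swap (0 : Fin 2) 1) (f - aeval (MvPolynomial.X 0) F))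
    ((MvPolynomial.totalDegree_rename_le _ _).trans ((MvPolynomial.totalDegree_sub _ _).trans
      (max_le hf ((totalDegree_aeval_X_le _ _).trans hFdeg))))
  refine ⟨F, Polynomial.C (1 / 2) * G, hFdeg, (natDegree_C_mul_le _ _).trans hG1, hFval, ?_⟩
  intro U W h
  have h1 := hG2 W U h.swap
  rw [aeval_rename_swap, aeval_rename_swap, map_sub, map_sub, mvAeval_aeval_X_zero,
    mvAeval_aeval_X_zero, hinv U W h] at h1
  rw [map_mul _ (Polynomial.C (1 / 2)) G, aeval_C, ← h1, map_div₀, map_one, map_ofNat]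
  ring

end Ellipse

/-! ### The ellipse of a zero drift model -/

lemma sum_Icc_neg_one_one {R : Type*} [AddCommMonoid R] (f : ℤ → R) :
    ∑ i ∈ Finset.Icc (-1 : ℤ) 1, f i = f (-1) + f 0 + f 1 := by
  have e : Finset.Icc (-1 : ℤ) 1 = {-1, 0, 1} := rfl
  rw [e, Finset.sum_insert (by decide), Finset.sum_insert (by decide), Finset.sum_singleton,
    add_assoc]

/-- If any three of four nonnegative masses have a positive sum, two of the masses are positive, and
each product of two masses occurs on the right-hand side. -/
lemma sum_pairs_pos {A B C D : ℝ} (hA : 0 ≤ A) (hB : 0 ≤ B) (hC : 0 ≤ C) (hD : 0 ≤ D)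
    (h1 : 0 < B + C + D) (h2 : 0 < A + C + D) (h3 : 0 < A + B + D) (h4 : 0 < A + B + C) :
    0 < 4 * (A * C) + A * D + C * D + A * B + B * C + B * D := by
  have hAC := mul_nonneg hA hC
  have hAD := mul_nonneg hA hD
  have hAB := mul_nonneg hA hB
  have hCD := mul_nonneg hC hD
  have hBC := mul_nonneg hB hC
  have hBD := mul_nonneg hB hD
  rcases hA.eq_or_lt with rfl | hA'
  · rcases hB.eq_or_lt with rfl | hB'
    · have : 0 < C * D := mul_pos (by linarith) (by linarith)
      linarith
    · have : 0 < B * (C + D) := mul_pos hB' (by linarith)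
      linarith
  · have : 0 < A * (B + C + D) := mul_pos hA' h1
    linarith

namespace StepModel

variable (S : StepModel)

lemma sum_eq : S.p 1 1 + S.p 1 0 + S.p 1 (-1) + S.p 0 (-1) + S.p (-1) (-1) + S.p (-1) 0 +
    S.p (-1) 1 + S.p 0 1 + S.p 0 0 = 1 := by
  have h := S.sum_eq_one
  simp [sum_Icc_neg_one_one] at h
  linarith

lemma drift_x_eq : S.p 1 1 + S.p 1 0 + S.p 1 (-1) = S.p (-1) (-1) + S.p (-1) 0 + S.p (-1) 1 := by
  have h := S.drift_x
  simp [sum_Icc_neg_one_one] at h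
  linarith

lemma drift_y_eq : S.p 1 1 + S.p 0 1 + S.p (-1) 1 = S.p (-1) (-1) + S.p 0 (-1) + S.p 1 (-1) := by
  have h := S.drift_y
  simp [sum_Icc_neg_one_one] at h
  linarith

/-- Among three consecutive weights around the origin, one is positive. -/
lemma three_pos : 0 < S.p 1 1 + S.p 1 0 + S.p 1 (-1) ∧ 0 < S.p 1 0 + S.p 1 (-1) + S.p 0 (-1) ∧
    0 < S.p 1 (-1) + S.p 0 (-1) + S.p (-1) (-1) ∧ 0 < S.p 0 (-1) + S.p (-1) (-1) + S.p (-1) 0 ∧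
    0 < S.p (-1) (-1) + S.p (-1) 0 + S.p (-1) 1 ∧ 0 < S.p (-1) 0 + S.p (-1) 1 + S.p 0 1 ∧
    0 < S.p (-1) 1 + S.p 0 1 + S.p 1 1 ∧ 0 < S.p 0 1 + S.p 1 1 + S.p 1 0 := by
  have key : ∀ {a b c : ℝ}, 0 ≤ a → 0 ≤ b → 0 ≤ c → ¬ (a = 0 ∧ b = 0 ∧ c = 0) → 0 < a + b + c := by
    intro a b c ha hb hc h
    by_contra h0
    exact h ⟨by linarith, by linarith, by linarith⟩
  have n := S.nonneg
  have h := S.nondegenerate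
  have h0 := h 0
  have h1 := h 1
  have h2 := h 2
  have h3 := h 3
  have h4 := h 4
  have h5 := h 5
  have h6 := h 6
  have h7 := h 7
  simp only [Fin.reduceAdd, Matrix.cons_val] at h0 h1 h2 h3 h4 h5 h6 h7
  exact ⟨key (n _ _) (n _ _) (n _ _) h0, key (n _ _) (n _ _) (n _ _) h1,
    key (n _ _) (n _ _) (n _ _) h2, key (n _ _) (n _ _) (n _ _) h3,
    key (n _ _) (n _ _) (n _ _) h4, key (n _ _) (n _ _) (n _ _) h5,
    key (n _ _) (n _ _) (n _ _) h6, key (n _ _) (n _ _) (n _ _) h7⟩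

/-- The ellipse that becomes the curve `K(x, y) = 0` in the coordinates `u = 1/(x-1)`,
`w = 1/(y-1)`. The coefficients are those of `K` in powers of `x - 1` and `y - 1`. The drift being
zero, the point `(1, 1)` is a double point of the curve, hence the equation in `u`, `w` is
quadratic; its discriminant is the determinant of the covariance matrix of the walk, up to the
sign. -/
def ellipse : Ellipse where
  α := S.p (-1) (-1) + S.p (-1) 0 + S.p (-1) 1
  β := S.p 0 0 + 2 * S.p (-1) 0 + 2 * S.p 0 (-1) + 4 * S.p (-1) (-1) - 1
  γ := S.p (-1) (-1) + S.p 0 (-1) + S.p 1 (-1)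
  δ := S.p (-1) 0 + 2 * S.p (-1) (-1)
  ε := S.p 0 (-1) + 2 * S.p (-1) (-1)
  ζ := S.p (-1) (-1)
  α_pos := S.three_pos.2.2.2.2.1
  γ_pos := by linarith [S.three_pos.2.2.1]
  disc_pos := by
    have n := S.nonneg
    obtain ⟨h0, h1, h2, h3, -⟩ := S.three_pos
    -- With the masses of the four directions up to sign (diagonal, horizontal, antidiagonal,
    -- vertical), `4 α γ - β²` is the expression that `sum_pairs_pos` is about.
    have h := sum_pairs_pos (add_nonneg (n 1 1) (n (-1) (-1))) (add_nonneg (n 1 0) (n (-1) 0))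
      (add_nonneg (n 1 (-1)) (n (-1) 1)) (add_nonneg (n 0 (-1)) (n 0 1))
      (by linarith [n (-1) 0, n (-1) 1, n 0 1]) (by linarith [n 1 1, n (-1) 1, n 0 1])
      (by linarith [n 1 1, n 1 0, n 0 1]) (by linarith [n (-1) (-1), n (-1) 0, n (-1) 1])
    have hs := S.sum_eq
    have hx := S.drift_x_eq
    have hy := S.drift_y_eq
    have eβ : S.p 0 0 + 2 * S.p (-1) 0 + 2 * S.p 0 (-1) + 4 * S.p (-1) (-1) - 1 =
        S.p 1 1 + S.p (-1) (-1) - S.p 1 (-1) - S.p (-1) 1 := by linarith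
    have eα : 2 * (S.p (-1) (-1) + S.p (-1) 0 + S.p (-1) 1) = S.p 1 1 + S.p (-1) (-1) +
        (S.p 1 0 + S.p (-1) 0) + (S.p 1 (-1) + S.p (-1) 1) := by linarith
    have eγ : 2 * (S.p (-1) (-1) + S.p 0 (-1) + S.p 1 (-1)) = S.p 1 1 + S.p (-1) (-1) +
        (S.p 1 (-1) + S.p (-1) 1) + (S.p 0 (-1) + S.p 0 1) := by linarith
    have e4 : ∀ a g : ℝ, 4 * a * g = (2 * a) * (2 * g) := fun a g => by ring
    rw [e4, eβ, eα, eγ]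
    linarith

lemma ellipse_β : S.ellipse.β = S.p 1 1 + S.p (-1) (-1) - S.p 1 (-1) - S.p (-1) 1 := by
  have hs := S.sum_eq
  have hx := S.drift_x_eq
  have hy := S.drift_y_eq
  simp only [ellipse]
  linarith

/-- The model with the coordinates exchanged. -/
def transpose : StepModel where
  p i j := S.p j i
  nonneg i j := S.nonneg j i
  small i j h := (S.small j i h).symm
  sum_eq_one := by rw [Finset.sum_comm]; exact S.sum_eq_one
  nondegenerate := by
    intro t
    obtain ⟨h0, h1, h2, h3, h4, h5, h6, h7⟩ := S.three_pos
    fin_cases t <;> simp only [Fin.reduceAdd, Matrix.cons_val, Fin.reduceFinMk, Fin.zero_eta] <;>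
      rintro ⟨a, b, c⟩ <;> linarith
  drift_x := by rw [Finset.sum_comm]; exact S.drift_y
  drift_y := by rw [Finset.sum_comm]; exact S.drift_x

lemma transpose_ellipse : S.transpose.ellipse = S.ellipse.swap := by
  ext <;> simp only [ellipse, transpose, Ellipse.swap]
  ring

lemma transpose_a : S.transpose.a = S.aT := rfl

lemma transpose_b : S.transpose.b = S.bT := rfl

lemma transpose_c : S.transpose.c = S.cT := rfl

lemma transpose_Yplus : S.transpose.Yplus = S.Xplus := rfl

lemma transpose_Yminus : S.transpose.Yminus = S.Xminus := rfl

section Evaluation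

variable {R : Type} [CommRing R] [Algebra ℝ R] (x y : R)

/-- The expansion of the kernel at its double point `(1, 1)`. -/
lemma aeval_kernel : MvPolynomial.aeval ![x, y] S.kernel =
    algebraMap ℝ R S.ellipse.γ * (y - 1) ^ 2 +
      algebraMap ℝ R S.ellipse.β * ((x - 1) * (y - 1)) +
      algebraMap ℝ R S.ellipse.α * (x - 1) ^ 2 +
      algebraMap ℝ R S.ellipse.ε * ((x - 1) * (y - 1) ^ 2) +
      algebraMap ℝ R S.ellipse.δ * ((x - 1) ^ 2 * (y - 1)) +
      algebraMap ℝ R S.ellipse.ζ * ((x - 1) ^ 2 * (y - 1) ^ 2) := by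
  have hs := congrArg (algebraMap ℝ R) S.sum_eq
  have hx := congrArg (algebraMap ℝ R) S.drift_x_eq
  have hy := congrArg (algebraMap ℝ R) S.drift_y_eq
  have t2 : (1 - (-1) : ℤ).toNat = 2 := rfl
  have t1 : (1 - 0 : ℤ).toNat = 1 := rfl
  have t0 : (1 - 1 : ℤ).toNat = 0 := rfl
  simp only [map_add, map_one] at hs hx hy
  simp only [kernel, sum_Icc_neg_one_one, ellipse, map_sub, map_mul, map_pow, map_add,
    MvPolynomial.aeval_C, MvPolynomial.aeval_X, map_one, map_ofNat]
  simp only [t2, t1, t0, Matrix.cons_val_zero, Matrix.cons_val_one]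
  linear_combination (x * y - (x - 1) * (y - 1)) * hs + (1 - x) * hx + (1 - y) * hy

lemma aeval_a : aeval x S.a = algebraMap ℝ R S.ellipse.γ + algebraMap ℝ R S.ellipse.ε * (x - 1) +
    algebraMap ℝ R S.ellipse.ζ * (x - 1) ^ 2 := by
  have t2 : (1 - (-1) : ℤ).toNat = 2 := rfl
  have t1 : (1 - 0 : ℤ).toNat = 1 := rfl
  have t0 : (1 - 1 : ℤ).toNat = 0 := rfl
  simp only [a, row, sum_Icc_neg_one_one, ellipse, map_mul, map_pow, map_add, aeval_C, aeval_X,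
    map_ofNat]
  simp only [t2, t1, t0]
  ring

lemma aeval_b : aeval x S.b = -2 * aeval x S.a + algebraMap ℝ R S.ellipse.β * (x - 1) +
    algebraMap ℝ R S.ellipse.δ * (x - 1) ^ 2 := by
  have hs := congrArg (algebraMap ℝ R) S.sum_eq
  have hx := congrArg (algebraMap ℝ R) S.drift_x_eq
  have hy := congrArg (algebraMap ℝ R) S.drift_y_eq
  have t2 : (1 - (-1) : ℤ).toNat = 2 := rfl
  have t1 : (1 - 0 : ℤ).toNat = 1 := rfl
  have t0 : (1 - 1 : ℤ).toNat = 0 := rfl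
  simp only [map_add, map_one] at hs hx hy
  simp only [a, b, row, sum_Icc_neg_one_one, ellipse, map_mul, map_pow, map_add, map_sub,
    aeval_C, aeval_X, map_ofNat, map_one]
  simp only [t2, t1, t0]
  linear_combination hs - hy

lemma aeval_c : aeval x S.c = aeval x S.a - algebraMap ℝ R S.ellipse.β * (x - 1) -
    algebraMap ℝ R S.ellipse.δ * (x - 1) ^ 2 + algebraMap ℝ R S.ellipse.α * (x - 1) ^ 2 := by
  have hs := congrArg (algebraMap ℝ R) S.sum_eq
  have hx := congrArg (algebraMap ℝ R) S.drift_x_eq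
  have hy := congrArg (algebraMap ℝ R) S.drift_y_eq
  have t2 : (1 - (-1) : ℤ).toNat = 2 := rfl
  have t1 : (1 - 0 : ℤ).toNat = 1 := rfl
  have t0 : (1 - 1 : ℤ).toNat = 0 := rfl
  simp only [map_add, map_one] at hs hx hy
  simp only [a, c, row, sum_Icc_neg_one_one, ellipse, map_mul, map_pow, map_add, map_sub,
    aeval_C, aeval_X, map_ofNat, map_one]
  simp only [t2, t1, t0]
  linear_combination (x - 1) * hs - (x - 1) * hx + hy

end Evaluation

end StepModel

/-! ### Restriction of rational functions to the curve -/

lemma transcendental_inv {z : AlgFun} (h : Transcendental ℝ z) : Transcendental ℝ z⁻¹ :=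
  fun h' => h (by simpa using h'.inv)

lemma transcendental_add_one {z : AlgFun} (h : Transcendental ℝ z) : Transcendental ℝ (1 + z) :=
  fun h' => h (by simpa using h'.sub (isAlgebraic_one (R := ℝ)))

lemma transcendental_sub_one {z : AlgFun} (h : Transcendental ℝ z) : Transcendental ℝ (z - 1) :=
  fun h' => h (by simpa using h'.add (isAlgebraic_one (R := ℝ)))

lemma _root_.Transcendental.ne_zero {z : AlgFun} (h : Transcendental ℝ z) : z ≠ 0 := by
  rintro rfl
  exact h isAlgebraic_zero

lemma _root_.Transcendental.aeval_ne_zero {z : AlgFun} (h : Transcendental ℝ z) {f : ℝ[X]}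
    (hf : f ≠ 0) : aeval z f ≠ 0 := fun h0 => hf (transcendental_iff.mp h f h0)

/-- The substitution of `u = 1/(x-1)` and `w = 1/(y-1)` into a polynomial. -/
def embed (f : MvPolynomial (Fin 2) ℝ) : RatXY :=
  MvPolynomial.aeval ![(xx - 1)⁻¹, (yy - 1)⁻¹] f

namespace StepModel

variable (S : StepModel)

lemma aeval_kernel_eq_abc {R : Type} [CommRing R] [Algebra ℝ R] (x y : R) :
    MvPolynomial.aeval ![x, y] S.kernel = aeval x S.a * y ^ 2 + aeval x S.b * y + aeval x S.c := by
  rw [aeval_kernel, aeval_b, aeval_c, aeval_a]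
  ring

/-- Off the lines `x = 1` and `y = 1`, the kernel curve is the ellipse. -/
lemma aeval_kernel_eq_ellipse {E : Type} [Field E] [Algebra ℝ E] {x y : E} (hx : x ≠ 1)
    (hy : y ≠ 1) : MvPolynomial.aeval ![x, y] S.kernel =
      (x - 1) ^ 2 * (y - 1) ^ 2 * MvPolynomial.aeval ![(x - 1)⁻¹, (y - 1)⁻¹] S.ellipse.poly := by
  have hx' : x - 1 ≠ 0 := sub_ne_zero.mpr hx
  have hy' : y - 1 ≠ 0 := sub_ne_zero.mpr hy
  rw [aeval_kernel, Ellipse.aeval_poly]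
  generalize algebraMap ℝ E S.ellipse.α = A, algebraMap ℝ E S.ellipse.β = B,
    algebraMap ℝ E S.ellipse.γ = G, algebraMap ℝ E S.ellipse.δ = D,
    algebraMap ℝ E S.ellipse.ε = H, algebraMap ℝ E S.ellipse.ζ = Z
  field_simp

variable {S}

/-- On the curve, the substitution `Ψ` is the affine reflection of the ellipse. -/
lemma psi_value {U W : AlgFun} (h : S.ellipse.GenericPt U W) :
    (1 + W⁻¹)⁻¹ * (aeval (1 + U⁻¹) S.c / aeval (1 + U⁻¹) S.a) =
      1 + (S.ellipse.reflW U W)⁻¹ := by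
  have hU := h.left.ne_zero
  have hW := h.right.ne_zero
  have hW' := h.reflW.right.ne_zero
  have hy := (transcendental_add_one (transcendental_inv h.right)).ne_zero
  have ha : aeval (1 + U⁻¹) S.a ≠ 0 :=
    (transcendental_add_one (transcendental_inv h.left)).aeval_ne_zero S.a_ne_zero
  have hα : algebraMap ℝ AlgFun S.ellipse.α ≠ 0 := by simpa using S.ellipse.α_pos.ne'
  have hz := h.zero
  rw [Ellipse.aeval_poly] at hz
  have e1 : algebraMap ℝ AlgFun S.ellipse.α * (W + S.ellipse.reflW U W) =
      -(algebraMap ℝ AlgFun S.ellipse.β * U + algebraMap ℝ AlgFun S.ellipse.δ) := by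
    rw [Ellipse.reflW, map_div₀, map_div₀]
    field_simp
    ring
  have e2 : U ^ 2 * aeval (1 + U⁻¹) S.a =
      algebraMap ℝ AlgFun S.ellipse.α * (W * S.ellipse.reflW U W) := by
    have : U ^ 2 * aeval (1 + U⁻¹) S.a = algebraMap ℝ AlgFun S.ellipse.γ * U ^ 2 +
        algebraMap ℝ AlgFun S.ellipse.ε * U + algebraMap ℝ AlgFun S.ellipse.ζ := by
      rw [aeval_a]
      field_simp
      ring
    rw [this]
    linear_combination hz - W * e1
  have e3 : U ^ 2 * aeval (1 + U⁻¹) S.c =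
      algebraMap ℝ AlgFun S.ellipse.α * ((1 + W) * (1 + S.ellipse.reflW U W)) := by
    have : U ^ 2 * aeval (1 + U⁻¹) S.c = U ^ 2 * aeval (1 + U⁻¹) S.a -
        algebraMap ℝ AlgFun S.ellipse.β * U - algebraMap ℝ AlgFun S.ellipse.δ +
        algebraMap ℝ AlgFun S.ellipse.α := by
      rw [aeval_c]
      field_simp
      ring
    rw [this, e2]
    linear_combination -e1
  have e4 : aeval (1 + U⁻¹) S.c / aeval (1 + U⁻¹) S.a =
      ((1 + W) * (1 + S.ellipse.reflW U W)) / (W * S.ellipse.reflW U W) := by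
    rw [← mul_div_mul_left _ _ (pow_ne_zero 2 hU), e2, e3, mul_div_mul_left _ _ hα]
  have hW1 : W + 1 ≠ 0 := by
    intro h0
    apply hy
    field_simp
    linear_combination h0
  rw [e4]
  field_simp
  ring

lemma phi_value {U W : AlgFun} (h : S.ellipse.GenericPt U W) :
    (1 + U⁻¹)⁻¹ * (aeval (1 + W⁻¹) S.cT / aeval (1 + W⁻¹) S.aT) =
      1 + (S.ellipse.swap.reflW W U)⁻¹ := by
  have h' := h.swap
  rw [← transpose_ellipse] at h'
  have e := psi_value h'
  rwa [transpose_ellipse, transpose_a, transpose_c] at e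

variable (S) in
/-- The rational function `M(x, y)` is defined on the curve `K = 0` and its restriction is the
polynomial `g` in `u = 1/(x-1)` and `w = 1/(y-1)`. -/
def Restricts (M : RatXY) (g : MvPolynomial (Fin 2) ℝ) : Prop :=
  ∀ U W, S.ellipse.GenericPt U W →
    HasValueAt M (1 + U⁻¹) (1 + W⁻¹) (MvPolynomial.aeval ![U, W] g)

lemma restricts_embed (f : MvPolynomial (Fin 2) ℝ) : S.Restricts (embed f) f := by
  intro U W h
  have hx : HasValueAt (xx - 1)⁻¹ (1 + U⁻¹) (1 + W⁻¹) U := by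
    simpa using (hasValueAt_xx.sub hasValueAt_one).inv
      (by simpa using (h.left.ne_zero : U ≠ 0) : (1 + U⁻¹ : AlgFun) - 1 ≠ 0)
  have hy : HasValueAt (yy - 1)⁻¹ (1 + U⁻¹) (1 + W⁻¹) W := by
    simpa using (hasValueAt_yy.sub hasValueAt_one).inv
      (by simpa using (h.right.ne_zero : W ≠ 0) : (1 + W⁻¹ : AlgFun) - 1 ≠ 0)
  exact hx.mvAeval hy f

lemma Restricts.phi {M : RatXY} {g : MvPolynomial (Fin 2) ℝ} (h : S.Restricts M g) :
    S.Restricts (S.Phi M) (S.ellipse.phi g) := by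
  intro U W hUW
  have hx : HasValueAt (S.phiHom xx) (1 + U⁻¹) (1 + W⁻¹) (1 + (S.ellipse.swap.reflW W U)⁻¹) := by
    rw [← phi_value hUW, phiHom, substHom_xx, phiX]
    exact (hasValueAt_xx.inv (transcendental_add_one (transcendental_inv hUW.left)).ne_zero).mul
      ((hasValueAt_yy.aeval _).div (hasValueAt_yy.aeval _)
        ((transcendental_add_one (transcendental_inv hUW.right)).aeval_ne_zero S.aT_ne_zero))
  have hy : HasValueAt (S.phiHom yy) (1 + U⁻¹) (1 + W⁻¹) (1 + W⁻¹) := by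
    rw [phiHom, substHom_yy]
    exact hasValueAt_yy
  rw [Ellipse.aeval_phi]
  exact HasValueAt.map S.phiHom hx hy (h _ _ hUW.reflU)

lemma Restricts.psi {M : RatXY} {g : MvPolynomial (Fin 2) ℝ} (h : S.Restricts M g) :
    S.Restricts (S.Psi M) (S.ellipse.psi g) := by
  intro U W hUW
  have hy : HasValueAt (S.psiHom yy) (1 + U⁻¹) (1 + W⁻¹) (1 + (S.ellipse.reflW U W)⁻¹) := by
    rw [← psi_value hUW, psiHom, substHom_yy, psiY]
    exact (hasValueAt_yy.inv (transcendental_add_one (transcendental_inv hUW.right)).ne_zero).mul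
      ((hasValueAt_xx.aeval _).div (hasValueAt_xx.aeval _)
        ((transcendental_add_one (transcendental_inv hUW.left)).aeval_ne_zero S.a_ne_zero))
  have hx : HasValueAt (S.psiHom xx) (1 + U⁻¹) (1 + W⁻¹) (1 + U⁻¹) := by
    rw [psiHom, substHom_xx]
    exact hasValueAt_xx
  rw [Ellipse.aeval_psi]
  exact HasValueAt.map S.psiHom hx hy (h _ _ hUW.reflW)

lemma Restricts.theta_pow {M : RatXY} {g : MvPolynomial (Fin 2) ℝ} (h : S.Restricts M g) (i : ℕ) :
    S.Restricts ((S.Theta ^ i) M) (S.ellipse.theta^[i] g) := by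
  induction i with
  | zero => simpa using h
  | succ i ih =>
    rw [Function.iterate_succ_apply', pow_succ', AlgEquiv.mul_apply]
    exact ih.psi.phi

/-! ### The branches `X_±` and `Y_±` -/

lemma sqrtDiscY_sq :
    S.sqrtDiscY ^ 2 = aeval tt S.b ^ 2 - 4 * aeval tt S.a * aeval tt S.c :=
  Classical.choose_spec (IsAlgClosed.exists_pow_nat_eq _ two_pos)

lemma aeval_tt_a_ne_zero : aeval tt S.a ≠ 0 := tt_transcendental.aeval_ne_zero S.a_ne_zero

lemma tt_ne_one : tt ≠ 1 := by
  rw [← sub_ne_zero]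
  exact (transcendental_sub_one tt_transcendental).ne_zero

lemma kernel_Yplus : MvPolynomial.aeval ![tt, S.Yplus] S.kernel = 0 := by
  have ha := aeval_tt_a_ne_zero (S := S)
  rw [aeval_kernel_eq_abc, Yplus]
  field_simp
  linear_combination sqrtDiscY_sq (S := S)

lemma Yplus_ne_one : S.Yplus ≠ 1 := by
  intro h
  have h1 := kernel_Yplus (S := S)
  rw [h, aeval_kernel] at h1
  have h2 : algebraMap ℝ AlgFun S.ellipse.α * (tt - 1) ^ 2 = 0 := by linear_combination h1
  have h3 : algebraMap ℝ AlgFun S.ellipse.α ≠ 0 := by simpa using S.ellipse.α_pos.ne'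
  exact mul_ne_zero h3 (pow_ne_zero 2 (sub_ne_zero.mpr tt_ne_one)) h2

lemma genericPt_Yplus : S.ellipse.GenericPt (tt - 1)⁻¹ (S.Yplus - 1)⁻¹ := by
  refine Ellipse.genericPt_of_left
    (transcendental_inv (transcendental_sub_one tt_transcendental)) ?_
  have h := kernel_Yplus (S := S)
  rw [aeval_kernel_eq_ellipse S tt_ne_one Yplus_ne_one] at h
  refine (mul_eq_zero.mp h).resolve_left (mul_ne_zero ?_ ?_)
  · exact pow_ne_zero 2 (sub_ne_zero.mpr tt_ne_one)
  · exact pow_ne_zero 2 (sub_ne_zero.mpr Yplus_ne_one)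

lemma Yminus_eq : S.Yminus = 1 + (S.ellipse.reflW (tt - 1)⁻¹ (S.Yplus - 1)⁻¹)⁻¹ := by
  have ha := aeval_tt_a_ne_zero (S := S)
  have h := genericPt_Yplus (S := S)
  have hy : S.Yplus ≠ 0 := by
    simpa using (transcendental_add_one (transcendental_inv h.right)).ne_zero
  rw [← psi_value h]
  simp only [inv_inv, add_sub_cancel]
  rw [eq_inv_mul_iff_mul_eq₀ hy, eq_div_iff ha, Yplus, Yminus]
  field_simp
  linear_combination -sqrtDiscY_sq (S := S)

lemma genericPt_Xplus : S.ellipse.GenericPt (S.Xplus - 1)⁻¹ (tt - 1)⁻¹ := by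
  have h := (genericPt_Yplus (S := S.transpose)).swap
  rwa [transpose_ellipse, Ellipse.swap_swap, transpose_Yplus] at h

lemma Xplus_ne_one : S.Xplus ≠ 1 := Yplus_ne_one (S := S.transpose)

lemma Xminus_eq : S.Xminus = 1 + (S.ellipse.swap.reflW (tt - 1)⁻¹ (S.Xplus - 1)⁻¹)⁻¹ := by
  have h := Yminus_eq (S := S.transpose)
  rwa [transpose_ellipse, transpose_Yplus, transpose_Yminus] at h

lemma Restricts.unique {M : RatXY} {g g' : MvPolynomial (Fin 2) ℝ} (h : S.Restricts M g)
    (h' : S.Restricts M g') {U W : AlgFun} (hUW : S.ellipse.GenericPt U W) :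
    MvPolynomial.aeval ![U, W] g = MvPolynomial.aeval ![U, W] g' :=
  (h U W hUW).unique (h' U W hUW)

end StepModel

/-! ### The dihedral group and orbit sums -/

section Dihedral

variable {G : Type*} [Group G] {a b : G}

lemma conj_pow_of_involutions (ha : a * a = 1) (hb : b * b = 1) (i : ℤ) :
    b * (a * b) ^ i = (a * b) ^ (-i) * b := by
  have hb' : b⁻¹ = b := inv_eq_of_mul_eq_one_right hb
  have ha' : a⁻¹ = a := inv_eq_of_mul_eq_one_right ha
  have h : b * (a * b) * b⁻¹ = (a * b)⁻¹ := by
    rw [mul_inv_rev, ha', hb', mul_assoc, mul_assoc, hb, mul_one]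
  rw [zpow_neg, ← inv_zpow, ← h, conj_zpow, hb', mul_assoc, mul_assoc, hb, mul_one]

/-- The group generated by two involutions consists of rotations and reflections. -/
lemma mem_closure_involutions (ha : a * a = 1) (hb : b * b = 1) {g : G}
    (hg : g ∈ Subgroup.closure {a, b}) : ∃ i : ℤ, g = (a * b) ^ i ∨ g = (a * b) ^ i * b := by
  have hb' : b⁻¹ = b := inv_eq_of_mul_eq_one_right hb
  induction hg using Subgroup.closure_induction with
  | mem x hx =>
    rcases hx with rfl | rfl
    · exact ⟨1, Or.inr (by rw [zpow_one, mul_assoc, hb, mul_one])⟩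
    · exact ⟨0, Or.inr (by simp)⟩
  | one => exact ⟨0, Or.inl (by simp)⟩
  | mul x y _ _ hx hy =>
    obtain ⟨i, rfl | rfl⟩ := hx <;> obtain ⟨j, rfl | rfl⟩ := hy
    · exact ⟨i + j, Or.inl (zpow_add _ _ _).symm⟩
    · exact ⟨i + j, Or.inr (by rw [zpow_add, mul_assoc])⟩
    · refine ⟨i - j, Or.inr ?_⟩
      rw [mul_assoc, conj_pow_of_involutions ha hb, ← mul_assoc, ← zpow_add, sub_eq_add_neg]
    · refine ⟨i - j, Or.inl ?_⟩
      rw [mul_assoc, ← mul_assoc b, conj_pow_of_involutions ha hb, mul_assoc, hb, mul_one,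
        ← zpow_add, sub_eq_add_neg]
  | inv x _ hx =>
    obtain ⟨i, rfl | rfl⟩ := hx
    · exact ⟨-i, Or.inl (zpow_neg _ _).symm⟩
    · refine ⟨i, Or.inr ?_⟩
      rw [mul_inv_rev, hb', ← zpow_neg, conj_pow_of_involutions ha hb, neg_neg]

/-- If `b` were a power of `a b`, it would commute with `a`, so that `(a b)² = 1`. -/
lemma not_mem_zpowers_of_involutions (ha : a * a = 1) (hb : b * b = 1) (ha1 : a ≠ 1) (hb1 : b ≠ 1) :
    b ∉ Subgroup.zpowers (a * b) := by
  rintro ⟨k, hk⟩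
  simp only at hk
  have hc : Commute b (a * b) := by
    have h : Commute ((a * b) ^ k) (a * b) := (Commute.refl (a * b)).zpow_left k
    rwa [hk] at h
  have hsq : (a * b) ^ (2 : ℤ) = 1 := by
    have h := conj_pow_of_involutions ha hb 1
    rw [zpow_one, hc.eq, mul_left_inj] at h
    rw [zpow_two]
    nth_rewrite 1 [h]
    rw [zpow_neg, zpow_one, inv_mul_cancel]
  obtain ⟨j, rfl | rfl⟩ := Int.even_or_odd' k
  · rw [zpow_mul, hsq, one_zpow] at hk
    exact hb1 hk.symm
  · rw [zpow_add, zpow_mul, hsq, one_zpow, one_mul, zpow_one] at hk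
    exact ha1 (mul_eq_right.mp hk)

/-- A finite group generated by two nontrivial involutions `a`, `b` is listed without repetition by
the products `(a b)ⁱ bʲ`. -/
lemma bijective_dihedral (ha : a * a = 1) (hb : b * b = 1) (ha1 : a ≠ 1) (hb1 : b ≠ 1)
    (hfin : Finite (Subgroup.closure {a, b})) :
    ∃ e : Fin (orderOf (a * b)) × Fin 2 → Subgroup.closure {a, b},
      Function.Bijective e ∧ 0 < orderOf (a * b) ∧
      ∀ i j, (e (i, j) : G) = (a * b) ^ (i : ℕ) * b ^ (j : ℕ) := by
  have hamem : a ∈ Subgroup.closure {a, b} := Subgroup.subset_closure (by simp)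
  have hbmem : b ∈ Subgroup.closure {a, b} := Subgroup.subset_closure (by simp)
  have hnot := not_mem_zpowers_of_involutions ha hb ha1 hb1
  have hpos : 0 < orderOf (a * b) := by
    have h := orderOf_pos (⟨a * b, mul_mem hamem hbmem⟩ : Subgroup.closure {a, b})
    rwa [← Subgroup.orderOf_coe] at h
  refine ⟨fun p => ⟨(a * b) ^ (p.1 : ℕ) * b ^ (p.2 : ℕ),
    mul_mem (pow_mem (mul_mem hamem hbmem) _) (pow_mem hbmem _)⟩, ⟨?_, ?_⟩, hpos, fun i j => rfl⟩
  · have hne : ∀ i j : ℕ, (a * b) ^ i ≠ (a * b) ^ j * b := by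
      intro i j h
      apply hnot
      have hm : ((a * b) ^ j)⁻¹ * (a * b) ^ i ∈ Subgroup.zpowers (a * b) := mul_mem
        (inv_mem (pow_mem (Subgroup.mem_zpowers _) _)) (pow_mem (Subgroup.mem_zpowers _) _)
      rwa [← eq_inv_mul_iff_mul_eq.mpr h.symm] at hm
    have hinj : ∀ i j : Fin (orderOf (a * b)), (a * b) ^ (i : ℕ) = (a * b) ^ (j : ℕ) → i = j :=
      fun i j h => Fin.ext (pow_injOn_Iio_orderOf i.2 j.2 h)
    rintro ⟨i, s⟩ ⟨j, t⟩ h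
    have h' := congrArg Subtype.val h
    simp only at h'
    fin_cases s <;> fin_cases t
    · simp at h'
      rw [hinj i j h']
    · simp at h'
      exact absurd h' (hne _ _)
    · simp at h'
      exact absurd h'.symm (hne _ _)
    · simp at h'
      rw [hinj i j h']
  · rintro ⟨g, hg⟩
    have hred : ∀ i : ℤ, ∃ k : Fin (orderOf (a * b)), (a * b) ^ i = (a * b) ^ (k : ℕ) := by
      intro i
      have h0 : 0 ≤ i % (orderOf (a * b) : ℤ) := Int.emod_nonneg _ (by exact_mod_cast hpos.ne')
      have h1 : i % (orderOf (a * b) : ℤ) < orderOf (a * b) :=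
        Int.emod_lt_of_pos _ (by exact_mod_cast hpos)
      refine ⟨⟨(i % (orderOf (a * b) : ℤ)).toNat, by omega⟩, ?_⟩
      rw [← zpow_mod_orderOf, ← zpow_natCast]
      simp only [Int.toNat_of_nonneg h0]
    obtain ⟨i, h | h⟩ := mem_closure_involutions ha hb hg
    · obtain ⟨k, hk⟩ := hred i
      exact ⟨(k, 0), Subtype.ext (by simp [h, hk])⟩
    · obtain ⟨k, hk⟩ := hred i
      exact ⟨(k, 1), Subtype.ext (by simp [h, hk])⟩

end Dihedral

lemma sum_range_succ_of_periodic {R : Type*} [AddCommGroup R] (g : ℕ → R) {n : ℕ}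
    (h : g n = g 0) : ∑ i ∈ Finset.range n, g (i + 1) = ∑ i ∈ Finset.range n, g i := by
  have h1 := Finset.sum_range_succ g n
  rw [Finset.sum_range_succ', h] at h1
  exact add_right_cancel h1

lemma sum_range_sub_of_periodic {R : Type*} [AddCommGroup R] (g : ℕ → R) {n : ℕ}
    (h : g n = g 0) : ∑ i ∈ Finset.range n, g (n - i) = ∑ i ∈ Finset.range n, g i := by
  rw [← sum_range_succ_of_periodic g h, ← Finset.sum_range_reflect]
  refine Finset.sum_congr rfl fun i hi => ?_
  congr 1
  have := Finset.mem_range.mp hi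
  omega

lemma xx_ne_one : xx ≠ 1 := by
  have h : (aeval xx (X - 1 : ℝ[X])) ≠ 0 := aeval_xx_ne_zero (X_sub_C_ne_zero (1 : ℝ))
  rw [← sub_ne_zero]
  simpa using h

lemma yy_ne_one : yy ≠ 1 := by
  have h : (aeval yy (X - 1 : ℝ[X])) ≠ 0 := aeval_yy_ne_zero (X_sub_C_ne_zero (1 : ℝ))
  rw [← sub_ne_zero]
  simpa using h

namespace StepModel

variable (S : StepModel)

lemma Phi_xx : S.Phi xx = S.phiX := substHom_xx _ _ S.phi_injective

lemma Phi_yy : S.Phi yy = yy := substHom_yy _ _ S.phi_injective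

lemma Psi_xx : S.Psi xx = xx := substHom_xx _ _ S.psi_injective

lemma Psi_yy : S.Psi yy = S.psiY := substHom_yy _ _ S.psi_injective

lemma Phi_mul_self : S.Phi * S.Phi = 1 :=
  AlgEquiv.ext fun z => DFunLike.congr_fun S.phiHom_comp z

lemma Psi_mul_self : S.Psi * S.Psi = 1 :=
  AlgEquiv.ext fun z => DFunLike.congr_fun S.psiHom_comp z

lemma Psi_Psi (M : RatXY) : S.Psi (S.Psi M) = M := DFunLike.congr_fun S.psiHom_comp M

lemma Psi_ne_one : S.Psi ≠ 1 := by
  intro h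
  have h1 : S.psiY = yy := by rw [← Psi_yy, h]; rfl
  have ha := aeval_xx_ne_zero S.a_ne_zero
  rw [psiY, inv_mul_eq_iff_eq_mul₀ yy_ne_zero, div_eq_iff ha] at h1
  have e : algebraMap (MvPolynomial (Fin 2) ℝ) RatXY
      (aeval (MvPolynomial.X 0 : MvPolynomial (Fin 2) ℝ) S.c) =
      algebraMap _ RatXY (MvPolynomial.X 1 ^ 2 *
        aeval (MvPolynomial.X 0 : MvPolynomial (Fin 2) ℝ) S.a) := by
    rw [algebraMap_eq_aeval, algebraMap_eq_aeval, map_mul, mvAeval_aeval_X_zero,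
      mvAeval_aeval_X_zero, h1]
    simp [sq]
  have e2 := congrArg (MvPolynomial.aeval ![(X : ℝ[X]), 0])
    (IsFractionRing.injective (MvPolynomial (Fin 2) ℝ) RatXY e)
  rw [map_mul, mvAeval_aeval_X_zero, mvAeval_aeval_X_zero] at e2
  apply S.c_ne_zero
  simpa using e2

lemma Phi_ne_one : S.Phi ≠ 1 := by
  intro h
  have h1 : S.phiX = xx := by rw [← Phi_xx, h]; rfl
  have ha := aeval_yy_ne_zero S.aT_ne_zero
  rw [phiX, inv_mul_eq_iff_eq_mul₀ xx_ne_zero, div_eq_iff ha] at h1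
  have e : algebraMap (MvPolynomial (Fin 2) ℝ) RatXY
      (aeval (MvPolynomial.X 1 : MvPolynomial (Fin 2) ℝ) S.cT) =
      algebraMap _ RatXY (MvPolynomial.X 0 ^ 2 *
        aeval (MvPolynomial.X 1 : MvPolynomial (Fin 2) ℝ) S.aT) := by
    rw [algebraMap_eq_aeval, algebraMap_eq_aeval, map_mul, mvAeval_aeval_X_one,
      mvAeval_aeval_X_one, h1]
    simp [sq]
  have e2 := congrArg (MvPolynomial.aeval ![0, (X : ℝ[X])])
    (IsFractionRing.injective (MvPolynomial (Fin 2) ℝ) RatXY e)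
  rw [map_mul, mvAeval_aeval_X_one, mvAeval_aeval_X_one] at e2
  apply S.cT_ne_zero
  simpa using e2

variable {S}

lemma card_group (hfin : Finite S.group) : Nat.card S.group = orderOf S.Theta * 2 := by
  obtain ⟨e, he, -, -⟩ := bijective_dihedral S.Phi_mul_self S.Psi_mul_self S.Phi_ne_one S.Psi_ne_one
    hfin
  have h := Nat.card_congr (Equiv.ofBijective e he)
  rw [Nat.card_prod, Nat.card_fin, Nat.card_fin] at h
  exact h.symm

lemma card_group_div_two (hfin : Finite S.group) : Nat.card S.group / 2 = orderOf S.Theta := by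
  rw [card_group hfin, Nat.mul_div_cancel _ two_pos]

lemma orderOf_Theta_pos (hfin : Finite S.group) : 0 < orderOf S.Theta := by
  obtain ⟨e, -, h, -⟩ := bijective_dihedral S.Phi_mul_self S.Psi_mul_self S.Phi_ne_one S.Psi_ne_one
    hfin
  exact h

lemma orbitSum_eq (hfin : Finite S.group) (M : RatXY) : S.orbitSum M =
    ∑ i ∈ Finset.range (orderOf S.Theta), (S.Theta ^ i) M -
      ∑ i ∈ Finset.range (orderOf S.Theta), (S.Theta ^ i) (S.Psi M) := by
  obtain ⟨e, he, -, hval⟩ : ∃ e : Fin (orderOf S.Theta) × Fin 2 → S.group, Function.Bijective e ∧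
      0 < orderOf S.Theta ∧ ∀ i j, (e (i, j)).1 = S.Theta ^ (i : ℕ) * S.Psi ^ (j : ℕ) :=
    bijective_dihedral S.Phi_mul_self S.Psi_mul_self S.Phi_ne_one S.Psi_ne_one hfin
  have hnot := not_mem_zpowers_of_involutions S.Phi_mul_self S.Psi_mul_self S.Phi_ne_one
    S.Psi_ne_one
  have h0 : ∀ i : ℕ, S.sgn (S.Theta ^ i) = 1 := fun i =>
    if_pos (pow_mem (Subgroup.mem_zpowers _) _)
  have h1 : ∀ i : ℕ, S.sgn (S.Theta ^ i * S.Psi) = -1 := fun i =>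
    if_neg fun h => hnot ((Subgroup.mul_mem_cancel_left _
      (pow_mem (Subgroup.mem_zpowers S.Theta) _)).mp h)
  have h2 : S.orbitSum M = ∑ᶠ p : Fin (orderOf S.Theta) × Fin 2,
      S.sgn (e p).1 • (e p).1 M :=
    (finsum_eq_of_bijective e he fun _ => rfl).symm
  have h3 : ∀ i : Fin (orderOf S.Theta), ∑ j : Fin 2, S.sgn (e (i, j)).1 • (e (i, j)).1 M =
      (S.Theta ^ (i : ℕ)) M - (S.Theta ^ (i : ℕ)) (S.Psi M) := by
    intro i
    have e0 : (e (i, 0)).1 = S.Theta ^ (i : ℕ) := by simp [hval]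
    have e1 : (e (i, 1)).1 = S.Theta ^ (i : ℕ) * S.Psi := by simp [hval]
    rw [Fin.sum_univ_two, e0, e1, h0, h1, one_smul, neg_one_smul, AlgEquiv.mul_apply,
      sub_eq_add_neg]
  rw [h2, finsum_eq_sum_of_fintype, Fintype.sum_prod_type, Finset.sum_congr rfl fun i _ => h3 i,
    Finset.sum_sub_distrib, Fin.sum_univ_eq_sum_range (fun i => (S.Theta ^ i) M),
    Fin.sum_univ_eq_sum_range (fun i => (S.Theta ^ i) (S.Psi M))]

lemma orbitSum_sub (hfin : Finite S.group) (M M' : RatXY) :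
    S.orbitSum (M - M') = S.orbitSum M - S.orbitSum M' := by
  simp only [orbitSum_eq hfin, map_sub, Finset.sum_sub_distrib]
  ring

lemma orbitSum_mul (hfin : Finite S.group) {c : RatXY} (hΦ : S.Phi c = c) (hΨ : S.Psi c = c)
    (M : RatXY) : S.orbitSum (c * M) = c * S.orbitSum M := by
  have h : ∀ i : ℕ, (S.Theta ^ i) c = c := by
    intro i
    induction i with
    | zero => rfl
    | succ i ih => rw [pow_succ, AlgEquiv.mul_apply, Theta, AlgEquiv.mul_apply, hΨ, hΦ]; exact ih
  simp only [orbitSum_eq hfin, map_mul, h, hΨ, mul_sub, Finset.mul_sum]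

lemma orbitSum_of_Psi_eq (hfin : Finite S.group) {M : RatXY} (h : S.Psi M = M) :
    S.orbitSum M = 0 := by
  rw [orbitSum_eq hfin, h, sub_self]

lemma orbitSum_of_Phi_eq (hfin : Finite S.group) {M : RatXY} (h : S.Phi M = M) :
    S.orbitSum M = 0 := by
  have h1 : S.Theta (S.Psi M) = M := by rw [Theta, AlgEquiv.mul_apply, Psi_Psi, h]
  have h2 := sum_range_succ_of_periodic (fun i => (S.Theta ^ i) (S.Psi M))
    (n := orderOf S.Theta) (by simp [pow_orderOf_eq_one])
  rw [orbitSum_eq hfin, ← h2, sub_eq_zero]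
  refine Finset.sum_congr rfl fun i _ => ?_
  rw [pow_succ, AlgEquiv.mul_apply, h1]

/-- The elements `Ψ Θⁱ` run through the same elements as `Θⁱ Ψ`, namely the reflections. -/
lemma orbitSum_eq' (hfin : Finite S.group) (M : RatXY) : S.orbitSum M =
    ∑ i ∈ Finset.range (orderOf S.Theta), (S.Theta ^ i) M -
      ∑ i ∈ Finset.range (orderOf S.Theta), S.Psi ((S.Theta ^ i) M) := by
  rw [orbitSum_eq hfin, ← sum_range_sub_of_periodic (fun i => (S.Theta ^ i) (S.Psi M))
    (by simp [pow_orderOf_eq_one])]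
  congr 1
  refine Finset.sum_congr rfl fun i hi => ?_
  have h := conj_pow_of_involutions S.Phi_mul_self S.Psi_mul_self i
  have hi' := (Finset.mem_range.mp hi).le
  have h2 : S.Theta ^ (-(i : ℤ)) = S.Theta ^ (orderOf S.Theta - i) := by
    rw [zpow_neg, zpow_natCast, inv_eq_iff_mul_eq_one, ← pow_add, Nat.add_sub_cancel' hi',
      pow_orderOf_eq_one]
  change S.Psi * S.Theta ^ (i : ℤ) = S.Theta ^ (-(i : ℤ)) * S.Psi at h
  rw [h2, zpow_natCast] at h
  exact (DFunLike.congr_fun h M).symm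

lemma kernel_ne_zero : S.kernel ≠ 0 := by
  intro h
  have h1 := S.aeval_kernel (1 : ℝ) 2
  rw [h] at h1
  norm_num at h1
  exact S.ellipse.γ_pos.ne' h1.symm

lemma K_ne_zero : S.K ≠ 0 := algebraMap_ne_zero kernel_ne_zero

lemma K_eq_aeval : S.K = MvPolynomial.aeval ![xx, yy] S.kernel := algebraMap_eq_aeval _

lemma aeval_kernel_transpose {R : Type} [CommRing R] [Algebra ℝ R] (x y : R) :
    MvPolynomial.aeval ![y, x] S.transpose.kernel = MvPolynomial.aeval ![x, y] S.kernel := by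
  rw [aeval_kernel, aeval_kernel, transpose_ellipse]
  simp only [Ellipse.swap]
  ring

lemma aeval_kernel_eq_abcT {R : Type} [CommRing R] [Algebra ℝ R] (x y : R) :
    MvPolynomial.aeval ![x, y] S.kernel =
      aeval y S.aT * x ^ 2 + aeval y S.bT * x + aeval y S.cT := by
  rw [← aeval_kernel_transpose, aeval_kernel_eq_abc, transpose_a, transpose_b, transpose_c]

/-- The two roots in `y` of `K = a y² + b y + c` have product `c / a`, so that the substitution `Ψ`
multiplies `K` and `x y` by the same factor `c / (a y²)`. -/
lemma Psi_xy_div_K : S.Psi (xx * yy / S.K) = xx * yy / S.K := by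
  have ha := aeval_xx_ne_zero S.a_ne_zero
  have hc := aeval_xx_ne_zero S.c_ne_zero
  have hx := xx_ne_zero
  have hy := yy_ne_zero
  have hK := S.K_ne_zero
  have e : S.Psi S.K = (aeval xx S.c / (aeval xx S.a * yy ^ 2)) * S.K := by
    have h := algHom_algebraMap S.psiHom S.kernel
    change S.Psi S.K = MvPolynomial.aeval ![S.Psi xx, S.Psi yy] S.kernel at h
    rw [h, K_eq_aeval, Psi_xx, Psi_yy, aeval_kernel_eq_abc, aeval_kernel_eq_abc, psiY]
    field_simp
    ring
  rw [map_div₀, map_mul, e, Psi_xx, Psi_yy, psiY]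
  field_simp

lemma Phi_xy_div_K : S.Phi (xx * yy / S.K) = xx * yy / S.K := by
  have ha := aeval_yy_ne_zero S.aT_ne_zero
  have hc := aeval_yy_ne_zero S.cT_ne_zero
  have hx := xx_ne_zero
  have hy := yy_ne_zero
  have hK := S.K_ne_zero
  have e : S.Phi S.K = (aeval yy S.cT / (aeval yy S.aT * xx ^ 2)) * S.K := by
    have h := algHom_algebraMap S.phiHom S.kernel
    change S.Phi S.K = MvPolynomial.aeval ![S.Phi xx, S.Phi yy] S.kernel at h
    rw [h, K_eq_aeval, Phi_xx, Phi_yy, aeval_kernel_eq_abcT, aeval_kernel_eq_abcT, phiX]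
    field_simp
    ring
  rw [map_div₀, map_mul, e, Phi_xx, Phi_yy, phiX]
  field_simp

end StepModel

/-! ### Dickson polynomials and the gluing function -/

lemma dickson_one_zero (A : ℝ) : dickson 1 A 0 = C 2 := by
  rw [dickson_zero]
  norm_num
  rfl

/-- The Dickson polynomial `D_n(v, A)` takes the value `sⁿ + tⁿ` at `v = s + t`, if `s t = A`. -/
lemma aeval_dickson {R : Type} [CommRing R] [Algebra ℝ R] {A : ℝ} {s t : R}
    (h : s * t = algebraMap ℝ R A) (n : ℕ) : aeval (s + t) (dickson 1 A n) = s ^ n + t ^ n := by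
  have key : aeval (s + t) (dickson 1 A n) = s ^ n + t ^ n ∧
      aeval (s + t) (dickson 1 A (n + 1)) = s ^ (n + 1) + t ^ (n + 1) := by
    induction n with
    | zero =>
      constructor
      · rw [dickson_one_zero, aeval_C, map_ofNat]
        norm_num
      · rw [zero_add, dickson_one]
        simp
    | succ n ih =>
      refine ⟨ih.2, ?_⟩
      rw [dickson_add_two, map_sub, map_mul, map_mul, aeval_X, aeval_C, ← h, ih.1, ih.2]
      ring
  exact key.1

lemma natDegree_dickson_le (A : ℝ) (n : ℕ) : (dickson 1 A n).natDegree ≤ n ∧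
    (dickson 1 A (n + 1)).natDegree ≤ n + 1 ∧ (dickson 1 A (n + 1)).coeff (n + 1) = 1 := by
  induction n with
  | zero =>
    refine ⟨?_, ?_, ?_⟩
    · rw [dickson_one_zero, natDegree_C]
    · rw [zero_add, dickson_one, natDegree_X]
    · rw [zero_add, dickson_one, coeff_X_one]
  | succ n ih =>
    refine ⟨ih.2.1, ?_, ?_⟩
    · rw [dickson_add_two]
      refine (natDegree_sub_le _ _).trans (max_le ?_ ?_)
      · refine natDegree_mul_le.trans ?_
        rw [natDegree_X]
        omega
      · exact (natDegree_C_mul_le _ _).trans (by omega)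
    · rw [dickson_add_two, coeff_sub, coeff_X_mul, coeff_C_mul, ih.2.2,
        coeff_eq_zero_of_natDegree_lt (p := dickson 1 A n) (by omega)]
      ring

lemma natDegree_dickson {A : ℝ} {n : ℕ} (hn : n ≠ 0) : (dickson 1 A n).natDegree = n := by
  obtain ⟨k, rfl⟩ := Nat.exists_eq_succ_of_ne_zero hn
  obtain ⟨-, h1, h2⟩ := natDegree_dickson_le A k
  exact natDegree_eq_of_le_of_coeff_ne_zero h1 (by rw [h2]; exact one_ne_zero)

namespace Ellipse

variable (C : Ellipse)

/-- The affine function of `U` whose zero is the centre of the ellipse. -/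
def centred : ℝ[X] :=
  Polynomial.C (2 * (C.β ^ 2 - 4 * C.α * C.γ)) * X +
    Polynomial.C (2 * C.β * C.δ - 4 * C.α * C.ε)

/-- A quarter of the discriminant of `(β² - 4 α γ) U² + (2 β δ - 4 α ε) U + δ² - 4 α ζ`, which is
the discriminant with respect to `W` of the equation of the ellipse. -/
def quarterDisc : ℝ :=
  ((2 * C.β * C.δ - 4 * C.α * C.ε) ^ 2 -
    4 * (C.δ ^ 2 - 4 * C.α * C.ζ) * (C.β ^ 2 - 4 * C.α * C.γ)) / 4

lemma natDegree_centred : C.centred.natDegree = 1 :=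
  natDegree_linear (by have := C.disc_pos; intro h; linarith)

lemma quarterDisc_swap : C.swap.quarterDisc = C.γ / C.α * C.quarterDisc := by
  have := C.α_pos.ne'
  simp only [quarterDisc, swap]
  field_simp
  ring

variable {C}

/-- The ellipse is parametrised by `s` with `centred(U) = s + A/s`, and then the centred second
coordinate is `√(γ/α) (e^{iθ} s + A / (e^{iθ} s))`. If `e^{imθ} = -1`, the values of the Dickson
polynomials at the two coordinates are proportional. -/
lemma dickson_centred {θ : ℝ} {m : ℕ} (hm : m * θ = Real.pi)
    (hcos : √(C.γ / C.α) * Real.cos θ = -C.β / (2 * C.α))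
    (hsin : √(C.γ / C.α) * (Real.sin θ * √(4 * C.α * C.γ - C.β ^ 2)) =
      (4 * C.α * C.γ - C.β ^ 2) / (2 * C.α))
    {U W : AlgFun} (h : MvPolynomial.aeval ![U, W] C.poly = 0) :
    aeval W ((dickson 1 C.swap.quarterDisc m).comp C.swap.centred) =
      -(algebraMap ℝ AlgFun (√(C.γ / C.α))) ^ m *
        aeval U ((dickson 1 C.quarterDisc m).comp C.centred) := by
  have hα := C.α_pos
  have hγ := C.γ_pos
  have hdisc := C.disc_pos
  -- `ℂ` embeds into the algebraically closed field, which gives sense to `e^{iθ}` there.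
  set j : ℂ →ₐ[ℝ] AlgFun := IsAlgClosed.lift with hj
  set r : ℝ →+* AlgFun := algebraMap ℝ AlgFun with hr
  set κ := √(C.γ / C.α) with hκ
  set ρ := √(4 * C.α * C.γ - C.β ^ 2) with hρ
  have hκ2 : κ ^ 2 = C.γ / C.α := Real.sq_sqrt (div_pos hγ hα).le
  have hρ2 : ρ ^ 2 = 4 * C.α * C.γ - C.β ^ 2 := Real.sq_sqrt (by linarith)
  set I := j Complex.I with hI
  have hI2 : I ^ 2 = -1 := by rw [hI, ← map_pow, Complex.I_sq, map_neg, map_one]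
  have hjr : ∀ x : ℝ, j (x : ℂ) = r x := fun x => by
    rw [hr, ← j.commutes]
    rfl
  set e := r (Real.cos θ) + r (Real.sin θ) * I with he
  set e' := r (Real.cos θ) - r (Real.sin θ) * I with he'
  have hee' : e * e' = 1 := by
    have h1 : r (Real.cos θ) ^ 2 + r (Real.sin θ) ^ 2 = 1 := by
      rw [← map_pow, ← map_pow, ← map_add, Real.cos_sq_add_sin_sq, map_one]
    rw [he, he']
    linear_combination h1 - r (Real.sin θ) ^ 2 * hI2
  have hem : e ^ m = -1 := by
    have h1 : e = j (Complex.exp (θ * Complex.I)) := by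
      rw [Complex.exp_mul_I, map_add, map_mul, ← Complex.ofReal_cos, ← Complex.ofReal_sin, hjr, hjr]
    have h2 : (m : ℂ) * (θ * Complex.I) = Real.pi * Complex.I := by
      rw [← hm]
      push_cast
      ring
    rw [h1, ← map_pow, ← Complex.exp_nat_mul, h2, Complex.exp_pi_mul_I, map_neg, map_one]
  have hem' : e' ^ m = -1 := by
    have h1 : e ^ m * e' ^ m = 1 := by rw [← mul_pow, hee', one_pow]
    rw [hem] at h1
    linear_combination -h1
  set v := aeval U C.centred with hv
  set z := 2 * r C.α * W + r C.β * U + r C.δ with hz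
  -- `z²` is the discriminant in `W` of the equation of the ellipse, hence `s t = A`.
  set s := (v + 2 * I * r ρ * z) / 2 with hs
  set t := (v - 2 * I * r ρ * z) / 2 with ht
  have hρ2' : r ρ ^ 2 = 4 * r C.α * r C.γ - r C.β ^ 2 := by
    rw [← map_pow, hρ2]
    simp only [map_sub, map_mul, map_pow, map_ofNat]
  have hv' : v = 2 * (r C.β ^ 2 - 4 * r C.α * r C.γ) * U +
      (2 * r C.β * r C.δ - 4 * r C.α * r C.ε) := by
    rw [hv, centred]
    simp only [map_add, map_sub, map_mul, map_pow, map_ofNat, aeval_X, aeval_C, ← hr]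
  have hst : s * t = r C.quarterDisc := by
    rw [aeval_poly] at h
    have h4 : r C.quarterDisc = ((2 * r C.β * r C.δ - 4 * r C.α * r C.ε) ^ 2 -
        4 * (r C.δ ^ 2 - 4 * r C.α * r C.ζ) * (r C.β ^ 2 - 4 * r C.α * r C.γ)) / 4 := by
      rw [quarterDisc]
      simp only [map_sub, map_div₀, map_mul, map_pow, map_ofNat]
    rw [h4, hs, ht, hv', hz]
    linear_combination (-(2 * r C.α * W + r C.β * U + r C.δ) ^ 2 * r ρ ^ 2) * hI2 +
      ((2 * r C.α * W + r C.β * U + r C.δ) ^ 2) * hρ2' +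
      (4 * r C.α * (4 * r C.α * r C.γ - r C.β ^ 2)) * h
  have hsum : s + t = v := by rw [hs, ht]; ring
  have hst' : (r κ * e * s) * (r κ * e' * t) = r C.swap.quarterDisc := by
    rw [quarterDisc_swap, map_mul, ← hst, ← hκ2, map_pow]
    linear_combination (r κ ^ 2 * s * t) * hee'
  have hα' : r C.α ≠ 0 := by simpa [hr] using hα.ne'
  have hcos' : r κ * r (Real.cos θ) = -r C.β / (2 * r C.α) := by
    rw [← map_mul, hcos]
    simp only [map_div₀, map_neg, map_mul, map_ofNat]
  have hsin' : r κ * (r (Real.sin θ) * r ρ) = (4 * r C.α * r C.γ - r C.β ^ 2) / (2 * r C.α) := by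
    rw [← map_mul, ← map_mul, hsin]
    simp only [map_div₀, map_sub, map_mul, map_pow, map_ofNat]
  have hsum' : r κ * e * s + r κ * e' * t = aeval W C.swap.centred := by
    have h1 : r κ * e * s + r κ * e' * t =
        (r κ * r (Real.cos θ)) * v - 2 * (r κ * (r (Real.sin θ) * r ρ)) * z := by
      rw [he, he', hs, ht]
      linear_combination (2 * r κ * r (Real.sin θ) * r ρ * z) * hI2
    rw [h1, hcos', hsin', hv', hz, centred]
    simp only [swap, map_add, map_sub, map_mul, map_pow, map_ofNat, aeval_X, aeval_C, ← hr]
    field_simp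
    ring
  rw [aeval_comp, aeval_comp, ← hsum', ← hv, ← hsum, aeval_dickson hst', aeval_dickson hst]
  simp only [mul_pow, hem, hem']
  ring

end Ellipse

namespace StepModel

variable (S : StepModel)

lemma sum_sq_x : ∑ i ∈ Finset.Icc (-1 : ℤ) 1, ∑ j ∈ Finset.Icc (-1 : ℤ) 1, (i : ℝ) ^ 2 * S.p i j =
    2 * S.ellipse.α := by
  have h := S.drift_x_eq
  simp [sum_Icc_neg_one_one, ellipse]
  linarith

lemma sum_sq_y : ∑ i ∈ Finset.Icc (-1 : ℤ) 1, ∑ j ∈ Finset.Icc (-1 : ℤ) 1, (j : ℝ) ^ 2 * S.p i j =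
    2 * S.ellipse.γ := by
  have h := S.drift_y_eq
  simp [sum_Icc_neg_one_one, ellipse]
  linarith

lemma sum_xy : ∑ i ∈ Finset.Icc (-1 : ℤ) 1, ∑ j ∈ Finset.Icc (-1 : ℤ) 1,
    (i : ℝ) * (j : ℝ) * S.p i j = S.ellipse.β := by
  rw [ellipse_β]
  simp [sum_Icc_neg_one_one]
  ring

lemma theta_eq :
    S.theta = Real.arccos (-S.ellipse.β / (2 * (√S.ellipse.α * √S.ellipse.γ))) := by
  rw [theta, sum_sq_x, sum_sq_y, sum_xy, Real.sqrt_mul zero_le_two, Real.sqrt_mul zero_le_two]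
  congr 2
  linear_combination (√S.ellipse.α * √S.ellipse.γ) * Real.mul_self_sqrt (zero_le_two (α := ℝ))

lemma cos_theta_sq_lt :
    (-S.ellipse.β / (2 * (√S.ellipse.α * √S.ellipse.γ))) ^ 2 < 1 := by
  have hα := Real.sqrt_pos.mpr S.ellipse.α_pos
  have hγ := Real.sqrt_pos.mpr S.ellipse.γ_pos
  rw [div_pow, div_lt_one (by positivity), mul_pow, mul_pow, Real.sq_sqrt S.ellipse.α_pos.le,
    Real.sq_sqrt S.ellipse.γ_pos.le]
  linarith [S.ellipse.disc_pos]

lemma theta_pos : 0 < S.theta := by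
  rw [theta_eq, Real.arccos_pos]
  exact lt_of_abs_lt ((sq_lt_one_iff_abs_lt_one _).mp S.cos_theta_sq_lt)

lemma cos_theta : √(S.ellipse.γ / S.ellipse.α) * Real.cos S.theta =
    -S.ellipse.β / (2 * S.ellipse.α) := by
  have hα := Real.sqrt_pos.mpr S.ellipse.α_pos
  have hγ := Real.sqrt_pos.mpr S.ellipse.γ_pos
  have h := abs_lt.mp ((sq_lt_one_iff_abs_lt_one _).mp S.cos_theta_sq_lt)
  rw [theta_eq, Real.cos_arccos h.1.le h.2.le, Real.sqrt_div S.ellipse.γ_pos.le]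
  rw [div_mul_div_comm, div_eq_div_iff (by positivity) (by linarith [S.ellipse.α_pos])]
  linear_combination (2 * S.ellipse.β * √S.ellipse.γ) * Real.sq_sqrt S.ellipse.α_pos.le

lemma sin_theta : √(S.ellipse.γ / S.ellipse.α) *
    (Real.sin S.theta * √(4 * S.ellipse.α * S.ellipse.γ - S.ellipse.β ^ 2)) =
      (4 * S.ellipse.α * S.ellipse.γ - S.ellipse.β ^ 2) / (2 * S.ellipse.α) := by
  have hα := Real.sqrt_pos.mpr S.ellipse.α_pos
  have hγ := Real.sqrt_pos.mpr S.ellipse.γ_pos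
  have hα2 := Real.sq_sqrt S.ellipse.α_pos.le
  have hγ2 := Real.sq_sqrt S.ellipse.γ_pos.le
  have hd : 0 ≤ 4 * S.ellipse.α * S.ellipse.γ - S.ellipse.β ^ 2 := by
    linarith [S.ellipse.disc_pos]
  have e : 1 - (-S.ellipse.β / (2 * (√S.ellipse.α * √S.ellipse.γ))) ^ 2 =
      (4 * S.ellipse.α * S.ellipse.γ - S.ellipse.β ^ 2) /
        (2 * (√S.ellipse.α * √S.ellipse.γ)) ^ 2 := by
    rw [div_pow, eq_div_iff (by positivity), sub_mul, div_mul_cancel₀ _ (by positivity)]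
    linear_combination 4 * S.ellipse.γ * hα2 + 4 * √S.ellipse.α ^ 2 * hγ2
  rw [theta_eq, Real.sin_arccos, e, Real.sqrt_div hd, Real.sqrt_sq (by positivity),
    Real.sqrt_div S.ellipse.γ_pos.le, div_mul_eq_mul_div _ _ (√_), Real.mul_self_sqrt hd]
  nth_rewrite 5 [← hα2]
  field_simp

lemma branchQuad_eq : S.branchQuad =
    C (S.ellipse.δ ^ 2 - 4 * S.ellipse.α * S.ellipse.ζ) * X ^ 2 +
      C (2 * S.ellipse.β * S.ellipse.δ - 4 * S.ellipse.α * S.ellipse.ε -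
        2 * (S.ellipse.δ ^ 2 - 4 * S.ellipse.α * S.ellipse.ζ)) * X +
      C (S.ellipse.β ^ 2 - 4 * S.ellipse.α * S.ellipse.γ -
        (2 * S.ellipse.β * S.ellipse.δ - 4 * S.ellipse.α * S.ellipse.ε) +
        (S.ellipse.δ ^ 2 - 4 * S.ellipse.α * S.ellipse.ζ)) := by
  have ha := S.aeval_a (X : ℝ[X])
  have hb := S.aeval_b (X : ℝ[X])
  have hc := S.aeval_c (X : ℝ[X])
  rw [aeval_X_left_apply] at ha hb hc
  rw [aeval_X_left_apply] at hb hc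
  rw [branchQuad, ← mul_divByMonic_cancel_left (q := (X - C (1 : ℝ)) ^ 2)
    (C (S.ellipse.δ ^ 2 - 4 * S.ellipse.α * S.ellipse.ζ) * X ^ 2 +
      C (2 * S.ellipse.β * S.ellipse.δ - 4 * S.ellipse.α * S.ellipse.ε -
        2 * (S.ellipse.δ ^ 2 - 4 * S.ellipse.α * S.ellipse.ζ)) * X +
      C (S.ellipse.β ^ 2 - 4 * S.ellipse.α * S.ellipse.γ -
        (2 * S.ellipse.β * S.ellipse.δ - 4 * S.ellipse.α * S.ellipse.ε) +
        (S.ellipse.δ ^ 2 - 4 * S.ellipse.α * S.ellipse.ζ))) ((monic_X_sub_C (1 : ℝ)).pow 2)]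
  congr 1
  rw [hb, hc, ha]
  simp only [algebraMap_eq, map_sub, map_add, map_mul, map_pow, map_ofNat, map_one]
  ring

lemma quarterDisc_eq : S.quarterDisc = S.ellipse.quarterDisc := by
  rw [quarterDisc, branchQuad_eq, Ellipse.quarterDisc]
  simp only [coeff_add, coeff_C_mul, coeff_X_pow, coeff_X, coeff_C]
  norm_num
  ring

lemma moebius_eq : S.moebius = inU S.ellipse.centred := by
  have h1 : 2 * S.branchQuad.eval 1 = 2 * (S.ellipse.β ^ 2 - 4 * S.ellipse.α * S.ellipse.γ) := by
    rw [branchQuad_eq]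
    simp only [eval_add, eval_mul, eval_pow, eval_X, eval_C]
    ring
  have h2 : (derivative S.branchQuad).eval 1 =
      2 * S.ellipse.β * S.ellipse.δ - 4 * S.ellipse.α * S.ellipse.ε := by
    rw [branchQuad_eq]
    simp only [derivative_add, derivative_mul, derivative_C, derivative_X_pow, derivative_X,
      eval_add, eval_mul, eval_pow, eval_X, eval_C, eval_zero, eval_one]
    norm_num
    ring
  rw [moebius, h1, h2, inU, Ellipse.centred]
  simp only [map_add, map_mul, map_sub, map_pow, map_ofNat, aeval_X, aeval_C, div_eq_mul_inv,
    RatFunc.algebraMap_eq_C]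

/-- In the coordinates `u = 1/(x-1)` and `w = 1/(y-1)`, the gluing function is a polynomial of
degree `m` in `u` which on the curve is also a polynomial in `w`. -/
theorem exists_gluing {m : ℕ} (hm : Real.pi / S.theta = m) {C₀ : ℝ} (hC₀ : C₀ ≠ 0) :
    ∃ f g : ℝ[X], RatFunc.C C₀ * S.omega m = inU f ∧ f ≠ 0 ∧ f.natDegree = m ∧ g.natDegree ≤ m ∧
      f.eval (-1) = 0 ∧ ∀ U W, S.ellipse.GenericPt U W → aeval U f = aeval W g := by
  have hθ := S.theta_pos
  have hm' : m * S.theta = Real.pi := by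
    rw [← hm]
    field_simp
  have hm0 : m ≠ 0 := by
    rintro rfl
    simp at hm'
    exact Real.pi_ne_zero hm'.symm
  set D := (dickson 1 S.ellipse.quarterDisc m).comp S.ellipse.centred with hD
  set D' := (dickson 1 S.ellipse.swap.quarterDisc m).comp S.ellipse.swap.centred with hD'
  have hκ : √(S.ellipse.γ / S.ellipse.α) ^ m ≠ 0 :=
    pow_ne_zero _ (Real.sqrt_pos.mpr (div_pos S.ellipse.γ_pos S.ellipse.α_pos)).ne'
  have hDdeg : D.natDegree = m := by
    rw [hD, natDegree_comp, natDegree_dickson hm0, Ellipse.natDegree_centred, mul_one]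
  have hDdeg' : D'.natDegree = m := by
    rw [hD', natDegree_comp, natDegree_dickson hm0, Ellipse.natDegree_centred, mul_one]
  have h0 : (dickson 1 S.quarterDisc m).eval (subst S.moebius (0 : ℝ)) = D.eval (-1) := by
    rw [moebius_eq, subst_inU zero_ne_one, quarterDisc_eq, hD, eval_comp]
    norm_num
  have hf : (C C₀ * (D - C (D.eval (-1)))).natDegree = m := by
    rw [natDegree_C_mul hC₀, natDegree_sub_C, hDdeg]
  -- The value of `u` at `x = 0` is `-1`.
  refine ⟨C C₀ * (D - C (D.eval (-1))),
    C C₀ * (C (-(√(S.ellipse.γ / S.ellipse.α) ^ m)⁻¹) * D' - C (D.eval (-1))),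
    ?_, ?_, hf, ?_, ?_, ?_⟩
  · rw [omega, h0, moebius_eq, quarterDisc_eq, inU, inU, map_mul, map_sub, aeval_C, aeval_C, hD,
      aeval_comp]
    rfl
  · intro h
    rw [h, natDegree_zero] at hf
    exact hm0 hf.symm
  · refine (natDegree_C_mul_le _ _).trans ?_
    rw [natDegree_sub_C]
    exact (natDegree_C_mul_le _ _).trans hDdeg'.le
  · simp
  · intro U W h
    have e := Ellipse.dickson_centred hm' S.cos_theta S.sin_theta h.zero
    rw [← hD, ← hD'] at e
    have hκ' : algebraMap ℝ AlgFun (√(S.ellipse.γ / S.ellipse.α)) ^ m ≠ 0 := by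
      rw [← map_pow]
      simpa using hκ
    have e2 : aeval W (C (-(√(S.ellipse.γ / S.ellipse.α) ^ m)⁻¹) * D') = aeval U D := by
      rw [map_mul, e, aeval_C, map_neg, map_inv₀, map_pow]
      field_simp
    rw [map_mul, map_mul, map_sub, map_sub, e2]
    simp

end StepModel

/-! ### Poles and power series expansions -/

lemma embed_add (f g : MvPolynomial (Fin 2) ℝ) : embed (f + g) = embed f + embed g := map_add _ _ _

lemma embed_mul (f g : MvPolynomial (Fin 2) ℝ) : embed (f * g) = embed f * embed g := map_mul _ _ _

lemma one_sub_xx_ne_zero : 1 - xx ≠ 0 := sub_ne_zero.mpr xx_ne_one.symm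

lemma one_sub_yy_ne_zero : 1 - yy ≠ 0 := sub_ne_zero.mpr yy_ne_one.symm

/-- A polynomial of degree at most `e` in `1/(x-1)` and `1/(y-1)` has poles of order at most `e`. -/
lemma exists_embed_eq_div {f : MvPolynomial (Fin 2) ℝ} {e : ℕ} (hf : f.totalDegree ≤ e) :
    ∃ P : MvPolynomial (Fin 2) ℝ, embed f =
      algebraMap (MvPolynomial (Fin 2) ℝ) RatXY P / ((1 - xx) ^ e * (1 - yy) ^ e) := by
  have hx := one_sub_xx_ne_zero
  have hy := one_sub_yy_ne_zero
  refine ⟨∑ d ∈ f.support, MvPolynomial.C (f.coeff d) *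
    ((-1) ^ d 0 * (1 - MvPolynomial.X 0) ^ (e - d 0)) *
    ((-1) ^ d 1 * (1 - MvPolynomial.X 1) ^ (e - d 1)), ?_⟩
  rw [algebraMap_eq_aeval, map_sum, Finset.sum_div]
  conv_lhs => rw [embed, f.as_sum, map_sum]
  refine Finset.sum_congr rfl fun d hd => ?_
  have hd' : d 0 + d 1 ≤ e := by
    refine le_trans ?_ ((MvPolynomial.le_totalDegree hd).trans hf)
    rw [Finsupp.sum_fintype _ _ (by simp), Fin.sum_univ_two]
  have key : ∀ (z : RatXY) (n : ℕ), 1 - z ≠ 0 → n ≤ e →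
      (z - 1)⁻¹ ^ n = (-1) ^ n * (1 - z) ^ (e - n) / (1 - z) ^ e := by
    intro z n hz hn
    obtain ⟨l, rfl⟩ := Nat.exists_eq_add_of_le hn
    rw [← neg_sub, inv_neg, neg_pow, Nat.add_sub_cancel_left, pow_add, inv_pow]
    field_simp
  rw [MvPolynomial.aeval_monomial, Finsupp.prod_fintype _ _ (by simp), Fin.prod_univ_two]
  simp only [Matrix.cons_val_zero, Matrix.cons_val_one, map_mul, map_pow, map_sub, map_neg, map_one,
    MvPolynomial.aeval_C, MvPolynomial.aeval_X]
  rw [key xx (d 0) hx (by omega), key yy (d 1) hy (by omega)]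
  field_simp

/-- The expansion at the origin of the polynomials in `1/(x-1)` and `1/(y-1)`. -/
def expand : MvPolynomial (Fin 2) ℝ →ₐ[ℝ] MvPowerSeries (Fin 2) ℝ :=
  MvPolynomial.aeval ![(MvPowerSeries.X 0 - 1)⁻¹, (MvPowerSeries.X 1 - 1)⁻¹]

lemma X_sub_one_mul_inv (i : Fin 2) : ((MvPowerSeries.X i - 1) * (MvPowerSeries.X i - 1)⁻¹ :
    MvPowerSeries (Fin 2) ℝ) = 1 :=
  MvPowerSeries.mul_inv_cancel _ (by simp)

/-- The rational function `H` is regular at the origin and `s` is its power series there. -/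
def HasExpansion (H : RatXY) (s : MvPowerSeries (Fin 2) ℝ) : Prop :=
  ∃ P Q : MvPolynomial (Fin 2) ℝ, MvPolynomial.constantCoeff Q ≠ 0 ∧
    H = algebraMap _ RatXY P / algebraMap _ RatXY Q ∧
    (Q : MvPowerSeries (Fin 2) ℝ) * s = (P : MvPowerSeries (Fin 2) ℝ)

lemma ne_zero_of_constantCoeff {Q : MvPolynomial (Fin 2) ℝ}
    (h : MvPolynomial.constantCoeff Q ≠ 0) : Q ≠ 0 := by
  rintro rfl
  simp at h

lemma HasExpansion.add {H H' : RatXY} {s s' : MvPowerSeries (Fin 2) ℝ} (h : HasExpansion H s)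
    (h' : HasExpansion H' s') : HasExpansion (H + H') (s + s') := by
  obtain ⟨P, Q, hQ, rfl, e⟩ := h
  obtain ⟨P', Q', hQ', rfl, e'⟩ := h'
  refine ⟨P * Q' + Q * P', Q * Q', by simp [hQ, hQ'], ?_, ?_⟩
  · rw [div_add_div _ _ (algebraMap_ne_zero (ne_zero_of_constantCoeff hQ))
      (algebraMap_ne_zero (ne_zero_of_constantCoeff hQ'))]
    simp only [map_add, map_mul]
  · push_cast
    linear_combination (Q' : MvPowerSeries (Fin 2) ℝ) * e + (Q : MvPowerSeries (Fin 2) ℝ) * e'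

lemma HasExpansion.mul {H H' : RatXY} {s s' : MvPowerSeries (Fin 2) ℝ} (h : HasExpansion H s)
    (h' : HasExpansion H' s') : HasExpansion (H * H') (s * s') := by
  obtain ⟨P, Q, hQ, rfl, e⟩ := h
  obtain ⟨P', Q', hQ', rfl, e'⟩ := h'
  refine ⟨P * P', Q * Q', by simp [hQ, hQ'], ?_, ?_⟩
  · simp only [map_mul, div_mul_div_comm]
  · push_cast
    rw [← e, ← e']
    ring

lemma hasExpansion_inv (i : Fin 2) :
    HasExpansion ((algebraMap (MvPolynomial (Fin 2) ℝ) RatXY (MvPolynomial.X i) - 1)⁻¹)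
      (MvPowerSeries.X i - 1)⁻¹ :=
  ⟨1, MvPolynomial.X i - 1, by simp, by simp, by
    have h := map_sub (MvPolynomial.coeToMvPowerSeries.ringHom (σ := Fin 2) (R := ℝ))
      (MvPolynomial.X i) 1
    simp only [MvPolynomial.coeToMvPowerSeries.ringHom_apply, MvPolynomial.coe_X,
      MvPolynomial.coe_one] at h
    rw [h, MvPolynomial.coe_one]
    exact X_sub_one_mul_inv i⟩

lemma hasExpansion_embed (f : MvPolynomial (Fin 2) ℝ) : HasExpansion (embed f) (expand f) := by
  induction f using MvPolynomial.induction_on with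
  | C r =>
    refine ⟨MvPolynomial.C r, 1, by simp, ?_, ?_⟩
    · rw [algebraMap_eq_aeval]
      simp [embed]
    · simp [expand]
      rfl
  | add f g hf hg => rw [embed_add, map_add]; exact hf.add hg
  | mul_X f i hf =>
    rw [embed_mul, map_mul]
    refine hf.mul ?_
    fin_cases i
    · simpa [embed, expand, xx, yy] using hasExpansion_inv 0
    · simpa [embed, expand, xx, yy] using hasExpansion_inv 1

/-- The exponent of the monomial `x^i y^j`. -/
def expo (i j : ℕ) : Fin 2 →₀ ℕ := Finsupp.single 0 i + Finsupp.single 1 j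

lemma expo_zero (i j : ℕ) : expo i j 0 = i := by simp [expo]

lemma expo_one (i j : ℕ) : expo i j 1 = j := by simp [expo]

lemma expo_eta (d : Fin 2 →₀ ℕ) : expo (d 0) (d 1) = d := by
  ext i
  fin_cases i
  · exact expo_zero _ _
  · exact expo_one _ _

lemma expo_le {i j i' j' : ℕ} : expo i j ≤ expo i' j' ↔ i ≤ i' ∧ j ≤ j' := by
  rw [Finsupp.le_def, Fin.forall_fin_two, expo_zero, expo_zero, expo_one, expo_one]

lemma expo_sub (i j i' j' : ℕ) : expo i j - expo i' j' = expo (i - i') (j - j') := by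
  ext l
  fin_cases l
  · simp [expo]
  · simp [expo]

/-- The coefficients of a power series in two variables. -/
def coeffs (s : MvPowerSeries (Fin 2) ℝ) (i j : ℕ) : ℝ := MvPowerSeries.coeff (expo i j) s

lemma HasExpansion.isGeneratingFunction {H : RatXY} {s : MvPowerSeries (Fin 2) ℝ}
    (h : HasExpansion H s) : IsGeneratingFunction H (coeffs s) := by
  obtain ⟨P, Q, hQ, e1, e2⟩ := h
  refine ⟨P, Q, hQ, e1, ?_⟩
  convert e2 using 2
  ext d
  change MvPowerSeries.coeff (expo (d 0) (d 1)) s = _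
  rw [expo_eta]

lemma coeffs_monomial_mul (r : ℝ) (a b : ℕ) (s : MvPowerSeries (Fin 2) ℝ) (i j : ℕ) :
    coeffs (MvPowerSeries.C r * MvPowerSeries.X 0 ^ a * MvPowerSeries.X 1 ^ b * s) i j =
      r * if a ≤ i ∧ b ≤ j then coeffs s (i - a) (j - b) else 0 := by
  have h : (MvPowerSeries.C r * MvPowerSeries.X 0 ^ a * MvPowerSeries.X 1 ^ b :
      MvPowerSeries (Fin 2) ℝ) = MvPowerSeries.monomial (expo a b) r := by
    rw [MvPowerSeries.X_pow_eq, MvPowerSeries.X_pow_eq, ← MvPowerSeries.monomial_zero_eq_C_apply,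
      MvPowerSeries.monomial_mul_monomial, MvPowerSeries.monomial_mul_monomial, zero_add, mul_one,
      mul_one, expo]
  rw [h, coeffs, MvPowerSeries.coeff_monomial_mul, expo_sub]
  simp only [expo_le, mul_ite, mul_zero]
  rfl

lemma coeffs_X_mul_X_mul (s : MvPowerSeries (Fin 2) ℝ) (i j : ℕ) :
    coeffs (MvPowerSeries.X 0 * MvPowerSeries.X 1 * s) (i + 1) (j + 1) = coeffs s i j := by
  have h := coeffs_monomial_mul 1 1 1 s (i + 1) (j + 1)
  simpa using h

/-- The power series without monomials divisible by the variable `j`. -/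
def without (j : Fin 2) : Subalgebra ℝ (MvPowerSeries (Fin 2) ℝ) where
  carrier := {s | ∀ d : Fin 2 →₀ ℕ, d j ≠ 0 → MvPowerSeries.coeff d s = 0}
  add_mem' := by
    intro s t hs ht d hd
    rw [map_add, hs d hd, ht d hd, add_zero]
  mul_mem' := by
    classical
    intro s t hs ht d hd
    rw [MvPowerSeries.coeff_mul]
    refine Finset.sum_eq_zero fun p hp => ?_
    rw [Finset.HasAntidiagonal.mem_antidiagonal] at hp
    by_cases h : p.1 j = 0
    · have h2 : p.2 j ≠ 0 := by
        rw [← hp, Finsupp.add_apply, h, zero_add] at hd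
        exact hd
      rw [ht _ h2, mul_zero]
    · rw [hs _ h, zero_mul]
  algebraMap_mem' := by
    classical
    intro r d hd
    rw [MvPowerSeries.algebraMap_apply, MvPowerSeries.coeff_C, if_neg]
    rintro rfl
    simp at hd

/-- The geometric series of one variable does not involve the other one. -/
lemma inv_mem_without {i j : Fin 2} (hij : i ≠ j) :
    ((MvPowerSeries.X i - 1)⁻¹ : MvPowerSeries (Fin 2) ℝ) ∈ without j := by
  classical
  set u : MvPowerSeries (Fin 2) ℝ := (MvPowerSeries.X i - 1)⁻¹ with hu
  have h : u = MvPowerSeries.X i * u - 1 := by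
    have h1 := X_sub_one_mul_inv i
    rw [← hu] at h1
    linear_combination -h1
  have key : ∀ (n : ℕ) (d : Fin 2 →₀ ℕ), d i = n → d j ≠ 0 → MvPowerSeries.coeff d u = 0 := by
    intro n
    induction n with
    | zero =>
      intro d hd hj
      have hd0 : d ≠ 0 := by rintro rfl; simp at hj
      rw [h, map_sub, MvPowerSeries.coeff_one, if_neg hd0, MvPowerSeries.X,
        MvPowerSeries.coeff_monomial_mul, if_neg, sub_zero]
      intro hle
      have := hle i
      simp [hd] at this
    | succ n ih =>
      intro d hd hj
      have hd0 : d ≠ 0 := by rintro rfl; simp at hj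
      rw [h, map_sub, MvPowerSeries.coeff_one, if_neg hd0, MvPowerSeries.X,
        MvPowerSeries.coeff_monomial_mul, sub_zero]
      split_ifs
      · rw [ih, mul_zero]
        · simp [hd]
        · simpa [Finsupp.single_apply, hij] using hj
      · rfl
  exact fun d hd => key _ d rfl hd

lemma coeffs_expand_aeval_X_zero (f : ℝ[X]) (i j : ℕ) :
    coeffs (expand (aeval (MvPolynomial.X 0) f)) i (j + 1) = 0 := by
  have h : expand (aeval (MvPolynomial.X 0) f) ∈ without 1 := by
    rw [expand, mvAeval_aeval_X_zero]
    exact Algebra.adjoin_le (Set.singleton_subset_iff.mpr (inv_mem_without (by decide)))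
      (aeval_mem_adjoin_singleton ℝ _)
  exact h _ (by rw [expo_one]; exact Nat.succ_ne_zero _)

lemma coeffs_expand_aeval_X_one (f : ℝ[X]) (i j : ℕ) :
    coeffs (expand (aeval (MvPolynomial.X 1) f)) (i + 1) j = 0 := by
  have h : expand (aeval (MvPolynomial.X 1) f) ∈ without 0 := by
    rw [expand, mvAeval_aeval_X_one]
    exact Algebra.adjoin_le (Set.singleton_subset_iff.mpr (inv_mem_without (by decide)))
      (aeval_mem_adjoin_singleton ℝ _)
  exact h _ (by rw [expo_zero]; exact Nat.succ_ne_zero _)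

namespace StepModel

variable (S : StepModel)

/-- Multiplication by the kernel is the discrete Laplacian on coefficients. -/
lemma coeffs_kernel_mul (s : MvPowerSeries (Fin 2) ℝ) (i j : ℕ) :
    coeffs (MvPolynomial.aeval ![MvPowerSeries.X 0, MvPowerSeries.X 1] S.kernel * s)
      (i + 1) (j + 1) = S.laplacian (coeffs s) i j := by
  have h : MvPolynomial.aeval ![(MvPowerSeries.X 0 : MvPowerSeries (Fin 2) ℝ), MvPowerSeries.X 1]
      S.kernel * s = (∑ u ∈ Finset.Icc (-1 : ℤ) 1, ∑ v ∈ Finset.Icc (-1 : ℤ) 1,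
        MvPowerSeries.C (S.p u v) * MvPowerSeries.X 0 ^ (1 - u).toNat *
          MvPowerSeries.X 1 ^ (1 - v).toNat * s) - MvPowerSeries.X 0 * MvPowerSeries.X 1 * s := by
    simp only [kernel, map_sub, map_sum, map_mul, map_pow, MvPolynomial.aeval_C,
      MvPolynomial.aeval_X, sub_mul, Finset.sum_mul, Matrix.cons_val_zero, Matrix.cons_val_one]
    rfl
  have hc : ∀ s t : MvPowerSeries (Fin 2) ℝ, coeffs (s - t) (i + 1) (j + 1) =
      coeffs s (i + 1) (j + 1) - coeffs t (i + 1) (j + 1) := fun s t => map_sub _ _ _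
  rw [h, hc, coeffs_X_mul_X_mul, laplacian, coeffs, map_sum]
  congr 1
  refine Finset.sum_congr rfl fun u hu => ?_
  rw [map_sum]
  refine Finset.sum_congr rfl fun v hv => ?_
  rw [Finset.mem_Icc] at hu hv
  refine (coeffs_monomial_mul _ _ _ _ _ _).trans ?_
  congr 1
  have h1 : i + 1 - (1 - u).toNat = ((i : ℤ) + u).toNat := by omega
  have h2 : j + 1 - (1 - v).toNat = ((j : ℤ) + v).toNat := by omega
  have h3 : ((1 - u).toNat ≤ i + 1 ∧ (1 - v).toNat ≤ j + 1) ↔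
      (0 ≤ (i : ℤ) + u ∧ 0 ≤ (j : ℤ) + v) := by omega
  rw [h1, h2]
  simp only [h3]

/-- The relation `K u² w² = E(u, w)`, with `E` the equation of the ellipse, in any algebra in which
`x - 1` and `y - 1` have the inverses `u` and `w`. -/
lemma aeval_kernel_mul {R : Type} [CommRing R] [Algebra ℝ R] {x y u w : R} (hu : (x - 1) * u = 1)
    (hw : (y - 1) * w = 1) : MvPolynomial.aeval ![x, y] S.kernel * (u ^ 2 * w ^ 2) =
      MvPolynomial.aeval ![u, w] S.ellipse.poly := by
  have h : MvPolynomial.aeval ![x, y] S.kernel * (u ^ 2 * w ^ 2) =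
      algebraMap ℝ R S.ellipse.γ * (u ^ 2 * ((y - 1) * w) ^ 2) +
      algebraMap ℝ R S.ellipse.β * (u * w * (((x - 1) * u) * ((y - 1) * w))) +
      algebraMap ℝ R S.ellipse.α * (((x - 1) * u) ^ 2 * w ^ 2) +
      algebraMap ℝ R S.ellipse.ε * (((x - 1) * u) * u * ((y - 1) * w) ^ 2) +
      algebraMap ℝ R S.ellipse.δ * (((x - 1) * u) ^ 2 * (((y - 1) * w) * w)) +
      algebraMap ℝ R S.ellipse.ζ * (((x - 1) * u) ^ 2 * ((y - 1) * w) ^ 2) := by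
    rw [aeval_kernel]
    ring
  rw [h, hu, hw, Ellipse.aeval_poly]
  ring

lemma K_mul_embed (R : MvPolynomial (Fin 2) ℝ) :
    S.K * embed (MvPolynomial.X 0 ^ 2 * MvPolynomial.X 1 ^ 2 * R) = embed (S.ellipse.poly * R) := by
  have h := S.aeval_kernel_mul (mul_inv_cancel₀ (sub_ne_zero.mpr xx_ne_one))
    (mul_inv_cancel₀ (sub_ne_zero.mpr yy_ne_one))
  rw [K_eq_aeval, embed_mul, embed_mul, ← mul_assoc, embed_mul S.ellipse.poly]
  congr 1
  rw [embed, embed, embed, ← h]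
  simp

lemma kernel_mul_expand (R : MvPolynomial (Fin 2) ℝ) :
    MvPolynomial.aeval ![MvPowerSeries.X 0, MvPowerSeries.X 1] S.kernel *
      expand (MvPolynomial.X 0 ^ 2 * MvPolynomial.X 1 ^ 2 * R) =
        expand (S.ellipse.poly * R) := by
  have h := S.aeval_kernel_mul (X_sub_one_mul_inv 0) (X_sub_one_mul_inv 1)
  rw [map_mul, map_mul expand S.ellipse.poly, ← mul_assoc]
  congr 1
  rw [expand, ← h]
  simp

end StepModel

/-- The function `x y H` for `H = u² w² R`, as a polynomial in `u` and `w`. -/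
def timesXY (R : MvPolynomial (Fin 2) ℝ) : MvPolynomial (Fin 2) ℝ :=
  (MvPolynomial.X 0 + 1) * (MvPolynomial.X 1 + 1) * MvPolynomial.X 0 * MvPolynomial.X 1 * R

lemma mul_aeval_eq_aeval_timesXY {A : Type} [CommRing A] [Algebra ℝ A] {x y u w : A}
    (hu : (x - 1) * u = 1) (hw : (y - 1) * w = 1) (R : MvPolynomial (Fin 2) ℝ) :
    x * y * MvPolynomial.aeval ![u, w] (MvPolynomial.X 0 ^ 2 * MvPolynomial.X 1 ^ 2 * R) =
      MvPolynomial.aeval ![u, w] (timesXY R) := by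
  have h1 : x * u = u + 1 := by linear_combination hu
  have h2 : y * w = w + 1 := by linear_combination hw
  simp only [timesXY, map_mul, map_add, map_pow, map_one, MvPolynomial.aeval_X,
    Matrix.cons_val_zero, Matrix.cons_val_one]
  rw [← h1, ← h2]
  ring

lemma xy_mul_embed (R : MvPolynomial (Fin 2) ℝ) :
    xx * yy * embed (MvPolynomial.X 0 ^ 2 * MvPolynomial.X 1 ^ 2 * R) = embed (timesXY R) :=
  mul_aeval_eq_aeval_timesXY (mul_inv_cancel₀ (sub_ne_zero.mpr xx_ne_one))
    (mul_inv_cancel₀ (sub_ne_zero.mpr yy_ne_one)) R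

lemma xy_mul_expand (R : MvPolynomial (Fin 2) ℝ) :
    MvPowerSeries.X 0 * MvPowerSeries.X 1 *
      expand (MvPolynomial.X 0 ^ 2 * MvPolynomial.X 1 ^ 2 * R) = expand (timesXY R) :=
  mul_aeval_eq_aeval_timesXY (X_sub_one_mul_inv 0) (X_sub_one_mul_inv 1) R

lemma totalDegree_timesXY_le {R : MvPolynomial (Fin 2) ℝ} {d : ℕ}
    (h : R = 0 ∨ R.totalDegree + 2 ≤ d) : (timesXY R).totalDegree ≤ d + 2 := by
  rcases h with rfl | h
  · simp [timesXY]
  have h1 : ∀ i : Fin 2, (MvPolynomial.X i + 1 : MvPolynomial (Fin 2) ℝ).totalDegree ≤ 1 := fun i =>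
    (MvPolynomial.totalDegree_add _ _).trans
      (max_le (MvPolynomial.totalDegree_X _).le (by simp))
  have h2 : ∀ i : Fin 2, (MvPolynomial.X i : MvPolynomial (Fin 2) ℝ).totalDegree ≤ 1 := fun i =>
    (MvPolynomial.totalDegree_X _).le
  have e1 := MvPolynomial.totalDegree_mul (MvPolynomial.X 0 + 1 : MvPolynomial (Fin 2) ℝ)
    (MvPolynomial.X 1 + 1)
  have e2 := MvPolynomial.totalDegree_mul ((MvPolynomial.X 0 + 1) * (MvPolynomial.X 1 + 1) :
    MvPolynomial (Fin 2) ℝ) (MvPolynomial.X 0)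
  have e3 := MvPolynomial.totalDegree_mul ((MvPolynomial.X 0 + 1) * (MvPolynomial.X 1 + 1) *
    MvPolynomial.X 0 : MvPolynomial (Fin 2) ℝ) (MvPolynomial.X 1)
  have e4 := MvPolynomial.totalDegree_mul ((MvPolynomial.X 0 + 1) * (MvPolynomial.X 1 + 1) *
    MvPolynomial.X 0 * MvPolynomial.X 1 : MvPolynomial (Fin 2) ℝ) R
  have := h1 0
  have := h1 1
  have := h2 0
  have := h2 1
  rw [timesXY]
  omega

/-! ### The inductive construction -/

lemma subst_inU_xx (f : ℝ[X]) : subst (inU f) xx = embed (aeval (MvPolynomial.X 0) f) := by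
  rw [subst_inU xx_ne_one, embed, mvAeval_aeval_X_zero]

lemma subst_inU_yy (f : ℝ[X]) : subst (inU f) yy = embed (aeval (MvPolynomial.X 1) f) := by
  rw [subst_inU yy_ne_one, embed, mvAeval_aeval_X_one]

lemma natDegree_basisPoly_le (d : ℝ) (k : ℕ) : (basisPoly d k).natDegree ≤ k := by
  have h : (basisPoly d k).natDegree ≤ (k + 1) / 2 * 1 + k / 2 * 1 := by
    refine natDegree_mul_le.trans (add_le_add ?_ ?_)
    · exact natDegree_pow_le_of_le _ natDegree_X_le
    · exact natDegree_pow_le_of_le _ (natDegree_X_sub_C_le d)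
  omega

namespace StepModel

variable {S : StepModel}

/-- The rational function `u² w² R(u, w)`, where `u = 1/(x-1)` and `w = 1/(y-1)`. -/
def form (R : MvPolynomial (Fin 2) ℝ) : RatXY :=
  embed (MvPolynomial.X 0 ^ 2 * MvPolynomial.X 1 ^ 2 * R)

lemma IsDecouplingFormula.unique {M : RatXY} {F F' : RatFunc ℝ} (h : S.IsDecouplingFormula M F)
    (h' : S.IsDecouplingFormula M F') : F = F' := by
  obtain ⟨vp, vm, hv, e⟩ := h
  obtain ⟨vp', vm', hv', e'⟩ := h'
  apply (algebraMap (RatFunc ℝ) AlgFun).injective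
  rw [e, e']
  congr 1
  refine Finset.sum_congr rfl fun i hi => ?_
  rw [(hv i hi).1.unique (hv' i hi).1, (hv i hi).2.unique (hv' i hi).2]

variable (S) in
/-- `G` is the bracket `X_+ y H(X_+, y) - F(X_+)`. -/
def IsBracket (H : RatXY) (F G : RatFunc ℝ) : Prop :=
  ∃ w : AlgFun, HasValueAt H S.Xplus tt w ∧
    algebraMap (RatFunc ℝ) AlgFun G = S.Xplus * tt * w - subst F S.Xplus

lemma IsBracket.unique {H : RatXY} {F G G' : RatFunc ℝ} (h : S.IsBracket H F G)
    (h' : S.IsBracket H F G') : G = G' := by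
  obtain ⟨w, hw, e⟩ := h
  obtain ⟨w', hw', e'⟩ := h'
  apply (algebraMap (RatFunc ℝ) AlgFun).injective
  rw [e, e', hw.unique hw']

lemma Restricts.value_Yplus {M : RatXY} {g : MvPolynomial (Fin 2) ℝ} (h : S.Restricts M g) :
    HasValueAt M tt S.Yplus (MvPolynomial.aeval ![(tt - 1)⁻¹, (S.Yplus - 1)⁻¹] g) := by
  simpa using h _ _ genericPt_Yplus

lemma Restricts.value_Yminus {M : RatXY} {g : MvPolynomial (Fin 2) ℝ} (h : S.Restricts M g) :
    HasValueAt M tt S.Yminus (MvPolynomial.aeval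
      ![(tt - 1)⁻¹, S.ellipse.reflW (tt - 1)⁻¹ (S.Yplus - 1)⁻¹] g) := by
  rw [Yminus_eq]
  simpa using h _ _ genericPt_Yplus.reflW

lemma Restricts.value_Xplus {M : RatXY} {g : MvPolynomial (Fin 2) ℝ} (h : S.Restricts M g) :
    HasValueAt M S.Xplus tt (MvPolynomial.aeval ![(S.Xplus - 1)⁻¹, (tt - 1)⁻¹] g) := by
  simpa using h _ _ genericPt_Xplus

/-- One step of the construction: the decoupling function `F(x)` and the bracket `G(y)` of
`M = x y u² w² R(u, w)` are polynomials in `u` and in `w`, and `M - F - G` is the equation of the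
ellipse times a polynomial whose degree exceeds that of `R` by at most `2`. -/
lemma exists_step (hfin : Finite S.group) {R : MvPolynomial (Fin 2) ℝ} {d : ℕ}
    (hd : R = 0 ∨ R.totalDegree + 2 ≤ d) (horb : S.orbitSum (xx * yy * form R) = 0) :
    ∃ (F G : ℝ[X]) (R' : MvPolynomial (Fin 2) ℝ),
      S.IsDecouplingFormula (xx * yy * form R) (inU F) ∧ S.IsBracket (form R) (inU F) (inU G) ∧
      timesXY R = aeval (MvPolynomial.X 0) F + aeval (MvPolynomial.X 1) G + S.ellipse.poly * R' ∧
      (R' = 0 ∨ R'.totalDegree + 2 ≤ d + 2) := by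
  have hdeg := totalDegree_timesXY_le hd
  rw [form, xy_mul_embed, orbitSum_eq' hfin, sub_eq_zero] at horb
  have hN := orderOf_Theta_pos hfin
  have hres := restricts_embed (S := S) (timesXY R)
  obtain ⟨F, G, hF, hG, hFval, hdec⟩ := S.ellipse.exists_decoupling hdeg hN
    (fun U W h => by
      have h1 := hres.theta_pow (orderOf S.Theta)
      rw [pow_orderOf_eq_one] at h1
      exact Restricts.unique h1 hres h)
    (fun U W h => by
      have h1 := HasValueAt.sum (Finset.range (orderOf S.Theta))
        fun i _ => hres.theta_pow i U W h
      have h2 := HasValueAt.sum (Finset.range (orderOf S.Theta))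
        fun i _ => (hres.theta_pow i).psi U W h
      rw [← horb] at h2
      exact h1.unique h2)
  obtain ⟨R', hR', hdeg'⟩ := Ellipse.exists_eq_poly_mul (C := S.ellipse) (d := d + 2)
    (f := timesXY R - (aeval (MvPolynomial.X 0) F + aeval (MvPolynomial.X 1) G))
    ((MvPolynomial.totalDegree_sub _ _).trans (max_le hdeg
      ((MvPolynomial.totalDegree_add _ _).trans (max_le ((totalDegree_aeval_X_le _ _).trans hF)
        ((totalDegree_aeval_X_le _ _).trans hG)))))
    ⟨_, _, genericPt_Yplus⟩
    (fun U W h => by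
      rw [map_sub, map_add, mvAeval_aeval_X_zero, mvAeval_aeval_X_one, hdec U W h, sub_self])
  refine ⟨F, G, R', ?_, ?_, ?_, hdeg'⟩
  · rw [form, xy_mul_embed]
    refine ⟨fun i => MvPolynomial.aeval ![(tt - 1)⁻¹, (S.Yplus - 1)⁻¹]
        (S.ellipse.theta^[i] (timesXY R)),
      fun i => MvPolynomial.aeval ![(tt - 1)⁻¹, S.ellipse.reflW (tt - 1)⁻¹ (S.Yplus - 1)⁻¹]
        (S.ellipse.theta^[i] (timesXY R)),
      fun i _ => ⟨(hres.theta_pow i).value_Yplus, (hres.theta_pow i).value_Yminus⟩, ?_⟩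
    rw [algebraMap_inU, card_group_div_two hfin]
    exact hFval _ _ genericPt_Yplus
  · refine ⟨_, (restricts_embed _).value_Xplus, ?_⟩
    have h := hdec _ _ (genericPt_Xplus (S := S))
    rw [mul_aeval_eq_aeval_timesXY (mul_inv_cancel₀ (sub_ne_zero.mpr Xplus_ne_one))
      (mul_inv_cancel₀ (sub_ne_zero.mpr tt_ne_one)), algebraMap_inU, subst_inU Xplus_ne_one, h]
    ring
  · linear_combination hR'

/-- The identity `x y H_n - F_n(x) - G_n(y) = K H_{n+1}`, obtained from the identity of polynomials
in `u` and `w`. -/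
lemma step_form {R R' : MvPolynomial (Fin 2) ℝ} {F G : ℝ[X]}
    (h : timesXY R = aeval (MvPolynomial.X 0) F + aeval (MvPolynomial.X 1) G +
      S.ellipse.poly * R') :
    xx * yy * form R - subst (inU F) xx - subst (inU G) yy = S.K * form R' := by
  rw [form, form, xy_mul_embed, h, K_mul_embed, subst_inU_xx, subst_inU_yy, embed_add, embed_add]
  ring

lemma Psi_subst_inU (F : ℝ[X]) : S.Psi (subst (inU F) xx) = subst (inU F) xx := by
  rw [subst_inU xx_ne_one]
  have h := aeval_algHom_apply (S.Psi : RatXY →ₐ[ℝ] RatXY) ((xx - 1)⁻¹) F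
  have h2 : (S.Psi : RatXY →ₐ[ℝ] RatXY) ((xx - 1)⁻¹) = (xx - 1)⁻¹ := by
    simp [Psi_xx]
  rw [h2] at h
  exact h.symm

lemma Phi_subst_inU (F : ℝ[X]) : S.Phi (subst (inU F) yy) = subst (inU F) yy := by
  rw [subst_inU yy_ne_one]
  have h := aeval_algHom_apply (S.Phi : RatXY →ₐ[ℝ] RatXY) ((yy - 1)⁻¹) F
  have h2 : (S.Phi : RatXY →ₐ[ℝ] RatXY) ((yy - 1)⁻¹) = (yy - 1)⁻¹ := by
    simp [Phi_yy]
  rw [h2] at h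
  exact h.symm

/-- `x y / K` is invariant under the group, and the signed orbit sums of functions of `x` and of
functions of `y` vanish. -/
lemma orbitSum_form (hfin : Finite S.group) {M H : RatXY} {F G : ℝ[X]} (hM : S.orbitSum M = 0)
    (h : M - subst (inU F) xx - subst (inU G) yy = S.K * H) : S.orbitSum (xx * yy * H) = 0 := by
  have hK := S.K_ne_zero
  have e : xx * yy * H = xx * yy / S.K * (M - subst (inU F) xx - subst (inU G) yy) := by
    rw [h]
    field_simp
  rw [e, orbitSum_mul hfin Phi_xy_div_K Psi_xy_div_K, orbitSum_sub hfin, orbitSum_sub hfin, hM,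
    orbitSum_of_Psi_eq hfin (Psi_subst_inU F), orbitSum_of_Phi_eq hfin (Phi_subst_inU G)]
  ring

lemma orbitSum_zero (hfin : Finite S.group) : S.orbitSum 0 = 0 :=
  orbitSum_of_Psi_eq hfin (map_zero _)

lemma exists_form_eq_div {R : MvPolynomial (Fin 2) ℝ} {d : ℕ}
    (hd : R = 0 ∨ R.totalDegree + 2 ≤ d) : ∃ P : MvPolynomial (Fin 2) ℝ,
      form R = algebraMap (MvPolynomial (Fin 2) ℝ) RatXY P / ((1 - xx) ^ d * (1 - yy) ^ d) := by
  rcases hd with rfl | hd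
  · exact ⟨0, by simp [form, embed]⟩
  obtain ⟨e, rfl⟩ := Nat.exists_eq_add_of_le' ((Nat.le_add_left _ _).trans hd)
  obtain ⟨P, hP⟩ := exists_embed_eq_div (f := R) (e := e) (by omega)
  have hx := one_sub_xx_ne_zero
  have hy := one_sub_yy_ne_zero
  refine ⟨P, ?_⟩
  have e1 : embed (MvPolynomial.X 0 ^ 2 * MvPolynomial.X 1 ^ 2) =
      1 / ((1 - xx) ^ 2 * (1 - yy) ^ 2) := by
    simp only [embed, map_mul, map_pow, MvPolynomial.aeval_X, Matrix.cons_val_zero,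
      Matrix.cons_val_one]
    rw [← neg_sub, inv_neg, neg_sq, ← neg_sub 1 yy, inv_neg, neg_sq]
    field_simp
  rw [form, embed_mul, hP, e1, div_mul_div_comm, one_mul]
  ring

/-- The lines `x = 1` and `y = 1` are not components of the kernel curve. -/
lemma kernel_not_dvd (d : ℕ) : ¬ S.kernel ∣
    ((1 - MvPolynomial.X 0) ^ d * (1 - MvPolynomial.X 1) ^ d : MvPolynomial (Fin 2) ℝ) := by
  rintro ⟨Q, hQ⟩
  have h := congrArg (MvPolynomial.aeval ![tt, S.Yplus]) hQ
  rw [map_mul, map_mul, kernel_Yplus, zero_mul] at h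
  simp only [map_pow, map_sub, map_one, MvPolynomial.aeval_X, Matrix.cons_val_zero,
    Matrix.cons_val_one] at h
  exact mul_ne_zero (pow_ne_zero _ (sub_ne_zero.mpr tt_ne_one.symm))
    (pow_ne_zero _ (sub_ne_zero.mpr Yplus_ne_one.symm)) h

lemma isDecoupling_of_step {R R' : MvPolynomial (Fin 2) ℝ} {F G : ℝ[X]}
    (h : timesXY R = aeval (MvPolynomial.X 0) F + aeval (MvPolynomial.X 1) G +
      S.ellipse.poly * R') : S.IsDecoupling (xx * yy * form R) (inU F) := by
  obtain ⟨P, hP⟩ := exists_form_eq_div (R := R') (d := R'.totalDegree + 2) (Or.inr le_rfl)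
  refine ⟨inU G, -P, _, kernel_not_dvd (R'.totalDegree + 2), ?_⟩
  have e := step_form h
  have e2 : algebraMap (MvPolynomial (Fin 2) ℝ) RatXY ((1 - MvPolynomial.X 0) ^
      (R'.totalDegree + 2) * (1 - MvPolynomial.X 1) ^ (R'.totalDegree + 2)) =
      (1 - xx) ^ (R'.totalDegree + 2) * (1 - yy) ^ (R'.totalDegree + 2) := by
    simp [xx, yy]
  rw [e2, map_neg, neg_div, ← hP]
  linear_combination -e

/-- The Laplacian of the coefficients of `H_{n+1}` are the coefficients of `H_n`. -/
lemma laplacian_of_step {R R' : MvPolynomial (Fin 2) ℝ} {F G : ℝ[X]}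
    (h : timesXY R = aeval (MvPolynomial.X 0) F + aeval (MvPolynomial.X 1) G +
      S.ellipse.poly * R') :
    S.laplacian (coeffs (expand (MvPolynomial.X 0 ^ 2 * MvPolynomial.X 1 ^ 2 * R'))) =
      coeffs (expand (MvPolynomial.X 0 ^ 2 * MvPolynomial.X 1 ^ 2 * R)) := by
  funext i j
  have h1 : S.ellipse.poly * R' = timesXY R - aeval (MvPolynomial.X 0) F -
      aeval (MvPolynomial.X 1) G := by linear_combination -h
  rw [← coeffs_kernel_mul, kernel_mul_expand, h1, map_sub, map_sub, ← xy_mul_expand]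
  have hc : ∀ s t : MvPowerSeries (Fin 2) ℝ, coeffs (s - t) (i + 1) (j + 1) =
      coeffs s (i + 1) (j + 1) - coeffs t (i + 1) (j + 1) := fun s t => map_sub _ _ _
  rw [hc, hc, coeffs_X_mul_X_mul, coeffs_expand_aeval_X_zero, coeffs_expand_aeval_X_one, sub_zero,
    sub_zero]

lemma form_zero : form 0 = 0 := by simp [form, embed]

/-- Harmonic functions from a pair `f(u)`, `g(w)` of functions that agree on the curve. -/
lemma exists_harmonic (hfin : Finite S.group) {f g : ℝ[X]} {d : ℕ} (hf : f.natDegree ≤ d)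
    (hg : g.natDegree ≤ d)
    (hfg : ∀ U W, S.ellipse.GenericPt U W → aeval U f = aeval W g) :
    ∃ R, (subst (inU f) xx - subst (inU g) yy) / S.K = form R ∧
      (R = 0 ∨ R.totalDegree + 2 ≤ d) ∧ S.orbitSum (xx * yy * form R) = 0 ∧
      S.laplacian (coeffs (expand (MvPolynomial.X 0 ^ 2 * MvPolynomial.X 1 ^ 2 * R))) = 0 := by
  obtain ⟨R, hR, hdeg⟩ := Ellipse.exists_eq_poly_mul (C := S.ellipse) (d := d)
    (f := aeval (MvPolynomial.X 0) f - aeval (MvPolynomial.X 1) g)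
    ((MvPolynomial.totalDegree_sub _ _).trans (max_le ((totalDegree_aeval_X_le _ _).trans hf)
      ((totalDegree_aeval_X_le _ _).trans hg)))
    ⟨_, _, genericPt_Yplus⟩
    (fun U W h => by
      rw [map_sub, mvAeval_aeval_X_zero, mvAeval_aeval_X_one, hfg U W h, sub_self])
  -- The harmonic function is a successor of the function `0`.
  have hstep : timesXY 0 = aeval (MvPolynomial.X 0) (-f) + aeval (MvPolynomial.X 1) g +
      S.ellipse.poly * R := by
    rw [← hR, map_neg, timesXY, mul_zero]
    ring
  have e := step_form hstep
  refine ⟨R, ?_, hdeg, ?_, ?_⟩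
  · rw [div_eq_iff S.K_ne_zero, mul_comm, ← e, form_zero, subst_inU xx_ne_one,
      subst_inU xx_ne_one, map_neg]
    ring
  · rw [form_zero, mul_zero] at e
    exact orbitSum_form hfin (orbitSum_zero hfin) e
  · rw [laplacian_of_step hstep]
    funext i j
    simp [coeffs]

end StepModel

/-- A polynomial of degree `m` in `1/(x-1)` has a pole of order exactly `m` at `x = 1`. -/
lemma inU_eq_div_one_sub_pow {f : ℝ[X]} (hf : f ≠ 0) : ∃ g : ℝ[X], g.eval 1 ≠ 0 ∧
    inU f = algebraMap ℝ[X] (RatFunc ℝ) g / (1 - RatFunc.X) ^ f.natDegree := by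
  refine ⟨C ((-1) ^ f.natDegree) * f.reverse.comp (X - 1), ?_, ?_⟩
  · rw [eval_mul, eval_C, eval_comp]
    simp only [eval_sub, eval_X, eval_one, sub_self]
    rw [← coeff_zero_eq_eval_zero, coeff_zero_reverse]
    exact mul_ne_zero (pow_ne_zero _ (by norm_num)) (leadingCoeff_ne_zero.mpr hf)
  · have h : (RatFunc.X - 1 : RatFunc ℝ) ≠ 0 := sub_ne_zero.mpr ratFuncX_ne_one
    rw [inU_eq, ← neg_sub RatFunc.X 1, neg_pow (RatFunc.X - 1 : RatFunc ℝ)]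
    simp only [map_mul, map_pow, map_neg, map_one, map_sub, RatFunc.algebraMap_X]
    field_simp

namespace StepModel

variable {S : StepModel}

/-- Iterating the step of the construction from `u² w² R₀` gives a sequence `u² w² R_n`, each member
of which is the Laplacian of the next; the degree of `R_n` grows by at most `2` at each step. -/
lemma exists_tower (hfin : Finite S.group) {R₀ : MvPolynomial (Fin 2) ℝ} {d : ℕ}
    (hd : R₀ = 0 ∨ R₀.totalDegree + 2 ≤ d) (horb : S.orbitSum (xx * yy * form R₀) = 0) :
    ∃ (R : ℕ → MvPolynomial (Fin 2) ℝ) (F G : ℕ → ℝ[X]), R 0 = R₀ ∧ ∀ n,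
      (R n = 0 ∨ (R n).totalDegree + 2 ≤ d + 2 * n) ∧
      S.orbitSum (xx * yy * form (R n)) = 0 ∧
      S.IsDecouplingFormula (xx * yy * form (R n)) (inU (F n)) ∧
      S.IsBracket (form (R n)) (inU (F n)) (inU (G n)) ∧
      timesXY (R n) = aeval (MvPolynomial.X 0) (F n) + aeval (MvPolynomial.X 1) (G n) +
        S.ellipse.poly * R (n + 1) := by
  have step : ∀ (n : ℕ) (r : {R : MvPolynomial (Fin 2) ℝ //
      (R = 0 ∨ R.totalDegree + 2 ≤ d + 2 * n) ∧ S.orbitSum (xx * yy * form R) = 0}),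
      ∃ (r' : {R : MvPolynomial (Fin 2) ℝ // (R = 0 ∨ R.totalDegree + 2 ≤ d + 2 * (n + 1)) ∧
        S.orbitSum (xx * yy * form R) = 0}) (F G : ℝ[X]),
      S.IsDecouplingFormula (xx * yy * form r.1) (inU F) ∧
      S.IsBracket (form r.1) (inU F) (inU G) ∧
      timesXY r.1 = aeval (MvPolynomial.X 0) F + aeval (MvPolynomial.X 1) G +
        S.ellipse.poly * r'.1 := by
    rintro n ⟨R, h1, h2⟩
    obtain ⟨F, G, R', hF, hG, hR, hdeg⟩ := exists_step hfin h1 h2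
    exact ⟨⟨R', hdeg, orbitSum_form hfin h2 (step_form hR)⟩, F, G, hF, hG, hR⟩
  choose r F G hF hG hR using step
  let R : ∀ n, {R : MvPolynomial (Fin 2) ℝ //
      (R = 0 ∨ R.totalDegree + 2 ≤ d + 2 * n) ∧ S.orbitSum (xx * yy * form R) = 0} :=
    fun n => Nat.rec ⟨R₀, hd, horb⟩ (fun n s => r n s) n
  exact ⟨fun n => (R n).1, fun n => F n (R n), fun n => G n (R n), rfl, fun n =>
    ⟨(R n).2.1, (R n).2.2, hF n (R n), hG n (R n), hR n (R n)⟩⟩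

lemma subst_inU_comp (P f : ℝ[X]) {z : RatXY} (hz : z ≠ 1) :
    aeval (subst (inU f) z) P = subst (inU (P.comp f)) z := by
  rw [subst_inU hz, subst_inU hz, aeval_comp]

/-- If `ω = f(u)` agrees with `g(w)` on the curve, the family of polyharmonic functions exists, and
`H_n^k = u² w² R_{n-1,k}(u, w)` with polynomials `R_{n,k}` of degree at most `k m + 2 n - 2`. -/
theorem exists_family (hfin : Finite S.group) {f g : ℝ[X]} {m : ℕ} (hf : f.natDegree ≤ m)
    (hg : g.natDegree ≤ m) (hfg : ∀ U W, S.ellipse.GenericPt U W → aeval U f = aeval W g) :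
    ∃ (R : ℕ → ℕ → MvPolynomial (Fin 2) ℝ) (F G : ℕ → ℕ → ℝ[X]),
      IsPolyharmonicFamily S (inU f) (inU g) (fun n k => form (R (n - 1) k))
        (fun n k => inU (F (n - 1) k)) (fun n k => inU (G (n - 1) k)) ∧
      (∀ n k, (R n k = 0 ∨ (R n k).totalDegree + 2 ≤ k * m + 2 * n) ∧
        S.orbitSum (xx * yy * form (R n k)) = 0 ∧
        timesXY (R n k) = aeval (MvPolynomial.X 0) (F n k) + aeval (MvPolynomial.X 1) (G n k) +
          S.ellipse.poly * R (n + 1) k) ∧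
      ∀ k, S.laplacian (coeffs (expand (MvPolynomial.X 0 ^ 2 * MvPolynomial.X 1 ^ 2 * R 0 k))) =
        0 := by
  -- `d₀ = ω(X_+(0))`
  set d₀ := subst (inU g) (0 : ℝ) with hd₀
  have hcomp : ∀ (k : ℕ) (p : ℝ[X]), p.natDegree ≤ m →
      ((basisPoly d₀ k).comp p).natDegree ≤ k * m := fun k p hp =>
    natDegree_comp_le.trans (Nat.mul_le_mul (natDegree_basisPoly_le d₀ k) hp)
  choose R₀ h1 h2 h3 h4 using fun k => exists_harmonic hfin (hcomp k f hf) (hcomp k g hg)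
    (fun U W h => by rw [aeval_comp, aeval_comp, hfg U W h])
  choose R F G hR0 hR using fun k => exists_tower hfin (h2 k) (h3 k)
  refine ⟨fun n k => R k n, fun n k => F k n, fun n k => G k n, ?_, ?_, ?_⟩
  · refine ⟨?_, ?_, ?_, ?_, ?_⟩
    · rw [algebraMap_inU, subst_inU Xplus_ne_one, hfg _ _ genericPt_Xplus]
    · intro k
      change form (R k 0) = _
      rw [subst_inU_comp _ _ xx_ne_one, subst_inU_comp _ _ yy_ne_one, h1, hR0]
    · intro n k _
      exact (hR k (n - 1)).2.2.1
    · intro n k _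
      exact (hR k (n - 1)).2.2.2.1
    · intro n k hn
      have e := step_form (hR k (n - 1)).2.2.2.2
      rw [Nat.sub_add_cancel hn] at e
      rw [eq_div_iff S.K_ne_zero, e, Nat.add_sub_cancel, mul_comm]
  · exact fun n k => ⟨(hR k n).1, (hR k n).2.1, (hR k n).2.2.2.2⟩
  · intro k
    change S.laplacian (coeffs (expand (_ * R k 0))) = 0
    rw [hR0]
    exact h4 k

/-- The values of the algebraic functions in the construction determine its rational functions. -/
lemma family_unique {ω ωX ωX' : RatFunc ℝ} {H H' : ℕ → ℕ → RatXY}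
    {F F' G G' : ℕ → ℕ → RatFunc ℝ}
    (h : IsPolyharmonicFamily S ω ωX H F G) (h' : IsPolyharmonicFamily S ω ωX' H' F' G')
    (n k : ℕ) (hn : 1 ≤ n) : H n k = H' n k ∧ F n k = F' n k := by
  have hX : ωX = ωX' :=
    (algebraMap (RatFunc ℝ) AlgFun).injective (h.omegaX.trans h'.omegaX.symm)
  subst hX
  have hF : ∀ n, 1 ≤ n → H n k = H' n k → F n k = F' n k := by
    intro n hn e
    have h1 := h.decoupling n k hn
    rw [e] at h1
    exact h1.unique (h'.decoupling n k hn)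
  have hH : H n k = H' n k := by
    induction n, hn using Nat.le_induction with
    | base => rw [h.harmonic, h'.harmonic]
    | succ n hn ih =>
      have e := hF n hn ih
      have h1 : S.IsBracket (H n k) (F n k) (G n k) := h.bracket n k hn
      rw [ih, e] at h1
      rw [h.step n k hn, h'.step n k hn, ih, e, h1.unique (h'.bracket n k hn)]
  exact ⟨hH, hF n hn hH⟩

end StepModel

end

end QuadrantWalk

theorem mainTheorem1 (S : QuadrantWalk.StepModel) (hfin : Finite S.group)
    (m : ℕ) (hm : Real.pi / S.theta = m) (C₀ : ℝ) (hC₀ : C₀ ≠ 0)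
    (ω : RatFunc ℝ) (hω : ω = RatFunc.C C₀ * S.omega m) :
    -- the basic properties of the conformal gluing function
    (QuadrantWalk.subst ω (0 : ℝ) = 0 ∧
      QuadrantWalk.subst ω S.Xplus = QuadrantWalk.subst ω S.Xminus ∧
      ∃ g : Polynomial ℝ, g.eval 1 ≠ 0 ∧
        ω = algebraMap (Polynomial ℝ) (RatFunc ℝ) g / (1 - RatFunc.X) ^ m) ∧
    -- the inductive construction is possible
    (∃ (ωX : RatFunc ℝ) (H : ℕ → ℕ → QuadrantWalk.RatXY) (F G : ℕ → ℕ → RatFunc ℝ),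
      QuadrantWalk.IsPolyharmonicFamily S ω ωX H F G) ∧
    -- and it has the following properties
    ∀ (ωX : RatFunc ℝ) (H : ℕ → ℕ → QuadrantWalk.RatXY) (F G : ℕ → ℕ → RatFunc ℝ),
      QuadrantWalk.IsPolyharmonicFamily S ω ωX H F G →
      (∀ n k, 1 ≤ n → S.IsDecoupling (QuadrantWalk.xx * QuadrantWalk.yy * H n k) (F n k)) ∧
      (∃ h : ℕ → ℕ → ℕ → ℕ → ℝ, ∀ n k, 1 ≤ n →
        QuadrantWalk.IsGeneratingFunction (H n k) (h n k) ∧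
        S.IsPolyharmonic n (h n k) ∧
        S.laplacian (h (n + 1) k) = h n k) ∧
      (∀ n k, 1 ≤ n → S.orbitSum (QuadrantWalk.xx * QuadrantWalk.yy * H n k) = 0) ∧
      (∀ n k, 1 ≤ n → ∃ P : MvPolynomial (Fin 2) ℝ,
        H n k = algebraMap (MvPolynomial (Fin 2) ℝ) QuadrantWalk.RatXY P /
          ((1 - QuadrantWalk.xx) ^ (k * m + 2 * (n - 1)) *
            (1 - QuadrantWalk.yy) ^ (k * m + 2 * (n - 1)))) := by
  obtain ⟨f, g, hf, hf0, hfm, hgm, hf1, hfg⟩ := S.exists_gluing hm hC₀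
  rw [← hω] at hf
  subst hf
  obtain ⟨R, F₀, G₀, hfam, hR, hharm⟩ := QuadrantWalk.StepModel.exists_family hfin hfm.le hgm hfg
  refine ⟨⟨?_, ?_, ?_⟩, ⟨_, _, _, _, hfam⟩, ?_⟩
  · rw [QuadrantWalk.subst_inU zero_ne_one, zero_sub, inv_neg, inv_one,
      Polynomial.coe_aeval_eq_eval, hf1]
  · have hp := QuadrantWalk.StepModel.genericPt_Xplus (S := S)
    have hX : S.Xminus - 1 ≠ 0 := by
      rw [QuadrantWalk.StepModel.Xminus_eq, add_sub_cancel_left]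
      exact inv_ne_zero hp.reflU.left.ne_zero
    rw [QuadrantWalk.subst_inU QuadrantWalk.StepModel.Xplus_ne_one,
      QuadrantWalk.subst_inU (sub_ne_zero.mp hX), hfg _ _ hp,
      QuadrantWalk.StepModel.Xminus_eq, add_sub_cancel_left, inv_inv, hfg _ _ hp.reflU]
  · obtain ⟨q, hq, e⟩ := QuadrantWalk.inU_eq_div_one_sub_pow hf0
    rw [hfm] at e
    exact ⟨q, hq, e⟩
  · intro ωX H F G h
    have key := QuadrantWalk.StepModel.family_unique h hfam
    have hlap : ∀ n k, 1 ≤ n → S.laplacian (QuadrantWalk.coeffs (QuadrantWalk.expand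
        (MvPolynomial.X 0 ^ 2 * MvPolynomial.X 1 ^ 2 * R n k))) =
          QuadrantWalk.coeffs (QuadrantWalk.expand
            (MvPolynomial.X 0 ^ 2 * MvPolynomial.X 1 ^ 2 * R (n - 1) k)) := by
      intro n k hn
      have h1 := QuadrantWalk.StepModel.laplacian_of_step (hR (n - 1) k).2.2
      rwa [Nat.sub_add_cancel hn] at h1
    refine ⟨?_, ?_, ?_, ?_⟩
    · intro n k hn
      rw [(key n k hn).1, (key n k hn).2]
      exact QuadrantWalk.StepModel.isDecoupling_of_step (hR (n - 1) k).2.2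
    · refine ⟨fun n k => QuadrantWalk.coeffs (QuadrantWalk.expand
        (MvPolynomial.X 0 ^ 2 * MvPolynomial.X 1 ^ 2 * R (n - 1) k)), fun n k hn => ⟨?_, ?_, ?_⟩⟩
      · rw [(key n k hn).1]
        exact (QuadrantWalk.hasExpansion_embed _).isGeneratingFunction
      · induction n, hn using Nat.le_induction with
        | base => exact hharm k
        | succ n hn ih =>
          change S.laplacian^[n] (S.laplacian
            (QuadrantWalk.coeffs (QuadrantWalk.expand (_ * R n k)))) = 0
          rw [hlap n k hn]
          exact ih
      · exact hlap n k hn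
    · intro n k hn
      rw [(key n k hn).1]
      exact (hR (n - 1) k).2.1
    · intro n k hn
      rw [(key n k hn).1]
      exact QuadrantWalk.StepModel.exists_form_eq_div (hR (n - 1) k).1
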